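/- **Setting.** Consider the 1-D compressible Navier–Stokes equations in Lagrangian coordinates for a polytropic ideal gas, $p=R\theta/v$, $e=c_v\theta$ ($R,c_v>0$), with viscosity $\mu>0$ and heat conductivity $\kappa>0$, written for $U=(v,u,E)$, $E=e+\tfrac12u^2$, as $U_t+F(U)_x=(B(U)U_x)_x$. Fix a constant state $\bar U=(v,u,E)$ with $v>0$ and $e=E-\tfrac12u^2>0$. All coefficients below are evaluated at $\bar U$, with $p=\frac{Re}{c_vv}$, $p_v=-\frac{Re}{c_vv^2}$, $p_e=\frac{R}{c_vv}$, $\theta_e=\frac1{c_v}$, and $$F'=\begin{pmatrix}0&-1&0\\p_v&-p_eu&p_e\\p_vu&p-p_eu^2&p_eu\end{pmatrix},\qquad B=\begin{pmatrix}0&0&0\\0&\frac\mu v&0\\0&\left(\frac\mu v-\frac{\kappa\theta_e}v\right)u&\frac{\kappa\theta_e}v\end{pmatrix}.$$ Put $a=\kappa\theta_e$, $D=\mu-a$, $q=p\,p_e$, and assume $\mu/a<1$. **Approximate eigenvalues.** For positive constants $K_1,K_2,K_3$ let $$\lambda_j^*(\eta)=-\alpha_j^*\eta^2+\beta_j^*+\sum_{k=1}^3\frac{A_{j,k}}{(1+\eta^2)^k}-\frac{K_j}{(1+\eta^2)^4},\qquad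 j=1,2,3,$$ where $\alpha_1^*=0$, $\alpha_2^*=\frac\mu v$, $\alpha_3^*=\frac av$, $\beta_1^*=\frac{vp_v}\mu$, $\beta_2^*=\frac{v(\mu q+ap_v-\mu p_v)}{\mu D}$, $\beta_3^*=-\frac{vq}{D}$ and $$A_{1,1}=-\tfrac{v^3p_v(ap_v+\mu q)}{a\mu^3},\qquad A_{1,2}=\tfrac{v^3p_v\left(\mu^2v^2q^2+2a^2v^2p_v^2+3a\mu v^2qp_v+\mu^2v^2qp_v-a^2\mu^2p_v-a\mu^3q\right)}{a^2\mu^5},$$ $$A_{1,3}=-\tfrac{v^3p_v}{a^3\mu^7}\Big[\mu^3v^4q^3+\mu^2v^2q^2\big(3v^2p_v(2a+\mu)-2a\mu^2\big)+a^3p_v\big(\mu^4+5v^4p_v^2-4\mu^2v^2p_v\big)+\mu q\big(a^2\mu^4+v^4p_v^2(10a^2+4a\mu+\mu^2)-2a\mu^2v^2p_v(3a+\mu)\big)\Big],$$ $$A_{2,1}=\tfrac{v^3}{\mu^3D^3}\big[\mu^3q^2-\mu qp_v(a^2-3a\mu+2\mu^2)+p_v^2D^3\big],$$ $$A_{2,2}=\tfrac{v^3(\mu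 q-Dp_v)}{\mu^5D^5}\big[2\mu^4v^2q^2+\mu qD\big(\mu^3D-v^2p_v(a-2\mu)^2\big)+p_v(2v^2p_v-\mu^2)D^4\big],$$ $$\begin{aligned}A_{2,3}=\tfrac{v^3}{\mu^7D^7}\Big[&5\mu^7v^4q^4+\mu^3v^2q^3D\big(4\mu^4D+v^2p_v(a^3-6a^2\mu+15a\mu^2-20\mu^3)\big)\\&+\mu^2q^2D^2\big(\mu^5D^2+3v^4p_v^2(-2a^3+9a^2\mu-15a\mu^2+10\mu^3)-2\mu^2v^2p_v(-a^3+5a^2\mu-10a\mu^2+6\mu^3)\big)\\&-\mu qp_vD^3\big(\mu^4D^2(2\mu-a)+v^4p_v^2(-10a^3+36a^2\mu-45a\mu^2+20\mu^3)+2\mu^2v^2p_v(3a^3-11a^2\mu+14a\mu^2-6\mu^3)\big)\\&+p_v^2D^7(\mu^4+5v^4p_v^2-4\mu^2v^2p_v)\Big],\end{aligned}$$ $$A_{3,1}=-\tfrac{v^3q(aq-Dp_v)}{aD^3},\qquad A_{3,2}=-\tfrac{v^3q}{a^2D^5}\big[2a^2v^2q^2+qD\big(a^2D+v^2p_v(\mu-4a)\big)+p_vD^2(v^2p_v-aD)\big],$$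 $$\begin{aligned}A_{3,3}=-\tfrac{v^3q}{a^3D^7}\Big[&5a^3v^4q^3-v^2q^2D\big(-4a^3D+v^2p_v(15a^2-6a\mu+\mu^2)\big)\\&+qD^2\big(a^3D^2-3v^4p_v^2(\mu-3a)+2av^2p_v(4a^2-5a\mu+\mu^2)\big)-p_vD^3(v^2p_v-aD)^2\Big].\end{aligned}$$ Call $(K_1,K_2,K_3,\sigma_0,\sigma_0^*)$, all positive and $\sigma_0<1$, *admissible* if in the strip $|\mathrm{Im}\,\eta|<\sigma_0$ the functions $\lambda_j^*$ are analytic, $\sup\mathrm{Re}\,\lambda_1^*<-\sigma_0^*$, $\sup\mathrm{Re}\big(\lambda_2^*+\frac\mu{2v}(\eta^2+1)\big)<-\sigma_0^*$, $\sup\mathrm{Re}\big(\lambda_3^*+\frac{\kappa\theta_e}{2v}(\eta^2+1)\big)<-\sigma_0^*$, and $\inf|\mathrm{Re}(\lambda_k^*-\lambda_j^*)|>0$ for $j\ne k$. **Singular part.** Let $\hat{\mathbb M}_j^*(\eta)=\dfrac{\mathrm{adj}\,(\lambda_j^*I+i\eta F'+\eta^2B)}{\prod_{k\ne j}(\lambda_j^*-\lambda_k^*)}$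 and $\hat{\mathbb G}^{*,j}(\eta,t)=e^{\lambda_j^*t}\hat{\mathbb M}_j^*$. With $\mathcal F^{-1}[g](x)=\frac1{2\pi}\int e^{i\eta x}g(\eta)\,d\eta$ in the sense of tempered distributions, the singular (high-frequency) part of the Green's function of the linearized system $V_t+F'V_x=BV_{xx}$ is $\mathbb G^*=\mathcal F^{-1}\big[\sum_j\hat{\mathbb G}^{*,j}\big]=\sum_{j=1}^3\mathbb G^{*,j}$, $\mathbb G^{*,j}=\mathcal F^{-1}[\hat{\mathbb G}^{*,j}]$. **Constant matrices.** $$M_1^{*,0}=\begin{pmatrix}1&0&0\\0&0&0\\0&0&0\end{pmatrix},\quad M_1^{*,1}=\begin{pmatrix}0&\frac v\mu&0\\-\frac{vp_v}\mu&0&0\\-\frac{uvp_v}\mu&0&0\end{pmatrix},\quad M_1^{*,2}=\begin{pmatrix}-\frac{v^2p_v}{\mu^2}&-\frac{uv^2p_e}{a\mu}&\frac{v^2p_e}{a\mu}\\0&\frac{v^2p_v}{\mu^2}&0\\-\frac{pv^2p_v}{a\mu}&\frac{uv^2p_v}{\mu^2}&0\end{pmatrix},$$ $$M_2^{*,0}=\begin{pmatrix}0&0&0\\0&1&0\\0&u&0\end{pmatrix},\quad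 M_2^{*,1}=\begin{pmatrix}0&-\frac v\mu&0\\\frac{vp_v}\mu&-\frac{uvp_e}D&\frac{vp_e}D\\\frac{uvp_v}\mu&\frac{v(p-u^2p_e)}D&\frac{uvp_e}D\end{pmatrix},\quad M_2^{*,2}=\begin{pmatrix}\frac{v^2p_v}{\mu^2}&-\frac{uv^2p_e}{\mu D}&\frac{v^2p_e}{\mu D}\\0&\frac{v^2(\mu^2q-p_vD^2)}{\mu^2D^2}&0\\-\frac{pv^2p_v}{\mu D}&\frac{uv^2(2\mu^2q-p_vD^2)}{\mu^2D^2}&-\frac{v^2q}{D^2}\end{pmatrix},$$ $$M_2^{*,3}=\begin{pmatrix}0&\frac{v^3r_2}{\mu^3D^2}&0\\-\frac{v^3p_vr_2}{\mu^3D^2}&-\frac{uv^3p_eq_2}{\mu^2D^3}&\frac{v^3p_eq_2}{\mu^2D^3}\\-\frac{uv^3p_vr_2}{\mu^3D^2}&\frac{v^3(p-u^2p_e)q_2}{\mu^2D^3}&\frac{uv^3p_eq_2}{\mu^2D^3}\end{pmatrix},\quad\begin{aligned}r_2&=2p_vD^2+\mu q(a-2\mu),\\q_2&=2\mu^2q-p_v(2\mu^2-3a\mu+a^2),\end{aligned}$$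 $$M_3^{*,0}=\begin{pmatrix}0&0&0\\0&0&0\\0&-u&1\end{pmatrix},\quad M_3^{*,1}=\begin{pmatrix}0&0&0\\0&\frac{uvp_e}D&-\frac{vp_e}D\\0&-\frac{v(p-u^2p_e)}D&-\frac{uvp_e}D\end{pmatrix},\quad M_3^{*,2}=\begin{pmatrix}0&\frac{uv^2p_e}{aD}&-\frac{v^2p_e}{aD}\\0&-\frac{v^2q}{D^2}&0\\\frac{pv^2p_v}{aD}&-\frac{2uv^2q}{D^2}&\frac{v^2q}{D^2}\end{pmatrix},$$ $$M_3^{*,3}=\begin{pmatrix}0&\frac{v^3q}{aD^2}&0\\-\frac{v^3qp_v}{aD^2}&\frac{uv^3p_eq_3}{aD^3}&-\frac{v^3p_eq_3}{aD^3}\\-\frac{uv^3qp_v}{aD^2}&-\frac{v^3(p-u^2p_e)q_3}{aD^3}&-\frac{uv^3p_eq_3}{aD^3}\end{pmatrix},\quad q_3=2aq-Dp_v.$$ **Theorem 4.1.** Admissible constants exist. For every admissible choice, the entries of $\hat{\mathbb G}^{*,j}(\cdot,t)$ are bounded functions on $\mathbb R$ for $t\ge0$, so that $\mathbb G^*=\sum_j\mathbb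 G^{*,j}$ is well defined, and the following holds, where $O(1)e^{-\sigma_0^*t-\sigma_0|x|}$ denotes a matrix-valued function of $x$ all of whose entries are bounded by $Ce^{-\sigma_0^*t-\sigma_0|x|}$, with one constant $C$ independent of $x$ and $t$. (i) For all $t\ge0$, in the sense of distributions in $x$, $$\begin{aligned}\mathbb G^{*,1}&=e^{\frac{vp_v}\mu t}\delta(x)M_1^{*,0}+O(1)e^{-\sigma_0^*t-\sigma_0|x|},\\\partial_x\mathbb G^{*,1}&=e^{\frac{vp_v}\mu t}\big(\delta'(x)M_1^{*,0}-\delta(x)M_1^{*,1}\big)+O(1)e^{-\sigma_0^*t-\sigma_0|x|},\\\partial_x^2\mathbb G^{*,1}&=e^{\frac{vp_v}\mu t}\big(\delta''(x)M_1^{*,0}-\delta'(x)M_1^{*,1}-\delta(x)(M_1^{*,2}+A_{1,1}t\,M_1^{*,0})\big)+O(1)e^{-\sigma_0^*t-\sigma_0|x|}.\end{aligned}$$ (ii) For $j=2,3$ and $t>0$, $\mathbb G^{*,j}(\cdot,t)$ is a smooth function, and for $t\ge1$, $k=0,1,2$ and all $x\in\mathbb R$, $$\partial_x^k\mathbb G^{*,j}(x,t)=O(1)e^{-\sigma_0^*t-\sigma_0|x|}.$$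 (iii) For $j=2,3$, $0<t<1$ and all $x\in\mathbb R$, with $H_j(x,t)=\dfrac{e^{\beta_j^*t}}{\sqrt{4\pi\alpha_j^*t}}e^{-\frac{x^2}{4\alpha_j^*t}}$, $$\begin{aligned}\mathbb G^{*,j}&=H_jM_j^{*,0}+O(1)e^{-\sigma_0^*t-\sigma_0|x|},\\\partial_x\mathbb G^{*,j}&=\partial_xH_jM_j^{*,0}-H_jM_j^{*,1}+O(1)e^{-\sigma_0^*t-\sigma_0|x|},\\\partial_x^2\mathbb G^{*,j}&=\partial_x^2H_jM_j^{*,0}-\partial_xH_jM_j^{*,1}-H_jM_j^{*,2}+O(1)e^{-\sigma_0^*t-\sigma_0|x|},\\\partial_x^3\mathbb G^{*,j}&=\partial_x^3H_jM_j^{*,0}-\partial_x^2H_jM_j^{*,1}-\partial_xH_jM_j^{*,2}+H_jM_j^{*,3}+O(1)e^{-\sigma_0^*t-\sigma_0|x|}.\end{aligned}$$ -/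

import Mathlib

open MeasureTheory
open scoped FourierTransform ENNReal ContDiff

noncomputable section

/-- A constant state `(v, u, E)` of a viscous, heat conducting, polytropic ideal gas in Lagrangian
coordinates (specific volume, velocity, specific total energy), together with the physical
constants: the gas constant `R` in `p = R θ / v`, the heat capacity `cv` in `e = cv θ`, the
viscosity `mu` and the heat conductivity `kap`. The internal energy is `e = E - u ^ 2 / 2`.
The last field is the Prandtl number condition `mu / (kap θ_e) < 1`, where `θ_e = 1 / cv`. -/
structure GasState where
  R : ℝ
  cv : ℝ
  mu : ℝ
  kap : ℝ
  v : ℝ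
  u : ℝ
  E : ℝ
  R_pos : 0 < R
  cv_pos : 0 < cv
  mu_pos : 0 < mu
  kap_pos : 0 < kap
  v_pos : 0 < v
  e_pos : 0 < E - u ^ 2 / 2
  prandtl : mu / (kap * (1 / cv)) < 1

namespace GasState

variable (S : GasState)

/-- Specific internal energy. -/
def e : ℝ := S.E - S.u ^ 2 / 2

/-- The pressure law `p(v, e) = R θ / v` with `θ = e / cv`. -/
def pressure (v e : ℝ) : ℝ := S.R * (e / S.cv) / v

/-- Pressure at the state. -/
def p : ℝ := S.pressure S.v S.e

/-- `∂p/∂v` at the state. -/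
def pv : ℝ := -(S.R * (S.e / S.cv)) / S.v ^ 2

/-- `∂p/∂e` at the state. -/
def pe : ℝ := S.R / (S.cv * S.v)

/-- `∂θ/∂e`. -/
def te : ℝ := 1 / S.cv

theorem hasDerivAt_pressure_v : HasDerivAt (fun v => S.pressure v S.e) S.pv S.v := by
  have h := (hasDerivAt_inv S.v_pos.ne').const_mul (S.R * (S.e / S.cv))
  have h2 : S.pv = S.R * (S.e / S.cv) * -(S.v ^ 2)⁻¹ := by
    unfold pv; ring
  rw [h2]
  exact h

theorem hasDerivAt_pressure_e : HasDerivAt (fun e => S.pressure S.v e) S.pe S.e := by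
  have h := (((hasDerivAt_id S.e).div_const S.cv).const_mul S.R).div_const S.v
  have h2 : S.pe = S.R * (1 / S.cv) / S.v := by
    unfold pe
    rw [mul_one_div, div_div]
  rw [h2]
  exact h

/-- The Jacobian matrix at the state of the flux `F(v, u, E) = (-u, p, p u)`. -/
def fluxJac : Matrix (Fin 3) (Fin 3) ℝ :=
  !![0, -1, 0;
     S.pv, -S.pe * S.u, S.pe;
     S.pv * S.u, S.p - S.pe * S.u ^ 2, S.pe * S.u]

/-- The viscosity matrix at the state. -/
def visc : Matrix (Fin 3) (Fin 3) ℝ :=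
  !![0, 0, 0;
     0, S.mu / S.v, 0;
     0, (S.mu / S.v - S.kap * S.te / S.v) * S.u, S.kap * S.te / S.v]

/-! ### The approximate eigenvalues

The indices `1, 2, 3` of the three modes are `0, 1, 2 : Fin 3` here, and likewise for the
coefficients `A_{j,k}`, `k = 1, 2, 3`. -/

/-- Diffusivities of the three modes. -/
def alpha : Fin 3 → ℝ := ![0, S.mu / S.v, S.kap * S.te / S.v]

/-- Constant terms of the three approximate eigenvalues. -/
def beta : Fin 3 → ℝ :=
  ![S.v * S.pv / S.mu,
    S.v * (S.mu * S.p * S.pe + S.kap * S.te * S.pv - S.mu * S.pv)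
      / (S.mu * (S.mu - S.kap * S.te)),
    S.p * S.v * S.pe / (S.kap * S.te - S.mu)]

def A11 : ℝ :=
  -(S.v ^ 3 * (S.kap * S.te * S.pv ^ 2 + S.mu * S.p * S.pe * S.pv))
    / (S.kap * S.mu ^ 3 * S.te)

def A12 : ℝ :=
  S.v ^ 3 * (S.mu ^ 2 * S.p ^ 2 * S.v ^ 2 * S.pe ^ 2 * S.pv
      + 2 * S.kap ^ 2 * S.v ^ 2 * S.te ^ 2 * S.pv ^ 3
      + 3 * S.kap * S.mu * S.p * S.v ^ 2 * S.te * S.pe * S.pv ^ 2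
      + S.mu ^ 2 * S.p * S.v ^ 2 * S.pe * S.pv ^ 2
      - S.kap ^ 2 * S.mu ^ 2 * S.te ^ 2 * S.pv ^ 2
      - S.kap * S.mu ^ 3 * S.p * S.te * S.pe * S.pv)
    / (S.kap ^ 2 * S.mu ^ 5 * S.te ^ 2)

def A13 : ℝ :=
  -(S.v ^ 3 * S.pv * (S.mu ^ 3 * S.p ^ 3 * S.v ^ 4 * S.pe ^ 3
      + S.mu ^ 2 * S.p ^ 2 * S.v ^ 2 * S.pe ^ 2
        * (3 * S.v ^ 2 * S.pv * (2 * S.kap * S.te + S.mu) - 2 * S.kap * S.mu ^ 2 * S.te)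
      + S.kap ^ 3 * S.te ^ 3 * S.pv
        * (S.mu ^ 4 + 5 * S.v ^ 4 * S.pv ^ 2 - 4 * S.mu ^ 2 * S.v ^ 2 * S.pv)
      + S.mu * S.p * S.pe * (S.kap ^ 2 * S.mu ^ 4 * S.te ^ 2
        + S.v ^ 4 * S.pv ^ 2
          * (10 * S.kap ^ 2 * S.te ^ 2 + 4 * S.kap * S.mu * S.te + S.mu ^ 2)
        - 2 * S.kap * S.mu ^ 2 * S.v ^ 2 * S.te * S.pv * (3 * S.kap * S.te + S.mu))))
    / (S.kap ^ 3 * S.mu ^ 7 * S.te ^ 3)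

def A21 : ℝ :=
  S.v ^ 3 * (S.mu ^ 3 * S.p ^ 2 * S.pe ^ 2
      - S.mu * S.p * S.pe * S.pv
        * (S.kap ^ 2 * S.te ^ 2 - 3 * S.kap * S.mu * S.te + 2 * S.mu ^ 2)
      + S.pv ^ 2 * (S.mu - S.kap * S.te) ^ 3)
    / (S.mu ^ 3 * (S.mu - S.kap * S.te) ^ 3)

def A22 : ℝ :=
  S.v ^ 3 * (S.mu * S.p * S.pe + S.pv * (S.kap * S.te - S.mu))
    * (2 * S.mu ^ 4 * S.p ^ 2 * S.v ^ 2 * S.pe ^ 2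
      + S.mu * S.p * S.pe * (S.mu - S.kap * S.te)
        * (S.mu ^ 3 * (S.mu - S.kap * S.te)
          - S.v ^ 2 * S.pv * (S.kap * S.te - 2 * S.mu) ^ 2)
      + S.pv * (2 * S.v ^ 2 * S.pv - S.mu ^ 2) * (S.mu - S.kap * S.te) ^ 4)
    / (S.mu ^ 5 * (S.mu - S.kap * S.te) ^ 5)

def A23 : ℝ :=
  S.v ^ 3 * (5 * S.mu ^ 7 * S.p ^ 4 * S.v ^ 4 * S.pe ^ 4
      + S.mu ^ 3 * S.p ^ 3 * S.v ^ 2 * S.pe ^ 3 * (S.mu - S.kap * S.te)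
        * (4 * S.mu ^ 4 * (S.mu - S.kap * S.te)
          + S.v ^ 2 * S.pv * (S.kap ^ 3 * S.te ^ 3 - 6 * S.kap ^ 2 * S.mu * S.te ^ 2
            + 15 * S.kap * S.mu ^ 2 * S.te - 20 * S.mu ^ 3))
      + S.mu ^ 2 * S.p ^ 2 * S.pe ^ 2 * (S.mu - S.kap * S.te) ^ 2
        * (S.mu ^ 5 * (S.mu - S.kap * S.te) ^ 2
          + 3 * S.v ^ 4 * S.pv ^ 2 * (-2 * S.kap ^ 3 * S.te ^ 3
            + 9 * S.kap ^ 2 * S.mu * S.te ^ 2 - 15 * S.kap * S.mu ^ 2 * S.te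
            + 10 * S.mu ^ 3)
          - 2 * S.mu ^ 2 * S.v ^ 2 * S.pv * (-(S.kap ^ 3 * S.te ^ 3)
            + 5 * S.kap ^ 2 * S.mu * S.te ^ 2 - 10 * S.kap * S.mu ^ 2 * S.te
            + 6 * S.mu ^ 3))
      - S.mu * S.p * S.pe * S.pv * (S.mu - S.kap * S.te) ^ 3
        * (S.mu ^ 4 * (S.mu - S.kap * S.te) ^ 2 * (2 * S.mu - S.kap * S.te)
          + S.v ^ 4 * S.pv ^ 2 * (-10 * S.kap ^ 3 * S.te ^ 3
            + 36 * S.kap ^ 2 * S.mu * S.te ^ 2 - 45 * S.kap * S.mu ^ 2 * S.te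
            + 20 * S.mu ^ 3)
          + 2 * S.mu ^ 2 * S.v ^ 2 * S.pv * (3 * S.kap ^ 3 * S.te ^ 3
            - 11 * S.kap ^ 2 * S.mu * S.te ^ 2 + 14 * S.kap * S.mu ^ 2 * S.te
            - 6 * S.mu ^ 3))
      + S.pv ^ 2 * (S.mu ^ 4 + 5 * S.v ^ 4 * S.pv ^ 2 - 4 * S.mu ^ 2 * S.v ^ 2 * S.pv)
        * (S.mu - S.kap * S.te) ^ 7)
    / (S.mu ^ 7 * (S.mu - S.kap * S.te) ^ 7)

def A31 : ℝ :=
  S.p * S.v ^ 3 * S.pe * (S.kap * S.p * S.te * S.pe + S.pv * (S.kap * S.te - S.mu))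
    / (S.kap * S.te * (S.kap * S.te - S.mu) ^ 3)

def A32 : ℝ :=
  S.p * S.v ^ 3 * S.pe * (2 * S.kap ^ 2 * S.p ^ 2 * S.v ^ 2 * S.te ^ 2 * S.pe ^ 2
      + S.p * S.pe * (S.mu - S.kap * S.te)
        * (S.kap ^ 2 * S.te ^ 2 * (S.mu - S.kap * S.te)
          + S.v ^ 2 * S.pv * (S.mu - 4 * S.kap * S.te))
      + S.pv * (S.mu - S.kap * S.te) ^ 2
        * (S.kap * S.te * (S.kap * S.te - S.mu) + S.v ^ 2 * S.pv))
    / (S.kap ^ 2 * S.te ^ 2 * (S.kap * S.te - S.mu) ^ 5)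

def A33 : ℝ :=
  S.p * S.v ^ 3 * S.pe * (5 * S.kap ^ 3 * S.p ^ 3 * S.v ^ 4 * S.te ^ 3 * S.pe ^ 3
      - S.p ^ 2 * S.v ^ 2 * S.pe ^ 2 * (S.mu - S.kap * S.te)
        * (4 * S.kap ^ 3 * S.te ^ 3 * (S.kap * S.te - S.mu)
          + S.v ^ 2 * S.pv * (15 * S.kap ^ 2 * S.te ^ 2 - 6 * S.kap * S.mu * S.te + S.mu ^ 2))
      + S.p * S.pe * (S.mu - S.kap * S.te) ^ 2
        * (S.kap ^ 3 * S.te ^ 3 * (S.mu - S.kap * S.te) ^ 2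
          - 3 * S.v ^ 4 * S.pv ^ 2 * (S.mu - 3 * S.kap * S.te)
          + 2 * S.kap * S.v ^ 2 * S.te * S.pv
            * (4 * S.kap ^ 2 * S.te ^ 2 - 5 * S.kap * S.mu * S.te + S.mu ^ 2))
      - S.pv * (S.mu - S.kap * S.te) ^ 3
        * (S.kap * S.te * (S.kap * S.te - S.mu) + S.v ^ 2 * S.pv) ^ 2)
    / (S.kap ^ 3 * S.te ^ 3 * (S.kap * S.te - S.mu) ^ 7)

/-- The coefficients `A_{j,k}`. -/
def A : Fin 3 → Fin 3 → ℝ :=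
  ![![S.A11, S.A12, S.A13], ![S.A21, S.A22, S.A23], ![S.A31, S.A32, S.A33]]

/-- The approximate eigenvalue
`λ_j^* = -α_j η² + β_j + ∑_{k=1}^3 A_{j,k} / (1 + η²)^k - K_j / (1 + η²)^4`. -/
def lamStar (K : Fin 3 → ℝ) (j : Fin 3) (η : ℂ) : ℂ :=
  -(S.alpha j : ℂ) * η ^ 2 + (S.beta j : ℂ)
    + ∑ k : Fin 3, (S.A j k : ℂ) / (1 + η ^ 2) ^ ((k : ℕ) + 1)
    - (K j : ℂ) / (1 + η ^ 2) ^ 4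

/-- The open strip `|Im η| < σ`. -/
def strip (σ : ℝ) : Set ℂ := {η | |η.im| < σ}

/-- The constants `K = (K_1, K_2, K_3)`, `σ₀`, `σ₀^*` are admissible: in the strip `|Im η| < σ₀`
the approximate eigenvalues are analytic, have negative real parts with the quantitative bounds
`sup Re λ_1^* < -σ₀^*`, `sup Re (λ_j^* + (α_j / 2) (η² + 1)) < -σ₀^*` for `j = 2, 3`,
and their real parts are uniformly separated. -/
structure Admissible (K : Fin 3 → ℝ) (σ₀ σs : ℝ) : Prop where
  K_pos : ∀ j, 0 < K j
  sigma_pos : 0 < σ₀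
  sigma_lt_one : σ₀ < 1
  sigmaStar_pos : 0 < σs
  analytic : ∀ j, DifferentiableOn ℂ (S.lamStar K j) (strip σ₀)
  gap_one : ∃ m < -σs, ∀ η ∈ strip σ₀, (S.lamStar K 0 η).re ≤ m
  gap_two : ∃ m < -σs, ∀ η ∈ strip σ₀,
    (S.lamStar K 1 η + ((S.mu / (2 * S.v) : ℝ) : ℂ) * (η ^ 2 + 1)).re ≤ m
  gap_three : ∃ m < -σs, ∀ η ∈ strip σ₀,
    (S.lamStar K 2 η + ((S.kap * S.te / (2 * S.v) : ℝ) : ℂ) * (η ^ 2 + 1)).re ≤ m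
  separated : ∃ σ₁ > 0, ∀ j k, j ≠ k → ∀ η ∈ strip σ₀,
    σ₁ ≤ |(S.lamStar K k η - S.lamStar K j η).re|

/-! ### The singular part of the Green's function -/

/-- `s I + i η F' + η² B`. -/
def symbol (s η : ℂ) : Matrix (Fin 3) (Fin 3) ℂ :=
  s • (1 : Matrix (Fin 3) (Fin 3) ℂ) + (Complex.I * η) • S.fluxJac.map (fun r => (r : ℂ))
    + η ^ 2 • S.visc.map (fun r => (r : ℂ))

/-- `M̂_j^* = adj(s I + i η F' + η² B) |_{s = λ_j^*} / ∏_{k ≠ j} (λ_j^* - λ_k^*)`. -/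
def MhatStar (K : Fin 3 → ℝ) (j : Fin 3) (η : ℂ) : Matrix (Fin 3) (Fin 3) ℂ :=
  (∏ k ∈ Finset.univ.erase j, (S.lamStar K j η - S.lamStar K k η))⁻¹ •
    (S.symbol (S.lamStar K j η) η).adjugate

/-- `Ĝ^{*,j}(η, t) = e^{λ_j^* t} M̂_j^*`. -/
def GhatStar (K : Fin 3 → ℝ) (j : Fin 3) (t : ℝ) (η : ℂ) : Matrix (Fin 3) (Fin 3) ℂ :=
  Complex.exp (S.lamStar K j η * t) • S.MhatStar K j η

end GasState

/-- The tempered distribution `φ ↦ ∫ g φ` given by a bounded measurable function `g`. -/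
def distOf (g : ℝ → ℂ) : TemperedDistribution ℝ ℂ :=
  open Classical in
  if h : MemLp g ∞ volume then Lp.toTemperedDistribution (h.toLp g) else 0

/-- The inverse Fourier transform, in the convention `f(x) = (2π)⁻¹ ∫ e^{i η x} g(η) dη`, of a
bounded measurable function `g`, as a tempered distribution. In Mathlib's convention it is the
inverse transform of `ξ ↦ g (2 π ξ)`. -/
def invFourierDist (g : ℝ → ℂ) : TemperedDistribution ℝ ℂ :=
  𝓕⁻ (distOf fun ξ => g (2 * Real.pi * ξ))

/-- `3 × 3` matrices of tempered distributions on the line. -/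
abbrev MatDist := Matrix (Fin 3) (Fin 3) (TemperedDistribution ℝ ℂ)

/-- The `k`-th distributional derivative, entry by entry. -/
def dxDist (k : ℕ) (T : MatDist) : MatDist :=
  T.map fun f => (TemperedDistribution.derivCLM ℂ)^[k] f

/-- The distribution `δ^{(k)}(x) M` for a constant matrix `M`. -/
def deltaDist (k : ℕ) (M : Matrix (Fin 3) (Fin 3) ℝ) : MatDist :=
  Matrix.of fun a b =>
    (M a b : ℂ) • (TemperedDistribution.derivCLM ℂ)^[k] (TemperedDistribution.delta (0 : ℝ))

/-- The matrix of distributions given by a matrix of bounded measurable functions. -/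
def matDistOf (g : ℝ → Matrix (Fin 3) (Fin 3) ℂ) : MatDist :=
  Matrix.of fun a b => distOf fun x => g x a b

/-- `e^{β t} (4 π α t)^{-1/2} e^{-x² / (4 α t)}`. -/
def heatKer (α β t x : ℝ) : ℝ :=
  Real.exp (β * t) / Real.sqrt (4 * Real.pi * α * t) * Real.exp (-x ^ 2 / (4 * α * t))

namespace GasState

variable (S : GasState)

/-- The part `G^{*,j}(·, t)` of the singular part of the Green's function. -/
def greenStarPart (K : Fin 3 → ℝ) (j : Fin 3) (t : ℝ) : MatDist :=
  Matrix.of fun a b => invFourierDist fun η => S.GhatStar K j t (η : ℂ) a b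

/-- The singular part `G^*(·, t)` of the Green's function, with Fourier transform
`∑_j Ĝ^{*,j}`. -/
def greenStar (K : Fin 3 → ℝ) (t : ℝ) : MatDist :=
  Matrix.of fun a b => invFourierDist fun η => (∑ j, S.GhatStar K j t (η : ℂ)) a b

/-- The heat kernel with diffusivity `α_j` and growth factor `e^{β_j t}`. -/
def heat (j : Fin 3) (t x : ℝ) : ℝ := heatKer (S.alpha j) (S.beta j) t x

/-! ### The constant matrices `M_j^{*,k}`

They are the coefficients in the expansion
`M̂_j^* = M_j^{*,0} + i η⁻¹ M_j^{*,1} + η⁻² M_j^{*,2} + i η⁻³ M_j^{*,3} + O(η⁻⁴)` at infinity. -/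

def M10 : Matrix (Fin 3) (Fin 3) ℝ := !![1, 0, 0; 0, 0, 0; 0, 0, 0]

def M11 : Matrix (Fin 3) (Fin 3) ℝ :=
  !![0, S.v / S.mu, 0;
     -(S.v * S.pv) / S.mu, 0, 0;
     -(S.u * S.v * S.pv) / S.mu, 0, 0]

def M12 : Matrix (Fin 3) (Fin 3) ℝ :=
  !![-(S.v ^ 2 * S.pv) / S.mu ^ 2, -(S.u * S.v ^ 2 * S.pe) / (S.kap * S.mu * S.te),
       S.v ^ 2 * S.pe / (S.kap * S.mu * S.te);
     0, S.v ^ 2 * S.pv / S.mu ^ 2, 0;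
     -(S.p * S.v ^ 2 * S.pv) / (S.kap * S.mu * S.te), S.u * S.v ^ 2 * S.pv / S.mu ^ 2, 0]

def M13 : Matrix (Fin 3) (Fin 3) ℝ :=
  !![0,
       -(S.v ^ 3 * (S.p * S.mu * S.pe + 2 * S.kap * S.pv * S.te)) / (S.kap * S.mu ^ 3 * S.te),
       0;
     S.v ^ 3 * S.pv * (S.p * S.mu * S.pe + 2 * S.kap * S.pv * S.te)
         / (S.kap * S.mu ^ 3 * S.te),
       S.u * S.v ^ 3 * S.pe * S.pv / (S.kap * S.mu ^ 2 * S.te),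
       -(S.v ^ 3 * S.pe * S.pv) / (S.kap * S.mu ^ 2 * S.te);
     S.u * S.v ^ 3 * S.pv * (S.p * S.mu * S.pe + 2 * S.kap * S.pv * S.te)
         / (S.kap * S.mu ^ 3 * S.te),
       -(S.v ^ 3 * (S.p * S.pv - S.u ^ 2 * S.pe * S.pv)) / (S.kap * S.mu ^ 2 * S.te),
       -(S.u * S.v ^ 3 * S.pe * S.pv) / (S.kap * S.mu ^ 2 * S.te)]

def M20 : Matrix (Fin 3) (Fin 3) ℝ := !![0, 0, 0; 0, 1, 0; 0, S.u, 0]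

def M21 : Matrix (Fin 3) (Fin 3) ℝ :=
  !![0, -S.v / S.mu, 0;
     S.v * S.pv / S.mu, -(S.u * S.v * S.pe) / (S.mu - S.kap * S.te),
       S.v * S.pe / (S.mu - S.kap * S.te);
     S.u * S.v * S.pv / S.mu, S.v * (S.p - S.u ^ 2 * S.pe) / (S.mu - S.kap * S.te),
       S.u * S.v * S.pe / (S.mu - S.kap * S.te)]

def M22 : Matrix (Fin 3) (Fin 3) ℝ :=
  !![S.v ^ 2 * S.pv / S.mu ^ 2,
       -(S.u * S.v ^ 2 * S.pe) / (S.mu ^ 2 - S.kap * S.mu * S.te),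
       S.v ^ 2 * S.pe / (S.mu ^ 2 - S.kap * S.mu * S.te);
     0,
       S.v ^ 2 * (S.p * S.mu ^ 2 * S.pe - S.pv * (S.mu - S.kap * S.te) ^ 2)
         / (S.mu ^ 2 * (S.mu - S.kap * S.te) ^ 2),
       0;
     -(S.p * S.v ^ 2 * S.pv) / (S.mu ^ 2 - S.kap * S.mu * S.te),
       S.u * S.v ^ 2 * (2 * S.p * S.mu ^ 2 * S.pe - S.pv * (S.mu - S.kap * S.te) ^ 2)
         / (S.mu ^ 2 * (S.mu - S.kap * S.te) ^ 2),
       -(S.p * S.v ^ 2 * S.pe) / (S.mu - S.kap * S.te) ^ 2]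

/-- A combination that occurs in several entries of `M_2^{*,3}`. -/
def q2 : ℝ :=
  2 * S.p * S.mu ^ 2 * S.pe
    - S.pv * (2 * S.mu ^ 2 - 3 * S.kap * S.te * S.mu + S.kap ^ 2 * S.te ^ 2)

/-- Another combination that occurs in several entries of `M_2^{*,3}`. -/
def r2 : ℝ :=
  2 * S.pv * (S.mu - S.kap * S.te) ^ 2 + S.p * S.mu * S.pe * (S.kap * S.te - 2 * S.mu)

def M23 : Matrix (Fin 3) (Fin 3) ℝ :=
  !![0, S.v ^ 3 * S.r2 / (S.mu ^ 3 * (S.mu - S.kap * S.te) ^ 2), 0;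
     -(S.v ^ 3 * S.pv * S.r2) / (S.mu ^ 3 * (S.mu - S.kap * S.te) ^ 2),
       -(S.u * S.v ^ 3 * S.pe * S.q2) / (S.mu ^ 2 * (S.mu - S.kap * S.te) ^ 3),
       S.v ^ 3 * S.pe * S.q2 / (S.mu ^ 2 * (S.mu - S.kap * S.te) ^ 3);
     -(S.u * S.v ^ 3 * S.pv * S.r2) / (S.mu ^ 3 * (S.mu - S.kap * S.te) ^ 2),
       S.v ^ 3 * (S.p - S.u ^ 2 * S.pe) * S.q2 / (S.mu ^ 2 * (S.mu - S.kap * S.te) ^ 3),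
       S.u * S.v ^ 3 * S.pe * S.q2 / (S.mu ^ 2 * (S.mu - S.kap * S.te) ^ 3)]

def M30 : Matrix (Fin 3) (Fin 3) ℝ := !![0, 0, 0; 0, 0, 0; 0, -S.u, 1]

def M31 : Matrix (Fin 3) (Fin 3) ℝ :=
  !![0, 0, 0;
     0, S.u * S.v * S.pe / (S.mu - S.kap * S.te), -(S.v * S.pe) / (S.mu - S.kap * S.te);
     0, -(S.v * (S.p - S.u ^ 2 * S.pe)) / (S.mu - S.kap * S.te),
       -(S.u * S.v * S.pe) / (S.mu - S.kap * S.te)]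

def M32 : Matrix (Fin 3) (Fin 3) ℝ :=
  !![0, S.u * S.v ^ 2 * S.pe / (S.kap * S.te * (S.mu - S.kap * S.te)),
       -(S.v ^ 2 * S.pe) / (S.kap * S.te * (S.mu - S.kap * S.te));
     0, -(S.p * S.v ^ 2 * S.pe) / (S.mu - S.kap * S.te) ^ 2, 0;
     S.p * S.v ^ 2 * S.pv / (S.kap * S.te * (S.mu - S.kap * S.te)),
       -(2 * S.p * S.u * S.v ^ 2 * S.pe) / (S.mu - S.kap * S.te) ^ 2,
       S.p * S.v ^ 2 * S.pe / (S.mu - S.kap * S.te) ^ 2]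

/-- A combination that occurs in several entries of `M_3^{*,3}`. -/
def q3 : ℝ := 2 * S.p * S.kap * S.pe * S.te + S.pv * (S.kap * S.te - S.mu)

def M33 : Matrix (Fin 3) (Fin 3) ℝ :=
  !![0, S.p * S.v ^ 3 * S.pe / (S.kap * S.te * (S.mu - S.kap * S.te) ^ 2), 0;
     -(S.p * S.v ^ 3 * S.pe * S.pv) / (S.kap * S.te * (S.mu - S.kap * S.te) ^ 2),
       -(S.u * S.v ^ 3 * S.pe * S.q3) / (S.kap * S.te * (S.kap * S.te - S.mu) ^ 3),
       S.v ^ 3 * S.pe * S.q3 / (S.kap * S.te * (S.kap * S.te - S.mu) ^ 3);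
     -(S.p * S.u * S.v ^ 3 * S.pe * S.pv) / (S.kap * S.te * (S.mu - S.kap * S.te) ^ 2),
       S.v ^ 3 * (S.p - S.u ^ 2 * S.pe) * S.q3 / (S.kap * S.te * (S.kap * S.te - S.mu) ^ 3),
       S.u * S.v ^ 3 * S.pe * S.q3 / (S.kap * S.te * (S.kap * S.te - S.mu) ^ 3)]

/-- The matrices `M_j^{*,0}`. -/
def M0 : Fin 3 → Matrix (Fin 3) (Fin 3) ℝ := ![M10, S.M20, S.M30]

/-- The matrices `M_j^{*,1}`. -/
def M1 : Fin 3 → Matrix (Fin 3) (Fin 3) ℝ := ![S.M11, S.M21, S.M31]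

/-- The matrices `M_j^{*,2}`. -/
def M2 : Fin 3 → Matrix (Fin 3) (Fin 3) ℝ := ![S.M12, S.M22, S.M32]

/-- The matrices `M_j^{*,3}`. -/
def M3 : Fin 3 → Matrix (Fin 3) (Fin 3) ℝ := ![S.M13, S.M23, S.M33]

end GasState

/-- `T = main + O(1) e^{-σs t - σ₀ |x|}` with constant `C`: the distribution `T - main` is a
measurable function of `x`, all of whose entries are at most `C e^{-σs t - σ₀ |x|}`. -/
def EqUpToExp (C σ₀ σs t : ℝ) (T main : MatDist) : Prop :=
  ∃ r : ℝ → Matrix (Fin 3) (Fin 3) ℂ,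
    (∀ a b, Measurable fun x => r x a b) ∧
    (∀ x a b, ‖r x a b‖ ≤ C * Real.exp (-σs * t - σ₀ * |x|)) ∧
    T = main + matDistOf r

end

/-!
In the strip `|Im η| < σ₀` the matrices `(iη)^k Ĝ^{*,j}` are analytic, and if an analytic function
there is integrable on all horizontal lines, with a bound uniform in the line, then shifting the
contour shows that its inverse Fourier transform is `O(e^{-σ₀ |x|})` (`norm_invF_le_of_strip`). So
one has to subtract from `(iη)^k Ĝ^{*,j}` what is not integrable, and identify its transform.

At infinity `M̂_j^*` has an expansion in powers of `w = (iη)⁻¹`, because after multiplication of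
`λ_j^*`, `F'` and `B` by the right powers of `w` the numerator and the denominator are analytic at
`w = 0`. Up to the order `w³` the coefficients depend only on the `α_k`, the `β_k`, `F'` and `B`,
and they are the matrices `M_j^{*,l}` up to sign (`GasState.exists_expansion_MhatStar`). Hence
`(iη)^k M̂_j^*` is a polynomial in `iη`, plus a multiple of `(iη)⁻¹`, plus `O(η⁻²)`. The term of order `η⁻¹` is not
integrable; it is replaced by a multiple of `iη / (1 + η²)`, which has no pole in the strip and
whose inverse transform `-sgn(x) e^{-|x|} / 2` is explicit and decays faster than `e^{-σ₀ |x|}`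
(`stripDecay_of_expansion`, `invFourierDist_oddSymbol`).

For the hyperbolic mode `λ_1^* = β_1 + O(η⁻²)`, so the factor `e^{λ_1^* t}` is expanded to first
order around `e^{β_1 t}`. The polynomial gives derivatives of the delta distribution, and
the term `A_{1,1} t M_1^{*,0}` is the first order effect of `λ_1^* - β_1` when `k = 2`. The gap
condition is a strict inequality, so the powers of `t` in the errors are absorbed by
`e^{-σ₀^* t}` (`GasState.Admissible.exists_delta_decomposition`).

For the parabolic modes and `t ≥ 1` the factor `e^{λ_j^* t}` is itself Gaussian in the strip. For
`t < 1` the polynomial is multiplied by the symbol `e^{(-α_j η² + β_j) t}` and gives derivatives of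
the heat kernel. Two errors need a bound uniform as `t → 0`: the multiple of `iη / (1 + η²)` times
the heat symbol, whose transform is the convolution of the heat kernel with the odd exponential
(`norm_invF_oddSymbol_mul_heatSymbol_le`), and the effect of `λ_j^* + α_j η² - β_j`, which is
`O(t (1 + |η|) e^{-c t η²})` and has a bounded integral by scaling
(`integral_mul_one_add_abs_mul_exp_le`).

Admissible constants exist because a large `K₁` makes `Re λ_1^*` negative on the line (at infinity
it tends to `β_1 < 0`), large `K₂ - K₁` and `K₃ - K₂` give the remaining bounds and separate the
three modes, and strict inequalities persist in a narrow strip (`GasState.exists_admissible`).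
-/

noncomputable section

/-! ### The inverse Fourier transform on the line -/

/-- The inverse Fourier transform `x ↦ (2π)⁻¹ ∫ e^{i x η} g(η) dη` of a function on the line,
written as a forward transform in Mathlib's normalization; it is zero if `g` is not integrable. -/
def invF (g : ℝ → ℂ) : ℝ → ℂ := 𝓕 fun ξ : ℝ => g (-2 * Real.pi * ξ)

theorem neg_two_pi_ne_zero : (-2 * Real.pi : ℝ) ≠ 0 := by
  have := Real.pi_pos
  nlinarith

theorem invF_eq_integral (g : ℝ → ℂ) (x : ℝ) :
    invF g x = ((2 * Real.pi)⁻¹ : ℝ) * ∫ η : ℝ, Complex.exp (Complex.I * x * η) * g η := by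
  have h := Measure.integral_comp_mul_left
    (fun η : ℝ => Complex.exp (Complex.I * x * η) * g η) (-2 * Real.pi)
  have hp := Real.pi_pos
  rw [invF, Real.fourier_real_eq_integral_exp_smul]
  rw [show |(-2 * Real.pi)⁻¹| = (2 * Real.pi)⁻¹ by
    rw [abs_inv, abs_of_neg (by linarith)]; congr 1; ring] at h
  rw [← Complex.real_smul, ← h]
  congr 1
  ext ξ
  rw [smul_eq_mul]
  congr 2
  push_cast
  ring

theorem norm_invF_le (g : ℝ → ℂ) (x : ℝ) : ‖invF g x‖ ≤ (2 * Real.pi)⁻¹ * ∫ η, ‖g η‖ := by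
  rw [invF_eq_integral, norm_mul, Complex.norm_real, Real.norm_of_nonneg (by positivity)]
  gcongr
  refine (norm_integral_le_integral_norm _).trans (le_of_eq ?_)
  congr 1
  ext η
  rw [norm_mul, Complex.norm_exp]
  simp [mul_assoc]

theorem integrable_comp_neg_two_pi {g : ℝ → ℂ} (hg : Integrable g) :
    Integrable fun ξ : ℝ => g (-2 * Real.pi * ξ) :=
  hg.comp_mul_left' neg_two_pi_ne_zero

theorem continuous_invF {g : ℝ → ℂ} (hg : Integrable g) : Continuous (invF g) :=
  VectorFourier.fourierIntegral_continuous Real.continuous_fourierChar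
    (by exact continuous_inner) (integrable_comp_neg_two_pi hg)

theorem integrable_exp_mul {g : ℝ → ℂ} (hg : Integrable g) (x : ℝ) :
    Integrable fun η : ℝ => Complex.exp (Complex.I * x * η) * g η := by
  refine hg.bdd_mul (c := 1) (Continuous.aestronglyMeasurable (by fun_prop)) ?_
  filter_upwards with η
  rw [Complex.norm_exp]
  simp [mul_assoc]

theorem invF_add {f g : ℝ → ℂ} (hf : Integrable f) (hg : Integrable g) (x : ℝ) :
    invF (fun η => f η + g η) x = invF f x + invF g x := by
  simp only [invF_eq_integral, mul_add]
  rw [integral_add (integrable_exp_mul hf x) (integrable_exp_mul hg x), mul_add]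

theorem invF_const_mul (c : ℂ) (f : ℝ → ℂ) (x : ℝ) :
    invF (fun η => c * f η) x = c * invF f x := by
  simp only [invF_eq_integral]
  rw [show (fun η : ℝ => Complex.exp (Complex.I * x * η) * (c * f η))
    = fun η : ℝ => c * (Complex.exp (Complex.I * x * η) * f η) by ext; ring, integral_const_mul]
  ring

theorem invF_sum {ι : Type*} (s : Finset ι) {f : ι → ℝ → ℂ} (hf : ∀ i ∈ s, Integrable (f i))
    (x : ℝ) : invF (fun η => ∑ i ∈ s, f i η) x = ∑ i ∈ s, invF (f i) x := by
  simp only [invF_eq_integral, Finset.mul_sum]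
  rw [integral_finsetSum _ fun i hi => integrable_exp_mul (hf i hi) x, Finset.mul_sum]

/-- All moments of `g` are finite. -/
def RapidDecay (g : ℝ → ℂ) : Prop := ∀ n : ℕ, Integrable fun η : ℝ => (Complex.I * η) ^ n * g η

theorem RapidDecay.integrable {g : ℝ → ℂ} (hg : RapidDecay g) : Integrable g := by
  simpa using hg 0

theorem RapidDecay.moment {g : ℝ → ℂ} (hg : RapidDecay g) (n : ℕ) :
    Integrable fun ξ : ℝ => ξ ^ n • g (-2 * Real.pi * ξ) := by
  have h := (integrable_comp_neg_two_pi (hg n)).const_mul (((-2 * Real.pi * Complex.I) ^ n)⁻¹)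
  refine h.congr (Filter.Eventually.of_forall fun ξ => ?_)
  have h2 : (-2 * Real.pi * Complex.I : ℂ) ^ n ≠ 0 := by
    refine pow_ne_zero _ (mul_ne_zero ?_ Complex.I_ne_zero)
    exact_mod_cast neg_two_pi_ne_zero
  simp only [Complex.real_smul]
  rw [show (Complex.I * ((-2 * Real.pi * ξ : ℝ) : ℂ)) ^ n
    = (-2 * Real.pi * Complex.I : ℂ) ^ n * (ξ : ℂ) ^ n by rw [← mul_pow]; push_cast; ring]
  push_cast
  field_simp

theorem RapidDecay.contDiff_invF {g : ℝ → ℂ} (hg : RapidDecay g) : ContDiff ℝ ∞ (invF g) := by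
  refine Real.contDiff_fourier (N := ⊤) fun n _ => ?_
  exact (hg.moment n).norm.congr (Filter.Eventually.of_forall fun ξ => by
    simp only [norm_smul, norm_pow])

theorem RapidDecay.iteratedDeriv_invF {g : ℝ → ℂ} (hg : RapidDecay g) (k : ℕ) :
    iteratedDeriv k (invF g) = invF fun η : ℝ => (Complex.I * η) ^ k * g η := by
  rw [invF, Real.iteratedDeriv_fourier (N := ⊤) (fun n _ => hg.moment n) (by simp), invF]
  congr 1
  ext ξ
  rw [smul_eq_mul]
  congr 2
  push_cast
  ring

/-! ### Shifting the contour in a strip -/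

theorem integral_eq_integral_add_mul_I {f : ℂ → ℂ} {σ : ℝ}
    (hf : DifferentiableOn ℂ f (GasState.strip σ)) {b : ℝ → ℝ} (hb : Integrable b)
    (hb0 : Filter.Tendsto b (Filter.cocompact ℝ) (nhds 0))
    (hfb : ∀ η ∈ GasState.strip σ, ‖f η‖ ≤ b η.re) {y : ℝ} (hy : |y| < σ) :
    ∫ x : ℝ, f x = ∫ x : ℝ, f (x + y * Complex.I) := by
  have hmem : ∀ x v : ℝ, |v| < σ → (x + v * Complex.I : ℂ) ∈ GasState.strip σ := fun x v hv => by
    simpa [GasState.strip] using hv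
  have hint : ∀ v : ℝ, |v| < σ → Integrable fun x : ℝ => f (x + v * Complex.I) := fun v hv => by
    refine hb.mono' (Continuous.aestronglyMeasurable ?_) (Filter.Eventually.of_forall fun x => ?_)
    · exact hf.continuousOn.comp_continuous (by fun_prop) fun x => hmem x v hv
    · simpa using hfb _ (hmem x v hv)
  have hσ : 0 < σ := (abs_nonneg y).trans_lt hy
  have hrect : ∀ T : ℝ, (((∫ x : ℝ in (-T)..T, f x)
      - ∫ x : ℝ in (-T)..T, f (x + y * Complex.I))
      + Complex.I • ∫ v : ℝ in (0:ℝ)..y, f (T + v * Complex.I))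
      - Complex.I • ∫ v : ℝ in (0:ℝ)..y, f ((-T : ℝ) + v * Complex.I) = 0 := fun T => by
    have := Complex.integral_boundary_rect_eq_zero_of_differentiableOn f (-T : ℝ)
      (T + y * Complex.I) (hf.mono ?_)
    · simpa using this
    · intro z hz
      have h2 := hz.2
      simp only [Set.mem_preimage, Complex.ofReal_im, Complex.add_im, Complex.mul_im,
        Complex.ofReal_re, Complex.I_im, mul_one, Complex.I_re, mul_zero, add_zero, zero_add] at h2
      have := Set.abs_sub_left_of_mem_uIcc h2
      simp only [sub_zero] at this
      exact this.trans_lt hy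
  have hvert : ∀ T : ℝ, ‖∫ v : ℝ in (0:ℝ)..y, f (T + v * Complex.I)‖ ≤ b T * |y - 0| := fun T => by
    refine intervalIntegral.norm_integral_le_of_norm_le_const fun v hv => ?_
    have hv' := Set.abs_sub_left_of_mem_uIcc (Set.uIoc_subset_uIcc hv)
    simp only [sub_zero] at hv'
    simpa using hfb _ (hmem T v (hv'.trans_lt hy))
  have htop : Filter.Tendsto b Filter.atTop (nhds 0) := hb0.mono_left atTop_le_cocompact
  have hbot : Filter.Tendsto (fun T => b (-T)) Filter.atTop (nhds 0) :=
    (hb0.mono_left atBot_le_cocompact).comp Filter.tendsto_neg_atTop_atBot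
  have hv1 : Filter.Tendsto (fun T : ℝ => ∫ v : ℝ in (0:ℝ)..y, f (T + v * Complex.I))
      Filter.atTop (nhds 0) := by
    refine squeeze_zero_norm hvert ?_
    simpa using htop.mul_const |y - 0|
  have hv2 : Filter.Tendsto (fun T : ℝ => ∫ v : ℝ in (0:ℝ)..y, f ((-T : ℝ) + v * Complex.I))
      Filter.atTop (nhds 0) := by
    refine squeeze_zero_norm (fun T => hvert (-T)) ?_
    simpa using hbot.mul_const |y - 0|
  have hi1 := intervalIntegral_tendsto_integral (μ := volume) (f := fun x : ℝ => f x)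
    (by simpa using hint 0 (by simpa using hσ))
    Filter.tendsto_neg_atTop_atBot Filter.tendsto_id
  have hi2 := intervalIntegral_tendsto_integral (μ := volume) (hint y hy)
    Filter.tendsto_neg_atTop_atBot Filter.tendsto_id
  have hlim := ((hi1.sub hi2).add (hv1.const_smul Complex.I)).sub (hv2.const_smul Complex.I)
  have huniq := tendsto_nhds_unique hlim ((tendsto_const_nhds (x := (0:ℂ))).congr
    fun T => (hrect T).symm)
  simpa [sub_eq_zero] using huniq

/-- A function that is analytic in the strip `|Im η| < σ`, with an integrable bound that is uniform
on horizontal lines, has an inverse Fourier transform that decays like `e^{-σ |x|}`: the line of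
integration may be shifted towards the boundary of the strip. -/
theorem norm_invF_le_of_strip {f : ℂ → ℂ} {σ : ℝ} (hσ : 0 < σ)
    (hf : DifferentiableOn ℂ f (GasState.strip σ)) {b : ℝ → ℝ} (hb : Integrable b)
    (hb0 : Filter.Tendsto b (Filter.cocompact ℝ) (nhds 0))
    (hfb : ∀ η ∈ GasState.strip σ, ‖f η‖ ≤ b η.re) (x : ℝ) :
    ‖invF (fun η => f η) x‖ ≤ (2 * Real.pi)⁻¹ * (∫ ξ, b ξ) * Real.exp (-σ * |x|) := by
  have key : ∀ y : ℝ, |y| < σ →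
      ‖invF (fun η => f η) x‖ ≤ (2 * Real.pi)⁻¹ * (∫ ξ, b ξ) * Real.exp (-y * x) := by
    intro y hy
    have hnorm : ∀ η : ℂ, ‖Complex.exp (Complex.I * x * η)‖ = Real.exp (-η.im * x) := fun η => by
      rw [Complex.norm_exp]
      congr 1
      simp [mul_comm]
    have hsh := integral_eq_integral_add_mul_I (σ := σ)
      (f := fun η : ℂ => Complex.exp (Complex.I * x * η) * f η)
      (b := fun ξ => Real.exp (σ * |x|) * b ξ)
      (DifferentiableOn.mul (by fun_prop) hf) (hb.const_mul _)
      (by simpa using hb0.const_mul (Real.exp (σ * |x|)))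
      (fun η hη => by
        rw [norm_mul, hnorm]
        refine mul_le_mul (Real.exp_le_exp.2 ?_) (hfb η hη) (norm_nonneg _) (Real.exp_pos _).le
        have h1 : |η.im| * |x| ≤ σ * |x| := mul_le_mul_of_nonneg_right (le_of_lt hη) (abs_nonneg x)
        have h2 := neg_abs_le (η.im * x)
        rw [abs_mul] at h2
        linarith) hy
    rw [invF_eq_integral, hsh, norm_mul, Complex.norm_real, Real.norm_of_nonneg (by positivity),
      mul_assoc]
    refine mul_le_mul_of_nonneg_left ?_ (by positivity)
    rw [← integral_mul_const]
    refine norm_integral_le_of_norm_le (hb.mul_const _) (Filter.Eventually.of_forall fun ξ => ?_)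
    have := hfb (ξ + y * Complex.I) (by simpa [GasState.strip] using hy)
    rw [norm_mul, hnorm, mul_comm]
    simpa using mul_le_mul_of_nonneg_right this (Real.exp_pos _).le
  -- the shift tends to the boundary of the strip, on the side chosen by the sign of `x`
  have hlim : Filter.Tendsto
      (fun r : ℝ => (2 * Real.pi)⁻¹ * (∫ ξ, b ξ) * Real.exp (-r * |x|)) (nhdsWithin σ (Set.Iio σ))
      (nhds ((2 * Real.pi)⁻¹ * (∫ ξ, b ξ) * Real.exp (-σ * |x|))) := by
    refine Filter.Tendsto.mono_left (Continuous.tendsto ?_ σ) nhdsWithin_le_nhds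
    fun_prop
  refine ge_of_tendsto hlim ?_
  filter_upwards [Ioo_mem_nhdsLT hσ] with r hr
  have hr1 : |r| < σ := by rw [abs_of_pos hr.1]; exact hr.2
  rcases le_total 0 x with hx | hx
  · simpa [abs_of_nonneg hx] using key r hr1
  · simpa [abs_of_nonpos hx] using key (-r) (by simpa using hr1)

/-! ### Tempered distributions given by bounded functions -/

/-- Bounded measurable functions on the line. -/
def BddMeas (g : ℝ → ℂ) : Prop := Measurable g ∧ ∃ C, ∀ x, ‖g x‖ ≤ C

theorem BddMeas.memLp {g : ℝ → ℂ} (hg : BddMeas g) : MemLp g ∞ volume :=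
  memLp_top_of_bound hg.1.aestronglyMeasurable hg.2.choose
    (Filter.Eventually.of_forall hg.2.choose_spec)

theorem BddMeas.comp {g : ℝ → ℂ} (hg : BddMeas g) {f : ℝ → ℝ} (hf : Measurable f) :
    BddMeas fun x => g (f x) :=
  ⟨hg.1.comp hf, hg.2.choose, fun x => hg.2.choose_spec (f x)⟩

theorem BddMeas.add {f g : ℝ → ℂ} (hf : BddMeas f) (hg : BddMeas g) :
    BddMeas fun x => f x + g x := by
  obtain ⟨hf, A, hA⟩ := hf
  obtain ⟨hg, B, hB⟩ := hg
  exact ⟨hf.add hg, A + B, fun x => (norm_add_le _ _).trans (add_le_add (hA x) (hB x))⟩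

theorem BddMeas.const_mul {f : ℝ → ℂ} (hf : BddMeas f) (c : ℂ) : BddMeas fun x => c * f x := by
  obtain ⟨hf, A, hA⟩ := hf
  exact ⟨hf.const_mul c, ‖c‖ * A, fun x => by rw [norm_mul]; gcongr; exact hA x⟩

theorem BddMeas.sum {ι : Type*} (s : Finset ι) {f : ι → ℝ → ℂ} (hf : ∀ i, BddMeas (f i)) :
    BddMeas fun x => ∑ i ∈ s, f i x := by
  classical
  induction s using Finset.induction_on with
  | empty => exact ⟨by simp, 0, by simp⟩
  | insert i s hi ih => simpa only [Finset.sum_insert hi] using (hf i).add ih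

theorem BddMeas.integrable_schwartz_mul {g : ℝ → ℂ} (hg : BddMeas g) (φ : SchwartzMap ℝ ℂ) :
    Integrable fun x => φ x * g x := by
  obtain ⟨hg, C, hC⟩ := hg
  exact φ.integrable.mul_bdd hg.aestronglyMeasurable (Filter.Eventually.of_forall hC)

theorem distOf_apply {g : ℝ → ℂ} (hg : MemLp g ∞ volume) (φ : SchwartzMap ℝ ℂ) :
    distOf g φ = ∫ x, φ x * g x := by
  rw [distOf, dif_pos hg, Lp.toTemperedDistribution_apply]
  refine integral_congr_ae ?_
  filter_upwards [hg.coeFn_toLp] with x hx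
  rw [hx, smul_eq_mul]

theorem distOf_add {f g : ℝ → ℂ} (hf : BddMeas f) (hg : BddMeas g) :
    distOf (fun x => f x + g x) = distOf f + distOf g := by
  ext φ
  rw [add_apply, distOf_apply hf.memLp, distOf_apply hg.memLp,
    distOf_apply (hf.add hg).memLp,
    ← integral_add (hf.integrable_schwartz_mul φ) (hg.integrable_schwartz_mul φ)]
  simp only [mul_add]

theorem distOf_const_mul {f : ℝ → ℂ} (hf : BddMeas f) (c : ℂ) :
    distOf (fun x => c * f x) = c • distOf f := by
  ext φ
  rw [smul_apply, distOf_apply hf.memLp, distOf_apply (hf.const_mul c).memLp,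
    smul_eq_mul, ← integral_const_mul]
  simp only [mul_left_comm]

theorem invFourierDist_apply {g : ℝ → ℂ} (hg : BddMeas g) (φ : SchwartzMap ℝ ℂ) :
    invFourierDist g φ = ∫ ξ, (𝓕⁻ φ) ξ * g (2 * Real.pi * ξ) := by
  rw [invFourierDist, TemperedDistribution.fourierInv_apply,
    distOf_apply (hg.comp (by fun_prop)).memLp]

theorem invFourierDist_add {f g : ℝ → ℂ} (hf : BddMeas f) (hg : BddMeas g) :
    invFourierDist (fun x => f x + g x) = invFourierDist f + invFourierDist g := by
  rw [invFourierDist, distOf_add (hf.comp (by fun_prop)) (hg.comp (by fun_prop))]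
  exact FourierTransform.fourierInv_add _ _

theorem invFourierDist_const_mul {f : ℝ → ℂ} (hf : BddMeas f) (c : ℂ) :
    invFourierDist (fun x => c * f x) = c • invFourierDist f := by
  rw [invFourierDist, distOf_const_mul (hf.comp (by fun_prop))]
  exact FourierTransform.fourierInv_smul _ _

theorem invFourierDist_sum {ι : Type*} (s : Finset ι) {f : ι → ℝ → ℂ} (hf : ∀ i, BddMeas (f i)) :
    invFourierDist (fun x => ∑ i ∈ s, f i x) = ∑ i ∈ s, invFourierDist (f i) := by
  classical
  induction s using Finset.induction_on with
  | empty =>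
    ext φ
    rw [invFourierDist_apply ⟨by simp, 0, by simp⟩]
    simp
  | insert i s hi ih =>
    simp only [Finset.sum_insert hi]
    rw [invFourierDist_add (hf i) (BddMeas.sum s hf), ih]

theorem integral_fourier_mul {f g : ℝ → ℂ} (hf : Integrable f) (hg : Integrable g) :
    ∫ ξ, 𝓕 f ξ * g ξ = ∫ x, f x * 𝓕 g x := by
  have := VectorFourier.integral_fourierIntegral_smul_eq_flip (L := innerₗ ℝ)
    Real.continuous_fourierChar (by exact continuous_inner) hf hg
  rwa [flip_innerₗ] at this

/-- For an integrable function the inverse transform in the sense of distributions is the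
inverse Fourier integral. -/
theorem invFourierDist_eq_distOf_invF {g : ℝ → ℂ} (hg : BddMeas g) (hi : Integrable g) :
    invFourierDist g = distOf (invF g) := by
  have hb : BddMeas (invF g) :=
    ⟨(continuous_invF hi).measurable, _, fun x => norm_invF_le g x⟩
  ext φ
  rw [invFourierDist_apply hg, distOf_apply hb.memLp, invF,
    ← integral_fourier_mul φ.integrable (integrable_comp_neg_two_pi hi),
    ← integral_neg_eq_self]
  congr 1
  ext ξ
  rw [SchwartzMap.fourierInv_coe, Real.fourierInv_eq_fourier_neg, neg_neg]
  congr 2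
  ring

/-- If `g` is the Fourier transform of a bounded integrable function `h`, then the inverse
transform of `g` in the sense of distributions is `h`. -/
theorem invFourierDist_eq_distOf_of_fourier {g h : ℝ → ℂ} (hg : BddMeas g) (hh : BddMeas h)
    (hi : Integrable h) (hgh : ∀ ξ : ℝ, 𝓕 h ξ = g (2 * Real.pi * ξ)) :
    invFourierDist g = distOf h := by
  ext φ
  rw [invFourierDist_apply hg, distOf_apply hh.memLp]
  have h1 := integral_fourier_mul hi (𝓕⁻ φ).integrable
  have h2 : (𝓕 ((𝓕⁻ φ : SchwartzMap ℝ ℂ) : ℝ → ℂ)) = φ := by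
    rw [← SchwartzMap.fourier_coe, FourierTransform.fourier_fourierInv_eq]
  rw [h2] at h1
  simp only [hgh] at h1
  simpa only [mul_comm] using h1

theorem iterate_derivCLM_apply (T : TemperedDistribution ℝ ℂ) (k : ℕ) (φ : SchwartzMap ℝ ℂ) :
    (TemperedDistribution.derivCLM ℂ)^[k] T φ
      = T ((fun ψ => -SchwartzMap.derivCLM ℂ ℂ ψ)^[k] φ) := by
  induction k generalizing φ with
  | zero => rfl
  | succ k ih =>
    rw [Function.iterate_succ_apply', TemperedDistribution.derivCLM_apply_apply,
      Function.iterate_succ_apply]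
    exact ih _

theorem fourierInv_iterate_neg_deriv (k : ℕ) (φ : SchwartzMap ℝ ℂ) (ξ : ℝ) :
    (𝓕⁻ ((fun ψ => -SchwartzMap.derivCLM ℂ ℂ ψ)^[k] φ)) ξ
      = (Complex.I * ((2 * Real.pi * ξ : ℝ) : ℂ)) ^ k * (𝓕⁻ φ) ξ := by
  induction k generalizing φ with
  | zero => simp
  | succ k ih =>
    rw [Function.iterate_succ_apply, ih, pow_succ]
    generalize (Complex.I * ((2 * Real.pi * ξ : ℝ) : ℂ)) ^ k = P
    rw [mul_assoc P]
    congr 1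
    have h1 : ((-SchwartzMap.derivCLM ℂ ℂ φ : SchwartzMap ℝ ℂ) : ℝ → ℂ) = -deriv φ := by
      ext x
      simp
    have h2 := congrFun (Real.fourier_deriv φ.integrable φ.differentiable
      ((SchwartzMap.derivCLM ℂ ℂ φ).integrable.congr (Filter.Eventually.of_forall fun x => by simp)))
      (-ξ)
    rw [SchwartzMap.fourierInv_coe, SchwartzMap.fourierInv_coe, Real.fourierInv_eq_fourier_neg,
      Real.fourierInv_eq_fourier_neg, h1]
    have h3 : 𝓕 (-deriv φ) (-ξ) = -𝓕 (deriv φ) (-ξ) := by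
      rw [Real.fourier_eq, Real.fourier_eq, ← integral_neg]
      simp
    rw [h3, h2, smul_eq_mul]
    push_cast
    ring

theorem iterate_derivCLM_delta_apply (l : ℕ) (φ : SchwartzMap ℝ ℂ) :
    (TemperedDistribution.derivCLM ℂ)^[l] (TemperedDistribution.delta (0 : ℝ)) φ
      = ∫ ξ : ℝ, (Complex.I * ((2 * Real.pi * ξ : ℝ) : ℂ)) ^ l * (𝓕⁻ φ) ξ := by
  rw [iterate_derivCLM_apply, TemperedDistribution.delta_apply]
  simp only [← fourierInv_iterate_neg_deriv]
  set ψ := (fun ψ => -SchwartzMap.derivCLM ℂ ℂ ψ)^[l] φ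
  have h2 : ψ 0 = (𝓕 ((𝓕⁻ ψ : SchwartzMap ℝ ℂ) : ℝ → ℂ)) 0 := by
    rw [← SchwartzMap.fourier_coe, FourierTransform.fourier_fourierInv_eq]
  rw [h2, Real.fourier_eq]
  simp

/-- A polynomial part of `(iη)^k g(η)` becomes a combination of derivatives of the delta
distribution in the `k`-th derivative of the inverse transform of `g`. -/
theorem iterate_derivCLM_invFourierDist {g r : ℝ → ℂ} (hg : BddMeas g) (hr : BddMeas r)
    (k n : ℕ) (p : ℕ → ℂ) (hgr : ∀ η : ℝ, (Complex.I * η) ^ k * g η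
      = ∑ l ∈ Finset.range n, p l * (Complex.I * η) ^ l + r η) :
    (TemperedDistribution.derivCLM ℂ)^[k] (invFourierDist g)
      = ∑ l ∈ Finset.range n, p l •
          (TemperedDistribution.derivCLM ℂ)^[l] (TemperedDistribution.delta (0 : ℝ))
        + invFourierDist r := by
  ext φ
  have hint : ∀ l : ℕ, Integrable fun ξ : ℝ =>
      p l * ((Complex.I * ((2 * Real.pi * ξ : ℝ) : ℂ)) ^ l * (𝓕⁻ φ) ξ) := fun l => by
    simp only [← fourierInv_iterate_neg_deriv]
    exact (SchwartzMap.integrable _).const_mul _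
  have hsum : (∑ l ∈ Finset.range n, p l • (TemperedDistribution.derivCLM ℂ)^[l]
      (TemperedDistribution.delta (0 : ℝ))) φ = ∑ l ∈ Finset.range n, p l •
      ((TemperedDistribution.derivCLM ℂ)^[l] (TemperedDistribution.delta (0 : ℝ)) φ) := by
    rw [sum_apply]
    rfl
  rw [add_apply, hsum, iterate_derivCLM_apply, invFourierDist_apply hg,
    invFourierDist_apply hr]
  simp only [iterate_derivCLM_delta_apply, fourierInv_iterate_neg_deriv, smul_eq_mul,
    ← integral_const_mul]
  rw [← integral_finsetSum _ fun l _ => hint l, ← integral_add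
    (integrable_finsetSum _ fun l _ => hint l)
    ((hr.comp (f := fun ξ => 2 * Real.pi * ξ) (by fun_prop)).integrable_schwartz_mul (𝓕⁻ φ))]
  congr 1
  ext ξ
  have := hgr (2 * Real.pi * ξ)
  rw [mul_right_comm, this, add_mul, Finset.sum_mul]
  congr 1
  · exact Finset.sum_congr rfl fun l _ => by ring
  · ring

/-! ### The transform of the odd exponential -/

/-- The function `iη / (1 + η²)`, which behaves like `i / η` at infinity. -/
def oddSymbol (η : ℂ) : ℂ := Complex.I * η / (1 + η ^ 2)

/-- The function `-sgn(x) e^{-|x|} / 2`, whose Fourier transform is `iη / (1 + η²)`. -/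
def oddExp (x : ℝ) : ℂ :=
  if 0 < x then ((-(Real.exp (-x) / 2) : ℝ) : ℂ) else ((Real.exp x / 2 : ℝ) : ℂ)

theorem norm_oddExp (x : ℝ) : ‖oddExp x‖ = Real.exp (-|x|) / 2 := by
  unfold oddExp
  split_ifs with h
  · rw [Complex.norm_real, norm_neg, Real.norm_of_nonneg (by positivity), abs_of_pos h]
  · rw [Complex.norm_real, Real.norm_of_nonneg (by positivity), abs_of_nonpos (not_lt.1 h), neg_neg]

theorem measurable_oddExp : Measurable oddExp := by
  unfold oddExp
  refine Measurable.ite measurableSet_Ioi ?_ ?_ <;> fun_prop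

theorem bddMeas_oddExp : BddMeas oddExp :=
  ⟨measurable_oddExp, 1 / 2, fun x => by
    rw [norm_oddExp]
    have := Real.exp_le_one_iff.2 (neg_nonpos.2 (abs_nonneg x))
    linarith⟩

theorem integrable_exp_neg_abs : Integrable fun x : ℝ => Real.exp (-|x|) := by
  rw [← integrableOn_univ, ← Set.Iic_union_Ioi (a := (0:ℝ)), integrableOn_union]
  constructor
  · refine (integrableOn_exp_Iic 0).congr_fun (fun x hx => ?_) measurableSet_Iic
    simp [abs_of_nonpos (Set.mem_Iic.1 hx)]
  · refine (integrableOn_exp_neg_Ioi 0).congr_fun (fun x hx => ?_) measurableSet_Ioi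
    simp [abs_of_pos (Set.mem_Ioi.1 hx)]

theorem integrable_oddExp : Integrable oddExp := by
  refine (integrable_exp_neg_abs.div_const 2).mono' measurable_oddExp.aestronglyMeasurable ?_
  exact Filter.Eventually.of_forall fun x => (norm_oddExp x).le

theorem one_add_sq_ne_zero (η : ℝ) : (1 + (η : ℂ) ^ 2) ≠ 0 := by
  have : (1 + η ^ 2 : ℝ) ≠ 0 := by positivity
  exact_mod_cast this

theorem fourier_oddExp (ξ : ℝ) : 𝓕 oddExp ξ = oddSymbol ((2 * Real.pi * ξ : ℝ) : ℂ) := by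
  set η : ℝ := 2 * Real.pi * ξ with hη
  have h1 : 𝓕 oddExp ξ = ∫ x : ℝ, Complex.exp (-(Complex.I * η) * x) * oddExp x := by
    rw [Real.fourier_real_eq_integral_exp_smul]
    congr 1
    ext x
    rw [smul_eq_mul, hη]
    congr 2
    push_cast
    ring
  have hint : Integrable fun x : ℝ => Complex.exp (-(Complex.I * η) * x) * oddExp x := by
    refine integrable_oddExp.bdd_mul (c := 1) (Continuous.aestronglyMeasurable (by fun_prop)) ?_
    filter_upwards with x
    rw [Complex.norm_exp]
    simp
  have h2 : ∫ x in Set.Iic (0:ℝ), Complex.exp (-(Complex.I * η) * x) * oddExp x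
      = (1 / 2) * (1 / (1 - Complex.I * η)) := by
    rw [setIntegral_congr_fun (g := fun x : ℝ => (1 / 2 : ℂ) * Complex.exp ((1 - Complex.I * η) * x))
      measurableSet_Iic]
    · rw [integral_const_mul, integral_exp_mul_complex_Iic (by simp)]
      simp
    · intro x hx
      simp only [oddExp, if_neg (not_lt.2 (Set.mem_Iic.1 hx))]
      push_cast
      rw [sub_mul, one_mul, sub_eq_add_neg, Complex.exp_add, neg_mul]
      ring
  have h3 : ∫ x in Set.Ioi (0:ℝ), Complex.exp (-(Complex.I * η) * x) * oddExp x
      = -(1 / 2) * (1 / (1 + Complex.I * η)) := by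
    rw [setIntegral_congr_fun (g := fun x : ℝ => -(1 / 2 : ℂ) * Complex.exp ((-(1 + Complex.I * η)) * x))
      measurableSet_Ioi]
    · rw [integral_const_mul, integral_exp_mul_complex_Ioi (by simp)]
      rw [Complex.ofReal_zero, mul_zero, Complex.exp_zero, neg_div_neg_eq]
    · intro x hx
      simp only [oddExp, if_pos (Set.mem_Ioi.1 hx)]
      push_cast
      rw [neg_add, add_mul, Complex.exp_add]
      simp only [neg_mul, one_mul]
      ring
  have hp : (1 + Complex.I * η : ℂ) ≠ 0 := fun h => by simpa using congrArg Complex.re h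
  have hm : (1 - Complex.I * η : ℂ) ≠ 0 := fun h => by simpa using congrArg Complex.re h
  have hq : (1 + (η : ℂ) ^ 2) = (1 + Complex.I * η) * (1 - Complex.I * η) := by
    ring_nf
    simp
  rw [h1, ← intervalIntegral.integral_Iic_add_Ioi hint.integrableOn hint.integrableOn (b := 0), h2,
    h3, oddSymbol, hq]
  field_simp
  ring

theorem bddMeas_oddSymbol : BddMeas fun η : ℝ => oddSymbol η := by
  refine ⟨Continuous.measurable ?_, 1, fun η => ?_⟩
  · unfold oddSymbol
    exact Continuous.div (by fun_prop) (by fun_prop) one_add_sq_ne_zero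
  · have h : ‖(1 + (η : ℂ) ^ 2)‖ = 1 + η ^ 2 := by
      rw [show (1 + (η : ℂ) ^ 2) = ((1 + η ^ 2 : ℝ) : ℂ) by push_cast; rfl, Complex.norm_real,
        Real.norm_of_nonneg (by positivity)]
    simp only [oddSymbol]
    rw [norm_div, h, div_le_one (by positivity)]
    simp only [norm_mul, Complex.norm_I, one_mul, Complex.norm_real, Real.norm_eq_abs]
    nlinarith [sq_abs η, sq_nonneg (|η| - 1), abs_nonneg η]

theorem invFourierDist_oddSymbol : invFourierDist (fun η : ℝ => oddSymbol η) = distOf oddExp :=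
  invFourierDist_eq_distOf_of_fourier bddMeas_oddSymbol bddMeas_oddExp integrable_oddExp
    fourier_oddExp

/-! ### Heat kernels -/

theorem RapidDecay.of_le_gaussian {g : ℝ → ℂ} (hg : Continuous g) {a C : ℝ} (ha : 0 < a)
    (h : ∀ η, ‖g η‖ ≤ C * Real.exp (-a * η ^ 2)) : RapidDecay g := fun n => by
  have hi := (integrable_rpow_mul_exp_neg_mul_sq ha (s := n) (by
    have : (0:ℝ) ≤ n := n.cast_nonneg
    linarith)).norm.const_mul C
  refine hi.mono' (Continuous.aestronglyMeasurable (by fun_prop))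
    (Filter.Eventually.of_forall fun η => ?_)
  rw [norm_mul, norm_pow, norm_mul, Complex.norm_I, one_mul, Complex.norm_real, Real.rpow_natCast,
    norm_mul, norm_pow, Real.norm_of_nonneg (Real.exp_pos _).le]
  calc ‖η‖ ^ n * ‖g η‖ ≤ ‖η‖ ^ n * (C * Real.exp (-a * η ^ 2)) := by gcongr; exact h η
    _ = _ := by ring

/-- The Fourier transform `e^{(-α η² + β) t}` of the heat kernel. -/
def heatSymbol (α β t : ℝ) (η : ℂ) : ℂ := Complex.exp ((-(α : ℂ) * η ^ 2 + β) * t)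

theorem norm_heatSymbol (α β t : ℝ) (η : ℂ) :
    ‖heatSymbol α β t η‖ = Real.exp ((-α * (η.re ^ 2 - η.im ^ 2) + β) * t) := by
  rw [heatSymbol, Complex.norm_exp]
  congr 1
  simp [sq]

theorem continuous_heatSymbol (α β t : ℝ) : Continuous (heatSymbol α β t) := by
  unfold heatSymbol
  fun_prop

theorem differentiable_heatSymbol (α β t : ℝ) : Differentiable ℂ (heatSymbol α β t) := by
  unfold heatSymbol
  fun_prop

theorem rapidDecay_heatSymbol {α t : ℝ} (β : ℝ) (hα : 0 < α) (ht : 0 < t) :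
    RapidDecay fun η : ℝ => heatSymbol α β t η := by
  refine RapidDecay.of_le_gaussian (a := α * t) (C := Real.exp (β * t))
    ((continuous_heatSymbol α β t).comp Complex.continuous_ofReal) (by positivity) fun η => ?_
  rw [norm_heatSymbol, ← Real.exp_add]
  refine le_of_eq ?_
  congr 1
  simp
  ring

theorem invF_heatSymbol {α t : ℝ} (β : ℝ) (hα : 0 < α) (ht : 0 < t) (x : ℝ) :
    invF (fun η => heatSymbol α β t η) x = heatKer α β t x := by
  have hb : 0 < 4 * Real.pi * α * t := by positivity
  have h1 : (fun ξ : ℝ => heatSymbol α β t ((-2 * Real.pi * ξ : ℝ) : ℂ)) = fun ξ : ℝ =>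
      Complex.exp (β * t) * Complex.exp (-Real.pi * ((4 * Real.pi * α * t : ℝ) : ℂ) * ξ ^ 2) := by
    ext ξ
    rw [heatSymbol, ← Complex.exp_add]
    congr 1
    push_cast
    ring
  have h2 := congrFun (fourier_gaussian_pi (b := ((4 * Real.pi * α * t : ℝ) : ℂ))
    (by simpa using hb)) x
  have h3 : (((4 * Real.pi * α * t : ℝ) : ℂ)) ^ (1 / 2 : ℂ) = (√(4 * Real.pi * α * t) : ℝ) := by
    rw [Real.sqrt_eq_rpow, Complex.ofReal_cpow hb.le]
    norm_num
  rw [invF, h1]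
  have h4 : ∀ f : ℝ → ℂ, 𝓕 (fun ξ => Complex.exp (β * t) * f ξ) x
      = Complex.exp (β * t) * 𝓕 f x := fun f => by
    rw [Real.fourier_eq, Real.fourier_eq, ← integral_const_mul]
    congr 1
    ext v
    simp only [Circle.smul_def, smul_eq_mul]
    ring
  rw [h4, h2, h3, heatKer]
  have hpi : (Real.pi : ℂ) ≠ 0 := by exact_mod_cast Real.pi_ne_zero
  have h5 : (-(Real.pi : ℂ) / ((4 * Real.pi * α * t : ℝ) : ℂ) * x ^ 2)
      = ((-x ^ 2 / (4 * α * t) : ℝ) : ℂ) := by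
    have hα' : (α : ℂ) ≠ 0 := by exact_mod_cast hα.ne'
    have ht' : (t : ℂ) ≠ 0 := by exact_mod_cast ht.ne'
    push_cast
    field_simp
  rw [h5]
  push_cast
  ring

theorem ofReal_iteratedDeriv_heatKer {α t : ℝ} (β : ℝ) (hα : 0 < α) (ht : 0 < t) (k : ℕ) (x : ℝ) :
    ((iteratedDeriv k (heatKer α β t) x : ℝ) : ℂ)
      = invF (fun η : ℝ => (Complex.I * η) ^ k * heatSymbol α β t η) x := by
  have hsm : ContDiff ℝ k (heatKer α β t) := by
    unfold heatKer
    fun_prop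
  have h1 : invF (fun η : ℝ => heatSymbol α β t η) = Complex.ofRealCLM ∘ heatKer α β t := by
    ext x
    exact invF_heatSymbol β hα ht x
  rw [← (rapidDecay_heatSymbol β hα ht).iteratedDeriv_invF k, h1, iteratedDeriv_eq_iteratedFDeriv,
    iteratedDeriv_eq_iteratedFDeriv,
    Complex.ofRealCLM.iteratedFDeriv_comp_left hsm.contDiffAt le_rfl]
  rfl

theorem heatKer_nonneg (α β t x : ℝ) : 0 ≤ heatKer α β t x := by
  unfold heatKer
  positivity

/-- The exponential moment of the heat kernel, bounded by means of
`|y| ≤ y² / (8 α t) + 2 α t`. -/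
theorem exp_abs_mul_heatKer_le {α t : ℝ} (β : ℝ) (hα : 0 < α) (ht : 0 < t) (y : ℝ) :
    Real.exp |y| * heatKer α β t y ≤ Real.exp ((β + 2 * α) * t) / √(4 * Real.pi * α * t)
      * Real.exp (-(1 / (8 * α * t)) * y ^ 2) := by
  have h : |y| ≤ y ^ 2 / (8 * α * t) + 2 * α * t := by
    have h0 : 0 ≤ (|y| - 4 * α * t) ^ 2 / (8 * α * t) := by positivity
    have h1 : (|y| - 4 * α * t) ^ 2 / (8 * α * t)
        = y ^ 2 / (8 * α * t) + 2 * α * t - |y| := by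
      rw [sub_sq, sq_abs]
      field_simp
      ring
    linarith
  have h2 : Real.exp |y| * heatKer α β t y = (1 / √(4 * Real.pi * α * t))
      * Real.exp (|y| + β * t + -y ^ 2 / (4 * α * t)) := by
    rw [heatKer, Real.exp_add, Real.exp_add]
    ring
  have h3 : Real.exp ((β + 2 * α) * t) / √(4 * Real.pi * α * t)
      * Real.exp (-(1 / (8 * α * t)) * y ^ 2) = (1 / √(4 * Real.pi * α * t))
      * Real.exp ((β + 2 * α) * t + -(1 / (8 * α * t)) * y ^ 2) := by
    rw [Real.exp_add]
    ring
  rw [h2, h3]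
  refine mul_le_mul_of_nonneg_left (Real.exp_le_exp.2 ?_) (by positivity)
  have h4 : -y ^ 2 / (4 * α * t) = -(y ^ 2 / (8 * α * t)) - (1 / (8 * α * t)) * y ^ 2 := by
    field_simp
    ring
  rw [h4]
  linarith

theorem integrable_exp_abs_mul_heatKer {α t : ℝ} (β : ℝ) (hα : 0 < α) (ht : 0 < t) :
    Integrable fun y => Real.exp |y| * heatKer α β t y := by
  refine ((integrable_exp_neg_mul_sq (b := 1 / (8 * α * t)) (by positivity)).const_mul _).mono'
    (Continuous.aestronglyMeasurable ?_)
    (Filter.Eventually.of_forall fun y => ?_) (g := fun y =>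
      Real.exp ((β + 2 * α) * t) / √(4 * Real.pi * α * t)
        * Real.exp (-(1 / (8 * α * t)) * y ^ 2))
  · unfold heatKer
    fun_prop
  · rw [Real.norm_of_nonneg (mul_nonneg (Real.exp_pos _).le (heatKer_nonneg _ _ _ _))]
    exact exp_abs_mul_heatKer_le β hα ht y

theorem integral_exp_abs_mul_heatKer_le {α t : ℝ} (β : ℝ) (hα : 0 < α) (ht : 0 < t) :
    ∫ y, Real.exp |y| * heatKer α β t y ≤ 2 * Real.exp ((β + 2 * α) * t) := by
  refine (integral_mono (integrable_exp_abs_mul_heatKer β hα ht)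
    ((integrable_exp_neg_mul_sq (b := 1 / (8 * α * t)) (by positivity)).const_mul _)
    (exp_abs_mul_heatKer_le β hα ht)).trans ?_
  rw [integral_const_mul, integral_gaussian, div_mul_eq_mul_div, mul_div_assoc, mul_comm,
    ← Real.sqrt_div (by positivity)]
  refine mul_le_mul_of_nonneg_right ?_ (Real.exp_pos _).le
  rw [show Real.pi / (1 / (8 * α * t)) / (4 * Real.pi * α * t) = 2 by
    have := Real.pi_pos
    field_simp
    norm_num]
  exact Real.sqrt_le_iff.2 ⟨by norm_num, by norm_num⟩

/-- The symbol `iη / (1 + η²)` is not absolutely integrable, so the uniform bound for small `t`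
cannot come from the size of the integrand: the inverse transform is a convolution of the heat
kernel with the odd exponential. -/
theorem norm_invF_oddSymbol_mul_heatSymbol_le {α t : ℝ} (β : ℝ) (hα : 0 < α) (ht : 0 < t) (x : ℝ) :
    ‖invF (fun η => oddSymbol η * heatSymbol α β t η) x‖
      ≤ Real.exp ((β + 2 * α) * t) * Real.exp (-|x|) := by
  have hgi := (rapidDecay_heatSymbol β hα ht).integrable
  have hflip := integral_fourier_mul integrable_oddExp
    (integrable_exp_mul (integrable_comp_neg_two_pi hgi) (-2 * Real.pi * x))
  have hleft : invF (fun η => oddSymbol η * heatSymbol α β t η) x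
      = -∫ ξ : ℝ, 𝓕 oddExp ξ * (Complex.exp (Complex.I * ((-2 * Real.pi * x : ℝ) : ℂ) * ξ)
          * heatSymbol α β t ((-2 * Real.pi * ξ : ℝ) : ℂ)) := by
    rw [invF, Real.fourier_real_eq_integral_exp_smul, ← integral_neg]
    congr 1
    ext ξ
    rw [fourier_oddExp, smul_eq_mul, show Complex.exp (((-2 * Real.pi * ξ * x : ℝ) : ℂ) * Complex.I)
      = Complex.exp (Complex.I * ((-2 * Real.pi * x : ℝ) : ℂ) * ξ) by
        congr 1; push_cast; ring]
    simp only [oddSymbol]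
    push_cast
    ring
  have hright : ∀ y : ℝ, 𝓕 (fun ξ : ℝ => Complex.exp (Complex.I * ((-2 * Real.pi * x : ℝ) : ℂ) * ξ)
      * heatSymbol α β t ((-2 * Real.pi * ξ : ℝ) : ℂ)) y = heatKer α β t (x + y) := fun y => by
    rw [← invF_heatSymbol β hα ht, invF, Real.fourier_real_eq_integral_exp_smul,
      Real.fourier_real_eq_integral_exp_smul]
    congr 1
    ext ξ
    rw [smul_eq_mul, smul_eq_mul, ← mul_assoc, ← Complex.exp_add]
    congr 2
    push_cast
    ring
  simp only [hright] at hflip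
  rw [hleft, hflip, norm_neg]
  have hi := integrable_exp_abs_mul_heatKer β hα ht
  have hb : ‖∫ y : ℝ, oddExp y * (heatKer α β t (x + y) : ℂ)‖
      ≤ ∫ y : ℝ, Real.exp (-|x|) / 2 * (Real.exp |x + y| * heatKer α β t (x + y)) := by
    refine norm_integral_le_of_norm_le ((hi.comp_add_left x).const_mul _)
      (Filter.Eventually.of_forall fun y => ?_)
    rw [norm_mul, norm_oddExp, Complex.norm_real, Real.norm_of_nonneg (heatKer_nonneg _ _ _ _)]
    have h1 : Real.exp (-|y|) ≤ Real.exp (-|x|) * Real.exp |x + y| := by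
      rw [← Real.exp_add]
      refine Real.exp_le_exp.2 ?_
      have := abs_sub (x + y) y
      rw [add_sub_cancel_right] at this
      linarith
    calc _ ≤ (Real.exp (-|x|) * Real.exp |x + y|) / 2 * heatKer α β t (x + y) := by
          gcongr
          exact heatKer_nonneg _ _ _ _
      _ = _ := by ring
  refine hb.trans ?_
  rw [integral_const_mul, integral_add_left_eq_self (fun y => Real.exp |y| * heatKer α β t y) x]
  have := integral_exp_abs_mul_heatKer_le β hα ht
  calc _ ≤ Real.exp (-|x|) / 2 * (2 * Real.exp ((β + 2 * α) * t)) := by gcongr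
    _ = _ := by ring

/-- A bound that is integrable uniformly in `0 < t ≤ 1`: this is what makes the absolutely
convergent part of the remainders bounded up to `t = 0`. -/
theorem integral_mul_one_add_abs_mul_exp_le {α t : ℝ} (hα : 0 < α) (ht : 0 < t) (ht1 : t ≤ 1) :
    Integrable (fun ξ : ℝ => t * ((1 + |ξ|) * Real.exp (-(α * t) * ξ ^ 2))) ∧
    ∫ ξ : ℝ, t * ((1 + |ξ|) * Real.exp (-(α * t) * ξ ^ 2))
      ≤ ∫ ξ : ℝ, (1 + |ξ|) * Real.exp (-α * ξ ^ 2) := by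
  have hint : ∀ a : ℝ, 0 < a → Integrable fun ξ : ℝ => (1 + |ξ|) * Real.exp (-a * ξ ^ 2) := by
    intro a ha
    refine ((integrable_exp_neg_mul_sq ha).add
      (integrable_rpow_mul_exp_neg_mul_sq ha (s := 1) (by norm_num)).norm).congr
      (Filter.Eventually.of_forall fun ξ => ?_)
    simp only [Pi.add_apply, Real.rpow_one, norm_mul, Real.norm_eq_abs, Real.abs_exp]
    ring
  refine ⟨(hint _ (by positivity)).const_mul t, ?_⟩
  have hs : 0 < √t := Real.sqrt_pos.2 ht
  have hs1 : √t ≤ 1 := Real.sqrt_le_one.2 ht1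
  have hst : √t * √t = t := Real.mul_self_sqrt ht.le
  have hsub := Measure.integral_comp_mul_left
    (fun ξ : ℝ => (1 + |ξ|) * Real.exp (-α * ξ ^ 2)) (√t)
  rw [abs_of_pos (inv_pos.2 hs), smul_eq_mul] at hsub
  have heq : ∫ ξ : ℝ, (1 + |ξ|) * Real.exp (-α * ξ ^ 2)
      = ∫ ξ : ℝ, √t * ((1 + |√t * ξ|) * Real.exp (-α * (√t * ξ) ^ 2)) := by
    rw [integral_const_mul, hsub, ← mul_assoc, mul_inv_cancel₀ hs.ne', one_mul]
  rw [heq]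
  refine integral_mono ((hint _ (by positivity)).const_mul t)
    (((hint α hα).comp_mul_left' hs.ne').const_mul _) fun ξ => ?_
  have h1 : -α * (√t * ξ) ^ 2 = -(α * t) * ξ ^ 2 := by
    rw [mul_pow, sq (√t), hst]
    ring
  simp only [h1, abs_mul, abs_of_pos hs]
  rw [← mul_assoc, ← mul_assoc]
  refine mul_le_mul_of_nonneg_right ?_ (Real.exp_pos _).le
  have h2 : t ≤ √t := by nlinarith
  nlinarith [abs_nonneg ξ, mul_nonneg hs.le (abs_nonneg ξ)]

theorem tendsto_const_div_one_add_sq (C : ℝ) :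
    Filter.Tendsto (fun ξ : ℝ => C / (1 + ξ ^ 2)) (Filter.cocompact ℝ) (nhds 0) := by
  refine Filter.Tendsto.const_div_atTop ?_ C
  refine Filter.tendsto_atTop_add_const_left _ _ ?_
  have h := (Filter.tendsto_pow_atTop (α := ℝ) two_ne_zero).comp
    (tendsto_norm_cocompact_atTop (E := ℝ))
  refine h.congr fun ξ => ?_
  simp

theorem integrable_const_div_one_add_sq (C : ℝ) : Integrable fun ξ : ℝ => C / (1 + ξ ^ 2) := by
  simpa only [div_eq_mul_inv] using integrable_inv_one_add_sq.const_mul C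

theorem one_add_sq_sq_mul_exp_le {a : ℝ} (ha : 0 < a) (ξ : ℝ) :
    (1 + ξ ^ 2) ^ 2 * Real.exp (-a * ξ ^ 2) ≤ 2 * (1 + 2 / a ^ 2) := by
  have hz : 0 ≤ a * ξ ^ 2 := by positivity
  have h3 := Real.quadratic_le_exp_of_nonneg hz
  have h4 : (1 + ξ ^ 2) ^ 2 ≤ 2 * (1 + 2 / a ^ 2) * Real.exp (a * ξ ^ 2) := by
    have h5 : ξ ^ 4 = (1 / a ^ 2) * (a * ξ ^ 2) ^ 2 := by field_simp
    have h6 : (1 + ξ ^ 2) ^ 2 ≤ 2 + 2 * ξ ^ 4 := by nlinarith [sq_nonneg (1 - ξ ^ 2)]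
    have h8 : 1 ≤ Real.exp (a * ξ ^ 2) := Real.one_le_exp hz
    have h9 : (a * ξ ^ 2) ^ 2 ≤ 2 * Real.exp (a * ξ ^ 2) := by nlinarith
    have h7 : ξ ^ 4 ≤ (1 / a ^ 2) * (2 * Real.exp (a * ξ ^ 2)) := by
      rw [h5]
      gcongr
    have h10 : 2 * (1 + 2 / a ^ 2) * Real.exp (a * ξ ^ 2)
        = 2 * Real.exp (a * ξ ^ 2) + 2 * ((1 / a ^ 2) * (2 * Real.exp (a * ξ ^ 2))) := by ring
    linarith
  calc _ ≤ 2 * (1 + 2 / a ^ 2) * Real.exp (a * ξ ^ 2) * Real.exp (-a * ξ ^ 2) := by gcongr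
    _ = _ := by rw [mul_assoc, ← Real.exp_add]; simp

theorem tendsto_mul_one_add_abs_mul_exp {a : ℝ} (ha : 0 < a) :
    Filter.Tendsto (fun ξ : ℝ => (1 + |ξ|) * Real.exp (-a * ξ ^ 2)) (Filter.cocompact ℝ)
      (nhds 0) := by
  have hle : ∀ ξ : ℝ, (1 + |ξ|) * Real.exp (-a * ξ ^ 2) ≤ (4 * (1 + 2 / a ^ 2)) / (1 + ξ ^ 2) := by
    intro ξ
    rw [le_div_iff₀ (by positivity)]
    have h1 : (1 + |ξ|) * (1 + ξ ^ 2) ≤ 2 * (1 + ξ ^ 2) ^ 2 := by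
      have : |ξ| ≤ 1 + 2 * ξ ^ 2 := by nlinarith [sq_abs ξ, sq_nonneg (|ξ| - 1), abs_nonneg ξ]
      nlinarith [sq_nonneg ξ]
    have h2 := one_add_sq_sq_mul_exp_le ha ξ
    calc _ = (1 + |ξ|) * (1 + ξ ^ 2) * Real.exp (-a * ξ ^ 2) := by ring
      _ ≤ 2 * (1 + ξ ^ 2) ^ 2 * Real.exp (-a * ξ ^ 2) := by gcongr
      _ ≤ _ := by linarith
  exact squeeze_zero (fun ξ => by positivity) hle (tendsto_const_div_one_add_sq _)

/-! ### Expansion of the approximate projections at infinity -/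

/-- `f(w) = c₀ + c₁ w + c₂ w² + c₃ w³ + w⁴ X(w)` with real coefficients and `X` analytic at `0`. -/
def Expands (f : ℂ → ℂ) (c₀ c₁ c₂ c₃ : ℝ) : Prop :=
  ∃ X : ℂ → ℂ, AnalyticAt ℂ X 0 ∧ ∀ w, f w = c₀ + c₁ * w + c₂ * w ^ 2 + c₃ * w ^ 3 + w ^ 4 * X w

theorem Expands.sub {f g : ℂ → ℂ} {c₀ c₁ c₂ c₃ d₀ d₁ d₂ d₃ : ℝ} (hf : Expands f c₀ c₁ c₂ c₃)
    (hg : Expands g d₀ d₁ d₂ d₃) :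
    Expands (fun w => f w - g w) (c₀ - d₀) (c₁ - d₁) (c₂ - d₂) (c₃ - d₃) := by
  obtain ⟨X, hX, hfX⟩ := hf
  obtain ⟨Y, hY, hgY⟩ := hg
  refine ⟨fun w => X w - Y w, hX.sub hY, fun w => ?_⟩
  simp only [hfX, hgY]
  push_cast
  ring

theorem Expands.mul {f g : ℂ → ℂ} {c₀ c₁ c₂ c₃ d₀ d₁ d₂ d₃ : ℝ} (hf : Expands f c₀ c₁ c₂ c₃)
    (hg : Expands g d₀ d₁ d₂ d₃) :
    Expands (fun w => f w * g w) (c₀ * d₀) (c₀ * d₁ + c₁ * d₀) (c₀ * d₂ + c₁ * d₁ + c₂ * d₀)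
      (c₀ * d₃ + c₁ * d₂ + c₂ * d₁ + c₃ * d₀) := by
  obtain ⟨X, hX, hfX⟩ := hf
  obtain ⟨Y, hY, hgY⟩ := hg
  refine ⟨fun w => (c₀ + c₁ * w + c₂ * w ^ 2 + c₃ * w ^ 3) * Y w
    + (d₀ + d₁ * w + d₂ * w ^ 2 + d₃ * w ^ 3) * X w + w ^ 4 * (X w * Y w)
    + (c₁ * d₃ + c₂ * d₂ + c₃ * d₁ + (c₂ * d₃ + c₃ * d₂) * w + c₃ * d₃ * w ^ 2),
    by fun_prop, fun w => ?_⟩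
  simp only [hfX, hgY]
  push_cast
  ring

/-- A quotient of expansions has the coefficients obtained by formal division, up to the order
that is covered by the expansions, and one further coefficient. -/
theorem Expands.exists_norm_div_sub_le {f g : ℂ → ℂ} {c₀ c₁ c₂ c₃ d₀ d₁ d₂ d₃ : ℝ}
    (hf : Expands f c₀ c₁ c₂ c₃) (hg : Expands g d₀ d₁ d₂ d₃) (hd : d₀ ≠ 0) {m₀ m₁ m₂ m₃ : ℝ}
    (h₀ : c₀ = d₀ * m₀) (h₁ : c₁ = d₀ * m₁ + d₁ * m₀) (h₂ : c₂ = d₀ * m₂ + d₁ * m₁ + d₂ * m₀)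
    (h₃ : c₃ = d₀ * m₃ + d₁ * m₂ + d₂ * m₁ + d₃ * m₀) :
    ∃ (m₄ : ℂ) (C r : ℝ), 0 < r ∧ ∀ w : ℂ, ‖w‖ ≤ r →
      ‖(g w)⁻¹ * f w - (m₀ + m₁ * w + m₂ * w ^ 2 + m₃ * w ^ 3 + m₄ * w ^ 4)‖ ≤ C * ‖w‖ ^ 5 := by
  have hm : Expands (fun w => (m₀ : ℂ) + m₁ * w + m₂ * w ^ 2 + m₃ * w ^ 3) m₀ m₁ m₂ m₃ :=
    ⟨fun _ => 0, analyticAt_const, fun w => by ring⟩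
  obtain ⟨X, hX, hfX⟩ := hf.sub (hg.mul hm)
  obtain ⟨Y, hY, hgY⟩ := hg
  have hgan : AnalyticAt ℂ g 0 := by
    rw [show g = _ from funext hgY]
    fun_prop
  have hg0 : g 0 ≠ 0 := by
    rw [hgY]
    simpa using hd
  have hq : AnalyticAt ℂ (fun w => (g w)⁻¹ * X w) 0 := (hgan.inv hg0).mul hX
  have hO := hq.differentiableAt.isBigO_sub
  obtain ⟨C, hC⟩ := hO.bound
  have hne : ∀ᶠ w in nhds (0 : ℂ), g w ≠ 0 := hgan.continuousAt.eventually_ne hg0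
  obtain ⟨r, hr, hball⟩ := Metric.eventually_nhds_iff.1 (hC.and hne)
  refine ⟨(g 0)⁻¹ * X 0, C, r / 2, by positivity, fun w hw => ?_⟩
  obtain ⟨h1, h2⟩ := hball (y := w) (by rw [dist_zero_right]; linarith)
  have h3 : f w = g w * (m₀ + m₁ * w + m₂ * w ^ 2 + m₃ * w ^ 3) + w ^ 4 * X w := by
    have : f w - g w * (m₀ + m₁ * w + m₂ * w ^ 2 + m₃ * w ^ 3) = _ := hfX w
    rw [h₀, h₁, h₂, h₃] at this
    rw [← sub_eq_iff_eq_add', this]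
    push_cast
    ring
  have h4 : (g w)⁻¹ * f w - (m₀ + m₁ * w + m₂ * w ^ 2 + m₃ * w ^ 3 + (g 0)⁻¹ * X 0 * w ^ 4)
      = w ^ 4 * ((g w)⁻¹ * X w - (g 0)⁻¹ * X 0) := by
    rw [h3]
    field_simp
    ring
  rw [h4, norm_mul, norm_pow]
  rw [sub_zero] at h1
  calc ‖w‖ ^ 4 * _ ≤ ‖w‖ ^ 4 * (C * ‖w‖) := by gcongr
    _ = _ := by ring

/-- The polarization, not symmetrized, of the entries of the adjugate of a `3 × 3` matrix. -/
def polarAdj {R : Type*} [CommRing R] (X Y : Matrix (Fin 3) (Fin 3) R) (a b : Fin 3) : R :=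
  X (b + 1) (a + 1) * Y (b + 2) (a + 2) - X (b + 1) (a + 2) * Y (b + 2) (a + 1)

theorem adjugate_eq_polarAdj {R : Type*} [CommRing R] (X : Matrix (Fin 3) (Fin 3) R)
    (a b : Fin 3) : X.adjugate a b = polarAdj X X a b := by
  rw [Matrix.adjugate_fin_three]
  fin_cases a <;> fin_cases b <;> simp [polarAdj] <;> ring

namespace GasState

variable (S : GasState)

theorem te_pos : 0 < S.te := one_div_pos.2 S.cv_pos

theorem mu_lt : S.mu < S.kap * S.te := by
  have h : S.mu / (S.kap * S.te) < 1 := S.prandtl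
  rwa [div_lt_one (mul_pos S.kap_pos S.te_pos)] at h

theorem alpha_zero_lt_one : S.alpha 0 < S.alpha 1 :=
  div_pos S.mu_pos S.v_pos

theorem alpha_one_lt_two : S.alpha 1 < S.alpha 2 :=
  div_lt_div_of_pos_right S.mu_lt S.v_pos

/-- The coefficient of `w⁰` in `w² λ I + w F' - B`. -/
def leadMat (j : Fin 3) : Matrix (Fin 3) (Fin 3) ℝ :=
  S.alpha j • (1 : Matrix (Fin 3) (Fin 3) ℝ) - S.visc

/-- The coefficient of `w²` in `w² λ I + w F' - B`. -/
def secondMat (j : Fin 3) : Matrix (Fin 3) (Fin 3) ℝ :=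
  S.beta j • (1 : Matrix (Fin 3) (Fin 3) ℝ)

/-- The leading coefficient of `∏_{k ≠ j} w² (λ_j - λ_k)`. -/
def denLead (j : Fin 3) : ℝ :=
  (S.alpha j - S.alpha (j + 1)) * (S.alpha j - S.alpha (j + 2))

/-- The coefficient of `w²` in `∏_{k ≠ j} w² (λ_j - λ_k)`. -/
def denSecond (j : Fin 3) : ℝ :=
  (S.alpha j - S.alpha (j + 1)) * (S.beta j - S.beta (j + 2))
    + (S.beta j - S.beta (j + 1)) * (S.alpha j - S.alpha (j + 2))

theorem denLead_ne_zero (j : Fin 3) : S.denLead j ≠ 0 := by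
  have h1 := S.alpha_zero_lt_one
  have h2 := S.alpha_one_lt_two
  fin_cases j
  · exact mul_ne_zero (sub_neg.2 h1).ne (sub_neg.2 (h1.trans h2)).ne
  · exact mul_ne_zero (sub_neg.2 h2).ne (sub_pos.2 h1).ne'
  · exact mul_ne_zero (sub_pos.2 (h1.trans h2)).ne' (sub_pos.2 h2).ne'

/-- In this and the next three lemmas, the coefficients of `w⁰`, …, `w³` are compared in the identity
`adj (w² λ_j^* I + w F' - B) = ∏_{k ≠ j} w² (λ_j^* - λ_k^*) M̂_j^*`. -/
theorem polarAdj_zero (j a b : Fin 3) :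
    polarAdj (S.leadMat j) (S.leadMat j) a b = S.denLead j * S.M0 j a b := by
  have h1 := S.mu_pos.ne'
  have h2 := S.v_pos.ne'
  have h3 := S.kap_pos.ne'
  have h4 := S.te_pos.ne'
  fin_cases j <;> fin_cases a <;> fin_cases b <;>
    simp [polarAdj, leadMat, denLead, alpha, visc, M0, M10, M20, M30]
  all_goals field_simp
  all_goals ring

theorem polarAdj_one (j a b : Fin 3) :
    polarAdj (S.leadMat j) S.fluxJac a b + polarAdj S.fluxJac (S.leadMat j) a b
      = S.denLead j * -S.M1 j a b := by
  have h1 := S.mu_pos.ne'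
  have h2 := S.v_pos.ne'
  have h3 := S.kap_pos.ne'
  have h4 := S.te_pos.ne'
  have h5 : S.mu - S.kap * S.te ≠ 0 := (sub_neg.2 S.mu_lt).ne
  fin_cases j <;> fin_cases a <;> fin_cases b <;>
    simp [polarAdj, leadMat, fluxJac, denLead, alpha, visc, M1, M11, M21, M31]
  all_goals field_simp
  all_goals ring

theorem polarAdj_two (j a b : Fin 3) :
    polarAdj (S.leadMat j) (S.secondMat j) a b + polarAdj S.fluxJac S.fluxJac a b
      + polarAdj (S.secondMat j) (S.leadMat j) a b
      = S.denLead j * -S.M2 j a b + S.denSecond j * S.M0 j a b := by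
  have h1 := S.mu_pos.ne'
  have h2 := S.v_pos.ne'
  have h3 := S.kap_pos.ne'
  have h4 := S.te_pos.ne'
  have h5 : S.mu - S.kap * S.te ≠ 0 := (sub_neg.2 S.mu_lt).ne
  have h6 : S.kap * S.te - S.mu ≠ 0 := (sub_pos.2 S.mu_lt).ne'
  have h7 : S.mu ^ 2 - S.kap * S.mu * S.te = S.mu * (S.mu - S.kap * S.te) := by ring
  fin_cases j <;> fin_cases a <;> fin_cases b <;>
    simp [polarAdj, leadMat, secondMat, fluxJac, denLead, denSecond, alpha, beta, visc, M0, M10,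
      M20, M30, M2, M12, M22, M32, h7]
  all_goals field_simp
  all_goals ring

theorem polarAdj_three (j a b : Fin 3) :
    polarAdj S.fluxJac (S.secondMat j) a b + polarAdj (S.secondMat j) S.fluxJac a b
      = S.denLead j * S.M3 j a b + S.denSecond j * -S.M1 j a b := by
  have h1 := S.mu_pos.ne'
  have h2 := S.v_pos.ne'
  have h3 := S.kap_pos.ne'
  have h4 := S.te_pos.ne'
  have h5 : S.mu - S.kap * S.te ≠ 0 := (sub_neg.2 S.mu_lt).ne
  have h6 : S.kap * S.te - S.mu ≠ 0 := (sub_pos.2 S.mu_lt).ne'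
  fin_cases j <;> fin_cases a <;> fin_cases b <;>
    simp [polarAdj, secondMat, fluxJac, denLead, denSecond, alpha, beta, M1, M11, M21, M31, M3,
      M13, M23, M33, r2, q2, q3]
  all_goals field_simp
  all_goals ring

/-- The term `w⁻⁴ (w² λ_j^* - α_j - β_j w²)` as a function of `w = (iη)⁻¹`. -/
def eigTail (K : Fin 3 → ℝ) (j : Fin 3) (w : ℂ) : ℂ :=
  S.A j 0 / (w ^ 2 - 1) + S.A j 1 * w ^ 2 / (w ^ 2 - 1) ^ 2 + S.A j 2 * w ^ 4 / (w ^ 2 - 1) ^ 3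
    - K j * w ^ 6 / (w ^ 2 - 1) ^ 4

/-- The function `w² λ_j^*` of `w = (iη)⁻¹`. -/
def scaledEig (K : Fin 3 → ℝ) (j : Fin 3) (w : ℂ) : ℂ :=
  S.alpha j + S.beta j * w ^ 2 + w ^ 4 * S.eigTail K j w

theorem analyticAt_eigTail (K : Fin 3 → ℝ) (j : Fin 3) : AnalyticAt ℂ (S.eigTail K j) 0 := by
  unfold eigTail
  have h : AnalyticAt ℂ (fun w : ℂ => w ^ 2 - 1) 0 := by fun_prop
  have h0 : ∀ n : ℕ, ((0 : ℂ) ^ 2 - 1) ^ n ≠ 0 := fun n => pow_ne_zero n (by norm_num)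
  exact (((analyticAt_const.div h (by norm_num)).add
    (AnalyticAt.div (by fun_prop) (h.pow 2) (h0 2))).add
    (AnalyticAt.div (by fun_prop) (h.pow 3) (h0 3))).sub
    (AnalyticAt.div (by fun_prop) (h.pow 4) (h0 4))

theorem lamStar_eq_scaledEig (K : Fin 3 → ℝ) (j : Fin 3) {η : ℂ} (h0 : η ≠ 0)
    (h1 : 1 + η ^ 2 ≠ 0) :
    S.lamStar K j η = (Complex.I * η) ^ 2 * S.scaledEig K j (Complex.I * η)⁻¹ := by
  have hw : (Complex.I * η)⁻¹ ^ 2 = -(η ^ 2)⁻¹ := by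
    rw [inv_pow, mul_pow, Complex.I_sq]
    field_simp
  have hw1 : -(η ^ 2)⁻¹ - 1 = -(1 + η ^ 2) / η ^ 2 := by
    field_simp
    ring
  have hw4 : (Complex.I * η)⁻¹ ^ 4 = (η ^ 4)⁻¹ := by
    rw [show (Complex.I * η)⁻¹ ^ 4 = ((Complex.I * η)⁻¹ ^ 2) ^ 2 by ring, hw]
    field_simp
  have hw6 : (Complex.I * η)⁻¹ ^ 6 = -(η ^ 6)⁻¹ := by
    rw [show (Complex.I * η)⁻¹ ^ 6 = ((Complex.I * η)⁻¹ ^ 2) ^ 3 by ring, hw]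
    field_simp
  rw [lamStar, scaledEig, eigTail, hw4, hw6, hw, hw1, mul_pow, Complex.I_sq, Fin.sum_univ_three]
  simp only [Fin.val_zero, Fin.val_one, Fin.val_two]
  field_simp
  ring

/-- The matrix `w² λ_j^* I + w F' - B`. -/
def scaledMat (K : Fin 3 → ℝ) (j : Fin 3) (w : ℂ) : Matrix (Fin 3) (Fin 3) ℂ :=
  S.scaledEig K j w • (1 : Matrix (Fin 3) (Fin 3) ℂ) + w • S.fluxJac.map (fun r => (r : ℂ))
    - S.visc.map (fun r => (r : ℂ))

theorem expands_scaledMat (K : Fin 3 → ℝ) (j a b : Fin 3) :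
    Expands (fun w => S.scaledMat K j w a b) (S.leadMat j a b) (S.fluxJac a b)
      (S.secondMat j a b) 0 := by
  refine ⟨fun w => S.eigTail K j w * (1 : Matrix (Fin 3) (Fin 3) ℂ) a b,
    (S.analyticAt_eigTail K j).mul analyticAt_const, fun w => ?_⟩
  have h1 : (((1 : Matrix (Fin 3) (Fin 3) ℝ) a b : ℝ) : ℂ) = (1 : Matrix (Fin 3) (Fin 3) ℂ) a b := by
    simp only [Matrix.one_apply]
    split_ifs <;> simp
  simp only [scaledMat, leadMat, secondMat, scaledEig, Matrix.sub_apply, Matrix.add_apply,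
    Matrix.smul_apply, Matrix.map_apply, smul_eq_mul]
  push_cast
  rw [h1]
  ring

theorem expands_scaledEig_sub (K : Fin 3 → ℝ) (j k : Fin 3) :
    Expands (fun w => S.scaledEig K j w - S.scaledEig K k w) (S.alpha j - S.alpha k) 0
      (S.beta j - S.beta k) 0 := by
  refine ⟨fun w => S.eigTail K j w - S.eigTail K k w,
    (S.analyticAt_eigTail K j).sub (S.analyticAt_eigTail K k), fun w => ?_⟩
  simp only [scaledEig]
  push_cast
  ring

theorem prod_erase_eq (f : Fin 3 → ℂ) (j : Fin 3) :
    ∏ k ∈ Finset.univ.erase j, f k = f (j + 1) * f (j + 2) := by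
  have h : Finset.univ.erase j = {j + 1, j + 2} := by
    revert j
    decide
  have hne : j + 1 ≠ j + 2 := by
    revert j
    decide
  rw [h, Finset.prod_pair hne]

theorem MhatStar_eq_scaled (K : Fin 3 → ℝ) (j a b : Fin 3) {η : ℂ} (h0 : η ≠ 0)
    (h1 : 1 + η ^ 2 ≠ 0) :
    S.MhatStar K j η a b
      = ((S.scaledEig K j (Complex.I * η)⁻¹ - S.scaledEig K (j + 1) (Complex.I * η)⁻¹)
          * (S.scaledEig K j (Complex.I * η)⁻¹ - S.scaledEig K (j + 2) (Complex.I * η)⁻¹))⁻¹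
        * polarAdj (S.scaledMat K j (Complex.I * η)⁻¹) (S.scaledMat K j (Complex.I * η)⁻¹) a b := by
  have hs : Complex.I * η ≠ 0 := mul_ne_zero Complex.I_ne_zero h0
  have hη : η ^ 2 = -(Complex.I * η) ^ 2 := by
    rw [mul_pow, Complex.I_sq]
    ring
  have hsym : S.symbol (S.lamStar K j η) η
      = (Complex.I * η) ^ 2 • S.scaledMat K j (Complex.I * η)⁻¹ := by
    ext a b
    simp only [symbol, scaledMat, lamStar_eq_scaledEig S K j h0 h1, Matrix.sub_apply,
      Matrix.add_apply, Matrix.smul_apply, Matrix.map_apply, smul_eq_mul]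
    rw [hη]
    field_simp
    ring
  rw [MhatStar, hsym, Matrix.adjugate_smul, prod_erase_eq, Matrix.smul_apply, Matrix.smul_apply,
    adjugate_eq_polarAdj, lamStar_eq_scaledEig S K j h0 h1, lamStar_eq_scaledEig S K (j + 1) h0 h1,
    lamStar_eq_scaledEig S K (j + 2) h0 h1, ← mul_sub, ← mul_sub, mul_mul_mul_comm, mul_inv,
    smul_eq_mul, smul_eq_mul, Fintype.card_fin, show 3 - 1 = 2 from rfl]
  field_simp

/-- The coefficients of the expansion of the entries of `M̂_j^*` in powers of `(iη)⁻¹`. -/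
def coeffM (j : Fin 3) (a b : Fin 3) : ℕ → ℝ
  | 0 => S.M0 j a b
  | 1 => -S.M1 j a b
  | 2 => -S.M2 j a b
  | 3 => S.M3 j a b
  | _ => 0

/-- The expansion of `M̂_j^*` at infinity. After division by `(iη)⁴` the numerator and the
denominator are functions of `w = (iη)⁻¹` that are analytic at `w = 0`; up to the order `w³` only the
leading two terms of the approximate eigenvalues contribute. -/
theorem exists_expansion_MhatStar (K : Fin 3 → ℝ) (j a b : Fin 3) :
    ∃ (m₄ : ℂ) (C R : ℝ), 2 ≤ R ∧ ∀ η : ℂ, R ≤ ‖η‖ →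
      ‖S.MhatStar K j η a b - (S.coeffM j a b 0 + S.coeffM j a b 1 * (Complex.I * η)⁻¹
        + S.coeffM j a b 2 * (Complex.I * η)⁻¹ ^ 2 + S.coeffM j a b 3 * (Complex.I * η)⁻¹ ^ 3
        + m₄ * (Complex.I * η)⁻¹ ^ 4)‖ ≤ C * ‖η‖⁻¹ ^ 5 := by
  have hX := fun p q => S.expands_scaledMat K j p q
  have hnum := ((hX (b + 1) (a + 1)).mul (hX (b + 2) (a + 2))).sub
    ((hX (b + 1) (a + 2)).mul (hX (b + 2) (a + 1)))
  have hden := (S.expands_scaledEig_sub K j (j + 1)).mul (S.expands_scaledEig_sub K j (j + 2))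
  have p0 := S.polarAdj_zero j a b
  have p1 := S.polarAdj_one j a b
  have p2 := S.polarAdj_two j a b
  have p3 := S.polarAdj_three j a b
  simp only [polarAdj, denLead, denSecond] at p0 p1 p2 p3
  obtain ⟨m₄, C, r, hr, h⟩ := hnum.exists_norm_div_sub_le hden (S.denLead_ne_zero j)
    (m₀ := S.M0 j a b) (m₁ := -S.M1 j a b) (m₂ := -S.M2 j a b) (m₃ := S.M3 j a b)
    (by linarith) (by linarith) (by linarith) (by linarith)
  refine ⟨m₄, C, max 2 r⁻¹, le_max_left _ _, fun η hη => ?_⟩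
  have h2 : 2 ≤ ‖η‖ := (le_max_left _ _).trans hη
  have h0 : η ≠ 0 := norm_pos_iff.1 (by linarith)
  have h1 : 1 + η ^ 2 ≠ 0 := fun h => by
    have : ‖η ^ 2‖ = 1 := by rw [eq_neg_of_add_eq_zero_right h]; simp
    rw [norm_pow] at this
    nlinarith
  have hn : ‖(Complex.I * η)⁻¹‖ = ‖η‖⁻¹ := by simp
  have hw := h (Complex.I * η)⁻¹ (by
    rw [hn]
    exact inv_le_of_inv_le₀ hr ((le_max_right _ _).trans hη))
  rw [hn] at hw
  rw [S.MhatStar_eq_scaled K j a b h0 h1]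
  simpa [coeffM, polarAdj] using hw

end GasState

/-! ### Bounds in the strip -/

namespace GasState

theorem abs_im_lt_one_of_mem_strip {σ : ℝ} (hσ1 : σ < 1) {η : ℂ} (hη : η ∈ strip σ) :
    |η.im| < 1 :=
  lt_trans hη hσ1

theorem norm_sq_le_of_mem_strip {σ : ℝ} (hσ1 : σ < 1) {η : ℂ} (hη : η ∈ strip σ) :
    ‖η‖ ^ 2 ≤ 1 + η.re ^ 2 := by
  have h := abs_im_lt_one_of_mem_strip hσ1 hη
  rw [← Complex.normSq_eq_norm_sq, Complex.normSq_apply]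
  nlinarith [abs_le.1 h.le, sq_abs η.im, abs_nonneg η.im]

/-- Since `1 + η² = (η - i) (η + i)`, this function stays away from zero in the strip, and it grows
like `(Re η)²`. -/
theorem le_norm_one_add_sq {σ : ℝ} (hσ1 : σ < 1) {η : ℂ} (hη : η ∈ strip σ) :
    (1 - σ) ^ 2 * (1 + η.re ^ 2) ≤ ‖1 + η ^ 2‖ := by
  have h : |η.im| < σ := hη
  have h0 : 0 ≤ (1 - σ) ^ 2 * (1 + η.re ^ 2) := by positivity
  have hσ0 : 0 < σ := (abs_nonneg _).trans_lt h
  obtain ⟨ha, hb⟩ := abs_lt.1 h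
  have key : ∀ v : ℝ, 1 - σ ≤ |v| → (1 - σ) ^ 2 * (1 + η.re ^ 2) ≤ η.re ^ 2 + v ^ 2 := by
    intro v hv
    have h1 : (1 - σ) ^ 2 ≤ v ^ 2 := by
      rw [← sq_abs v]
      exact pow_le_pow_left₀ (by linarith) hv 2
    have h2 : (1 - σ) ^ 2 ≤ 1 := by nlinarith
    nlinarith [sq_nonneg η.re]
  have hfac : ‖1 + η ^ 2‖ ^ 2 = (η.re ^ 2 + (1 - η.im) ^ 2) * (η.re ^ 2 + (1 + η.im) ^ 2) := by
    rw [← Complex.normSq_eq_norm_sq, Complex.normSq_apply]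
    simp [sq]
    ring
  refine (pow_le_pow_iff_left₀ h0 (norm_nonneg _) two_ne_zero).1 ?_
  rw [hfac, sq]
  refine mul_le_mul (key _ ?_) (key _ ?_) h0 (by positivity)
  · rw [abs_of_pos (by linarith)]
    linarith
  · rw [abs_of_pos (by linarith)]
    linarith

theorem one_add_sq_ne_zero_of_mem_strip {σ : ℝ} (hσ1 : σ < 1) {η : ℂ} (hη : η ∈ strip σ) :
    1 + η ^ 2 ≠ 0 := by
  have h := le_norm_one_add_sq hσ1 hη
  have h2 : 0 < (1 - σ) ^ 2 * (1 + η.re ^ 2) := by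
    have : 0 < 1 - σ := by linarith
    positivity
  exact norm_pos_iff.1 (h2.trans_le h)

theorem norm_inv_one_add_sq_le {σ : ℝ} (hσ1 : σ < 1) {η : ℂ} (hη : η ∈ strip σ) :
    ‖(1 + η ^ 2)⁻¹‖ ≤ ((1 - σ) ^ 2)⁻¹ * (1 + η.re ^ 2)⁻¹ := by
  have : 0 < 1 - σ := by linarith
  rw [norm_inv, ← mul_inv]
  exact inv_anti₀ (by positivity) (le_norm_one_add_sq hσ1 hη)

theorem inv_one_add_sq_le_one (x : ℝ) : (1 + x ^ 2)⁻¹ ≤ 1 :=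
  inv_le_one_of_one_le₀ (by nlinarith [sq_nonneg x])

theorem norm_oddSymbol_sq_le {σ : ℝ} (hσ1 : σ < 1) {η : ℂ} (hη : η ∈ strip σ) :
    ‖oddSymbol η‖ ^ 2 ≤ ((1 - σ) ^ 2)⁻¹ ^ 2 * (1 + η.re ^ 2)⁻¹ := by
  have h1 := norm_inv_one_add_sq_le hσ1 hη
  have h2 := norm_sq_le_of_mem_strip hσ1 hη
  have h3 : (0:ℝ) < 1 + η.re ^ 2 := by positivity
  rw [oddSymbol, div_eq_mul_inv, norm_mul, norm_mul, Complex.norm_I, one_mul, mul_pow]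
  calc ‖η‖ ^ 2 * ‖(1 + η ^ 2)⁻¹‖ ^ 2
      ≤ (1 + η.re ^ 2) * (((1 - σ) ^ 2)⁻¹ * (1 + η.re ^ 2)⁻¹) ^ 2 := by gcongr
    _ = _ := by field_simp

theorem norm_oddSymbol_le {σ : ℝ} (hσ1 : σ < 1) {η : ℂ} (hη : η ∈ strip σ) :
    ‖oddSymbol η‖ ≤ ((1 - σ) ^ 2)⁻¹ := by
  refine (pow_le_pow_iff_left₀ (norm_nonneg _) (by positivity) two_ne_zero).1
    ((norm_oddSymbol_sq_le hσ1 hη).trans ?_)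
  exact mul_le_of_le_one_right (by positivity) (inv_one_add_sq_le_one _)

theorem differentiableOn_oddSymbol {σ : ℝ} (hσ1 : σ < 1) :
    DifferentiableOn ℂ oddSymbol (strip σ) := by
  unfold oddSymbol
  exact DifferentiableOn.div (by fun_prop) (by fun_prop)
    fun η hη => one_add_sq_ne_zero_of_mem_strip hσ1 hη

/-- In the strip `|Im η| < σ`, the function is `O((1 + (Re η)²)⁻¹)`. -/
def StripDecay (σ : ℝ) (f : ℂ → ℂ) : Prop :=
  ∃ C : ℝ, ∀ η ∈ strip σ, ‖f η‖ ≤ C / (1 + η.re ^ 2)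

/-- From a bound in the strip and an expansion `f = ∑_{l < 5} m_l (iη)^{-l} + O(η⁻⁵)` at infinity to
a bound for `(iη)^k f` minus its polynomial part. The term of order `η⁻¹` is removed by
`iη / (1 + η²)`, which is `-(iη)⁻¹ + O(η⁻³)` and has no singularity in the strip. -/
theorem stripDecay_of_expansion {f : ℂ → ℂ} {σ B C R : ℝ} (hσ1 : σ < 1)
    (hB : ∀ η ∈ strip σ, ‖f η‖ ≤ B) (m : ℕ → ℂ) (hR : 2 ≤ R)
    (h : ∀ η : ℂ, R ≤ ‖η‖ →
      ‖f η - ∑ l ∈ Finset.range 5, m l * (Complex.I * η)⁻¹ ^ l‖ ≤ C * ‖η‖⁻¹ ^ 5)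
    {k : ℕ} (hk : k ≤ 3) :
    StripDecay σ fun η => (Complex.I * η) ^ k * f η
      - ∑ l ∈ Finset.range (k + 1), m l * (Complex.I * η) ^ (k - l) + m (k + 1) * oddSymbol η := by
  set N : ℝ := ‖m 0‖ + ‖m 1‖ + ‖m 2‖ + ‖m 3‖ + ‖m 4‖ with hN
  have hmN : ∀ l < 5, ‖m l‖ ≤ N := fun l hl => by
    interval_cases l <;>
      linarith [norm_nonneg (m 0), norm_nonneg (m 1), norm_nonneg (m 2), norm_nonneg (m 3),
        norm_nonneg (m 4)]
  have hN0 : 0 ≤ N := (norm_nonneg _).trans (hmN 0 (by norm_num))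
  set c : ℝ := ((1 - σ) ^ 2)⁻¹
  have hc : 0 ≤ c := by positivity
  refine ⟨2 * (|C| + 4 * N) + (R ^ 3 * |B| + 4 * (N * R ^ 3) + N * c) * (1 + R ^ 2), fun η hη => ?_⟩
  rw [le_div_iff₀ (by positivity)]
  have hx : η.re ^ 2 ≤ ‖η‖ ^ 2 := by
    rw [← Complex.normSq_eq_norm_sq, Complex.normSq_apply]
    nlinarith [mul_self_nonneg η.im]
  rcases le_total R ‖η‖ with hRη | hRη
  · have hη2 : 2 ≤ ‖η‖ := hR.trans hRη
    have h0 : η ≠ 0 := norm_pos_iff.1 (by linarith)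
    have hs : Complex.I * η ≠ 0 := mul_ne_zero Complex.I_ne_zero h0
    have hone : 1 + η ^ 2 ≠ 0 := one_add_sq_ne_zero_of_mem_strip hσ1 hη
    set n : ℝ := ‖η‖⁻¹ with hn
    have hn0 : 0 ≤ n := by positivity
    have hn1 : n ≤ 1 := inv_le_one_of_one_le₀ (by linarith)
    have hnη : n * ‖η‖ = 1 := inv_mul_cancel₀ (by linarith)
    have hsn : ‖Complex.I * η‖ = ‖η‖ := by simp
    have hsi : ‖(Complex.I * η)⁻¹‖ = n := by simp [hn]
    have hq : ‖(Complex.I * η)⁻¹ + oddSymbol η‖ ≤ n ^ 2 := by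
      have e : (Complex.I * η)⁻¹ + oddSymbol η = (Complex.I * η)⁻¹ * (1 + η ^ 2)⁻¹ := by
        rw [oddSymbol]
        field_simp
        rw [Complex.I_sq]
        ring
      have hlow : ‖η‖ ≤ ‖1 + η ^ 2‖ := by
        have h1 := norm_sub_norm_le (η ^ 2) (-1)
        rw [norm_neg, norm_one, norm_pow, sub_neg_eq_add, add_comm (η ^ 2)] at h1
        nlinarith
      rw [e, norm_mul, hsi, norm_inv, sq n]
      exact mul_le_mul_of_nonneg_left (inv_anti₀ (by linarith) hlow) hn0
    have herr : ‖(Complex.I * η) ^ k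
        * (f η - ∑ l ∈ Finset.range 5, m l * (Complex.I * η)⁻¹ ^ l)‖ ≤ |C| * n ^ 2 := by
      rw [norm_mul, norm_pow, hsn]
      calc ‖η‖ ^ k * _ ≤ ‖η‖ ^ k * (|C| * n ^ 5) := by
            gcongr
            exact (h η hRη).trans (mul_le_mul_of_nonneg_right (le_abs_self C) (by positivity))
        _ = |C| * (n * ‖η‖) ^ k * n ^ (5 - k) := by
            rw [mul_pow, show n ^ 5 = n ^ k * n ^ (5 - k) by rw [← pow_add]; congr 1; omega]
            ring
        _ ≤ |C| * n ^ 2 := by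
            rw [hnη, one_pow, mul_one]
            exact mul_le_mul_of_nonneg_left
              (pow_le_pow_of_le_one hn0 hn1 (by omega)) (abs_nonneg C)
    have hterm : ∀ l < 5, ∀ p, 2 ≤ p → ‖m l * (Complex.I * η)⁻¹ ^ p‖ ≤ N * n ^ 2 := by
      intro l hl p hp
      rw [norm_mul, norm_pow, hsi]
      exact mul_le_mul (hmN l hl) (pow_le_pow_of_le_one hn0 hn1 hp) (by positivity) hN0
    have htermq : ∀ l < 5, ‖m l * ((Complex.I * η)⁻¹ + oddSymbol η)‖ ≤ N * n ^ 2 := fun l hl => by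
      rw [norm_mul]
      exact mul_le_mul (hmN l hl) hq (norm_nonneg _) hN0
    have hmain : ‖(Complex.I * η) ^ k * f η
        - ∑ l ∈ Finset.range (k + 1), m l * (Complex.I * η) ^ (k - l) + m (k + 1) * oddSymbol η‖
        ≤ (|C| + 4 * N) * n ^ 2 := by
      have hNn : 0 ≤ N * n ^ 2 := by positivity
      set e := f η - ∑ l ∈ Finset.range 5, m l * (Complex.I * η)⁻¹ ^ l with he
      have hf : f η = e + ∑ l ∈ Finset.range 5, m l * (Complex.I * η)⁻¹ ^ l := by rw [he]; ring
      rw [hf]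
      interval_cases k
      · have e1 : (Complex.I * η) ^ 0 * (e + ∑ l ∈ Finset.range 5, m l * (Complex.I * η)⁻¹ ^ l)
            - ∑ l ∈ Finset.range (0 + 1), m l * (Complex.I * η) ^ (0 - l)
            + m (0 + 1) * oddSymbol η
            = (Complex.I * η) ^ 0 * e + m 1 * ((Complex.I * η)⁻¹ + oddSymbol η)
              + m 2 * (Complex.I * η)⁻¹ ^ 2 + m 3 * (Complex.I * η)⁻¹ ^ 3
              + m 4 * (Complex.I * η)⁻¹ ^ 4 := by
          generalize Complex.I * η = s at hs ⊢
          simp [Finset.sum_range_succ]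
          ring
        rw [e1]
        refine (norm_add_le _ _).trans ?_
        have n1 := norm_add_le ((Complex.I * η) ^ 0 * e + m 1 * ((Complex.I * η)⁻¹ + oddSymbol η)
              + m 2 * (Complex.I * η)⁻¹ ^ 2) (m 3 * (Complex.I * η)⁻¹ ^ 3)
        have n2 := norm_add_le ((Complex.I * η) ^ 0 * e + m 1 * ((Complex.I * η)⁻¹ + oddSymbol η))
              (m 2 * (Complex.I * η)⁻¹ ^ 2)
        have n3 := norm_add_le ((Complex.I * η) ^ 0 * e) (m 1 * ((Complex.I * η)⁻¹ + oddSymbol η))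
        linarith [htermq 1 (by norm_num), hterm 2 (by norm_num) 2 (by norm_num),
          hterm 3 (by norm_num) 3 (by norm_num), hterm 4 (by norm_num) 4 (by norm_num)]
      · have e1 : (Complex.I * η) ^ 1 * (e + ∑ l ∈ Finset.range 5, m l * (Complex.I * η)⁻¹ ^ l)
            - ∑ l ∈ Finset.range (1 + 1), m l * (Complex.I * η) ^ (1 - l)
            + m (1 + 1) * oddSymbol η
            = (Complex.I * η) ^ 1 * e + m 2 * ((Complex.I * η)⁻¹ + oddSymbol η)
              + m 3 * (Complex.I * η)⁻¹ ^ 2 + m 4 * (Complex.I * η)⁻¹ ^ 3 := by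
          generalize Complex.I * η = s at hs ⊢
          simp [Finset.sum_range_succ]
          field_simp
          ring
        rw [e1]
        refine (norm_add_le _ _).trans ?_
        have n2 := norm_add_le ((Complex.I * η) ^ 1 * e + m 2 * ((Complex.I * η)⁻¹ + oddSymbol η))
              (m 3 * (Complex.I * η)⁻¹ ^ 2)
        have n3 := norm_add_le ((Complex.I * η) ^ 1 * e) (m 2 * ((Complex.I * η)⁻¹ + oddSymbol η))
        linarith [htermq 2 (by norm_num), hterm 3 (by norm_num) 2 (by norm_num),
          hterm 4 (by norm_num) 3 (by norm_num)]
      · have e1 : (Complex.I * η) ^ 2 * (e + ∑ l ∈ Finset.range 5, m l * (Complex.I * η)⁻¹ ^ l)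
            - ∑ l ∈ Finset.range (2 + 1), m l * (Complex.I * η) ^ (2 - l)
            + m (2 + 1) * oddSymbol η
            = (Complex.I * η) ^ 2 * e + m 3 * ((Complex.I * η)⁻¹ + oddSymbol η)
              + m 4 * (Complex.I * η)⁻¹ ^ 2 := by
          generalize Complex.I * η = s at hs ⊢
          simp [Finset.sum_range_succ]
          field_simp
          ring
        rw [e1]
        refine (norm_add_le _ _).trans ?_
        have n3 := norm_add_le ((Complex.I * η) ^ 2 * e) (m 3 * ((Complex.I * η)⁻¹ + oddSymbol η))
        linarith [htermq 3 (by norm_num), hterm 4 (by norm_num) 2 (by norm_num)]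
      · have e1 : (Complex.I * η) ^ 3 * (e + ∑ l ∈ Finset.range 5, m l * (Complex.I * η)⁻¹ ^ l)
            - ∑ l ∈ Finset.range (3 + 1), m l * (Complex.I * η) ^ (3 - l)
            + m (3 + 1) * oddSymbol η
            = (Complex.I * η) ^ 3 * e + m 4 * ((Complex.I * η)⁻¹ + oddSymbol η) := by
          generalize Complex.I * η = s at hs ⊢
          simp [Finset.sum_range_succ]
          field_simp
          ring
        rw [e1]
        refine (norm_add_le _ _).trans ?_
        linarith [htermq 4 (by norm_num)]
    have hfin : n ^ 2 * (1 + η.re ^ 2) ≤ 2 := by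
      have h1 : n ^ 2 * ‖η‖ ^ 2 = 1 := by rw [← mul_pow, hnη, one_pow]
      have h2 : n ^ 2 * (1 + η.re ^ 2) ≤ n ^ 2 * (1 + ‖η‖ ^ 2) := by gcongr
      nlinarith
    have hbig : 0 ≤ (R ^ 3 * |B| + 4 * (N * R ^ 3) + N * c) * (1 + R ^ 2) := by positivity
    calc _ ≤ (|C| + 4 * N) * n ^ 2 * (1 + η.re ^ 2) := by gcongr
      _ = (|C| + 4 * N) * (n ^ 2 * (1 + η.re ^ 2)) := by ring
      _ ≤ (|C| + 4 * N) * 2 := by gcongr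
      _ ≤ _ := by linarith
  · have hR0 : 0 ≤ R := by linarith
    have hpow : ∀ p ≤ 3, ‖Complex.I * η‖ ^ p ≤ R ^ 3 := fun p hp => by
      have : ‖Complex.I * η‖ ≤ R := by simpa using hRη
      calc _ ≤ R ^ p := by gcongr
        _ ≤ R ^ 3 := pow_le_pow_right₀ (by linarith) hp
    have h1 : ‖(Complex.I * η) ^ k * f η‖ ≤ R ^ 3 * |B| := by
      rw [norm_mul, norm_pow]
      exact mul_le_mul (hpow k hk) ((hB η hη).trans (le_abs_self B)) (norm_nonneg _) (by positivity)
    have h2 : ‖∑ l ∈ Finset.range (k + 1), m l * (Complex.I * η) ^ (k - l)‖ ≤ 4 * (N * R ^ 3) := by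
      refine (norm_sum_le _ _).trans ((Finset.sum_le_card_nsmul _ _ (N * R ^ 3) fun l hl => ?_).trans
        ?_)
      · rw [norm_mul, norm_pow]
        have := Finset.mem_range.1 hl
        exact mul_le_mul (hmN l (by omega)) (hpow _ (by omega)) (by positivity) hN0
      · rw [Finset.card_range, nsmul_eq_mul]
        have : ((k + 1 : ℕ) : ℝ) ≤ 4 := by exact_mod_cast (by omega : k + 1 ≤ 4)
        gcongr
    have h3 : ‖m (k + 1) * oddSymbol η‖ ≤ N * c := by
      rw [norm_mul]
      exact mul_le_mul (hmN _ (by omega)) (norm_oddSymbol_le hσ1 hη) (norm_nonneg _) hN0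
    have h4 : ‖(Complex.I * η) ^ k * f η
        - ∑ l ∈ Finset.range (k + 1), m l * (Complex.I * η) ^ (k - l) + m (k + 1) * oddSymbol η‖
        ≤ R ^ 3 * |B| + 4 * (N * R ^ 3) + N * c := by
      refine (norm_add_le _ _).trans (add_le_add ((norm_sub_le _ _).trans (add_le_add h1 h2)) h3)
    have h5 : 1 + η.re ^ 2 ≤ 1 + R ^ 2 := by nlinarith [norm_nonneg η]
    calc _ ≤ (R ^ 3 * |B| + 4 * (N * R ^ 3) + N * c) * (1 + R ^ 2) := by gcongr
      _ ≤ _ := by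
        have : 0 ≤ 2 * (|C| + 4 * N) := by positivity
        linarith

end GasState

/-! ### Rates at infinity in the strip -/

namespace GasState

theorem StripDecay.add {σ : ℝ} {f g : ℂ → ℂ} (hf : StripDecay σ f) (hg : StripDecay σ g) :
    StripDecay σ fun η => f η + g η := by
  obtain ⟨A, hA⟩ := hf
  obtain ⟨B, hB⟩ := hg
  refine ⟨A + B, fun η hη => (norm_add_le _ _).trans ?_⟩
  rw [add_div]
  exact add_le_add (hA η hη) (hB η hη)

theorem StripDecay.bdd_mul {σ : ℝ} {f g : ℂ → ℂ} {B : ℝ} (hf : ∀ η ∈ strip σ, ‖f η‖ ≤ B)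
    (hg : StripDecay σ g) : StripDecay σ fun η => f η * g η := by
  obtain ⟨C, hC⟩ := hg
  refine ⟨|B| * C, fun η hη => ?_⟩
  rw [norm_mul, mul_div_assoc]
  exact mul_le_mul ((hf η hη).trans (le_abs_self B)) (hC η hη) (norm_nonneg _) (abs_nonneg B)

theorem StripDecay.const_mul {σ : ℝ} {f : ℂ → ℂ} (hf : StripDecay σ f) (c : ℂ) :
    StripDecay σ fun η => c * f η :=
  StripDecay.bdd_mul (f := fun _ => c) (B := ‖c‖) (fun _ _ => le_rfl) hf

theorem StripDecay.exists_bound {σ : ℝ} {f : ℂ → ℂ} (hf : StripDecay σ f) :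
    ∃ C : ℝ, 0 ≤ C ∧ ∀ η ∈ strip σ, ‖f η‖ ≤ C / (1 + η.re ^ 2) := by
  obtain ⟨C, hC⟩ := hf
  refine ⟨|C|, abs_nonneg C, fun η hη => (hC η hη).trans ?_⟩
  gcongr
  exact le_abs_self C

theorem StripDecay.bounded {σ : ℝ} {f : ℂ → ℂ} (hf : StripDecay σ f) :
    ∃ C : ℝ, 0 ≤ C ∧ ∀ η ∈ strip σ, ‖f η‖ ≤ C := by
  obtain ⟨C, hC0, hC⟩ := hf.exists_bound
  refine ⟨C, hC0, fun η hη => (hC η hη).trans (div_le_self hC0 ?_)⟩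
  nlinarith [sq_nonneg η.re]

theorem stripDecay_inv_one_add_sq {σ : ℝ} (hσ1 : σ < 1) :
    StripDecay σ fun η => (1 + η ^ 2)⁻¹ :=
  ⟨((1 - σ) ^ 2)⁻¹, fun _ hη => by
    rw [div_eq_mul_inv]
    exact norm_inv_one_add_sq_le hσ1 hη⟩

theorem stripDecay_oddSymbol_mul_oddSymbol {σ : ℝ} (hσ1 : σ < 1) :
    StripDecay σ fun η => oddSymbol η * oddSymbol η :=
  ⟨((1 - σ) ^ 2)⁻¹ ^ 2, fun _ hη => by
    rw [norm_mul, ← sq, div_eq_mul_inv]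
    exact norm_oddSymbol_sq_le hσ1 hη⟩

variable (S : GasState)

/-- The part `λ_j^* + α_j η² - β_j` of the approximate eigenvalue that vanishes at infinity. -/
def eigRem (K : Fin 3 → ℝ) (j : Fin 3) (η : ℂ) : ℂ :=
  S.lamStar K j η - (-(S.alpha j : ℂ) * η ^ 2 + S.beta j)

theorem lamStar_eq (K : Fin 3 → ℝ) (j : Fin 3) (η : ℂ) :
    S.lamStar K j η = -(S.alpha j : ℂ) * η ^ 2 + S.beta j + S.eigRem K j η := by
  rw [eigRem]
  ring

/-- The eigenvalue remainder is `A_{j,1} / (1 + η²)` plus a term of the order of `(1 + η²)⁻²`. -/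
theorem eigRem_eq (K : Fin 3 → ℝ) (j : Fin 3) (η : ℂ) :
    S.eigRem K j η = (S.A j 0 : ℂ) * (1 + η ^ 2)⁻¹
      + ((1 + η ^ 2)⁻¹) * ((S.A j 1 + S.A j 2 * (1 + η ^ 2)⁻¹ - K j * ((1 + η ^ 2)⁻¹) ^ 2)
        * (1 + η ^ 2)⁻¹) := by
  rw [eigRem, lamStar, Fin.sum_univ_three]
  simp only [Fin.val_zero, Fin.val_one, Fin.val_two]
  simp only [div_eq_mul_inv, ← inv_pow]
  ring

theorem stripDecay_eigFactor {σ : ℝ} (hσ1 : σ < 1) (K : Fin 3 → ℝ) (j : Fin 3) :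
    StripDecay σ fun η => (S.A j 1 + S.A j 2 * (1 + η ^ 2)⁻¹ - K j * ((1 + η ^ 2)⁻¹) ^ 2)
        * (1 + η ^ 2)⁻¹ := by
  obtain ⟨C, hC0, hC⟩ := (stripDecay_inv_one_add_sq hσ1).bounded
  refine StripDecay.bdd_mul (B := ‖(S.A j 1 : ℂ)‖ + ‖(S.A j 2 : ℂ)‖ * C + ‖(K j : ℂ)‖ * C ^ 2)
    (fun η hη => ?_) (stripDecay_inv_one_add_sq hσ1)
  refine (norm_sub_le _ _).trans (add_le_add ((norm_add_le _ _).trans (add_le_add le_rfl ?_)) ?_)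
  · rw [norm_mul]
    exact mul_le_mul_of_nonneg_left (hC η hη) (norm_nonneg _)
  · rw [norm_mul, norm_pow]
    gcongr
    exact hC η hη

theorem stripDecay_eigRem {σ : ℝ} (hσ1 : σ < 1) (K : Fin 3 → ℝ) (j : Fin 3) :
    StripDecay σ (S.eigRem K j) := by
  obtain ⟨C, hC0, hC⟩ := (stripDecay_inv_one_add_sq hσ1).bounded
  have h := ((stripDecay_inv_one_add_sq hσ1).const_mul (S.A j 0 : ℂ)).add
    (StripDecay.bdd_mul hC (S.stripDecay_eigFactor hσ1 K j))
  rwa [show S.eigRem K j = _ from funext (S.eigRem_eq K j)]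

theorem norm_lamStar_le {σ : ℝ} (hσ1 : σ < 1) (K : Fin 3 → ℝ) (j : Fin 3) (R : ℝ) :
    ∃ B : ℝ, ∀ η ∈ strip σ, ‖η‖ ≤ R → ‖S.lamStar K j η‖ ≤ B := by
  obtain ⟨C, hC0, hC⟩ := (S.stripDecay_eigRem hσ1 K j).bounded
  refine ⟨|S.alpha j| * R ^ 2 + |S.beta j| + C, fun η hη hR => ?_⟩
  rw [lamStar_eq]
  refine (norm_add_le _ _).trans (add_le_add ((norm_add_le _ _).trans (add_le_add ?_ ?_)) (hC η hη))
  · rw [norm_mul, norm_neg, norm_pow, Complex.norm_real, Real.norm_eq_abs]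
    gcongr
  · rw [Complex.norm_real, Real.norm_eq_abs]

theorem differentiableOn_lamStar {σ : ℝ} (hσ1 : σ < 1) (K : Fin 3 → ℝ) (j : Fin 3) :
    DifferentiableOn ℂ (S.lamStar K j) (strip σ) := by
  have hz : ∀ n : ℕ, ∀ η ∈ strip σ, (1 + η ^ 2) ^ n ≠ 0 := fun n η hη =>
    pow_ne_zero n (one_add_sq_ne_zero_of_mem_strip hσ1 hη)
  have hd : ∀ (c : ℂ) (n : ℕ), DifferentiableOn ℂ (fun η : ℂ => c / (1 + η ^ 2) ^ n) (strip σ) :=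
    fun c n => DifferentiableOn.div (by fun_prop) (by fun_prop) (hz n)
  unfold lamStar
  simp only [Fin.sum_univ_three]
  exact (DifferentiableOn.add (by fun_prop) (((hd _ _).add (hd _ _)).add (hd _ _))).sub (hd _ _)

theorem MhatStar_apply (K : Fin 3 → ℝ) (j a b : Fin 3) (η : ℂ) :
    S.MhatStar K j η a b
      = ((S.lamStar K j η - S.lamStar K (j + 1) η) * (S.lamStar K j η - S.lamStar K (j + 2) η))⁻¹
        * polarAdj (S.symbol (S.lamStar K j η) η) (S.symbol (S.lamStar K j η) η) a b := by
  rw [MhatStar, prod_erase_eq, Matrix.smul_apply, adjugate_eq_polarAdj, smul_eq_mul]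

theorem symbol_apply (s η : ℂ) (a b : Fin 3) :
    S.symbol s η a b = s * (1 : Matrix (Fin 3) (Fin 3) ℂ) a b + Complex.I * η * S.fluxJac a b
      + η ^ 2 * S.visc a b := by
  simp [symbol]

variable {S}
variable {K : Fin 3 → ℝ} {σ₀ σs : ℝ}

theorem Admissible.exists_le_norm_sub (h : S.Admissible K σ₀ σs) :
    ∃ σ₁ > 0, ∀ j k, j ≠ k → ∀ η ∈ strip σ₀, σ₁ ≤ ‖S.lamStar K j η - S.lamStar K k η‖ := by
  obtain ⟨σ₁, h1, h2⟩ := h.separated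
  exact ⟨σ₁, h1, fun j k hjk η hη => (h2 k j hjk.symm η hη).trans (Complex.abs_re_le_norm _)⟩

theorem Admissible.differentiableOn_MhatStar (h : S.Admissible K σ₀ σs) (j a b : Fin 3) :
    DifferentiableOn ℂ (fun η => S.MhatStar K j η a b) (strip σ₀) := by
  obtain ⟨σ₁, h1, h2⟩ := h.exists_le_norm_sub
  have hl := h.analytic
  have hne : ∀ k, j ≠ k → ∀ η ∈ strip σ₀, S.lamStar K j η - S.lamStar K k η ≠ 0 :=
    fun k hk η hη => norm_pos_iff.1 (h1.trans_le (h2 j k hk η hη))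
  have hsym : ∀ p q, DifferentiableOn ℂ (fun η => S.symbol (S.lamStar K j η) η p q) (strip σ₀) := by
    intro p q
    simp only [symbol_apply]
    exact (((hl j).mul_const _).add (by fun_prop)).add (by fun_prop)
  simp only [MhatStar_apply]
  refine DifferentiableOn.mul (DifferentiableOn.inv (((hl j).sub (hl _)).mul ((hl j).sub (hl _)))
    fun η hη => mul_ne_zero (hne _ (by simp) η hη) (hne _ (by simp) η hη)) ?_
  simp only [polarAdj]
  exact ((hsym _ _).mul (hsym _ _)).sub ((hsym _ _).mul (hsym _ _))

theorem Admissible.exists_norm_MhatStar_le_of_norm_le (h : S.Admissible K σ₀ σs) (j a b : Fin 3)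
    (R : ℝ) : ∃ B : ℝ, ∀ η ∈ strip σ₀, ‖η‖ ≤ R → ‖S.MhatStar K j η a b‖ ≤ B := by
  obtain ⟨σ₁, h1, h2⟩ := h.exists_le_norm_sub
  obtain ⟨L, hL⟩ := S.norm_lamStar_le h.sigma_lt_one K j R
  set N : Fin 3 → Fin 3 → ℝ := fun p q => |L| * ‖(1 : Matrix (Fin 3) (Fin 3) ℂ) p q‖
    + |R| * ‖(S.fluxJac p q : ℂ)‖ + |R| ^ 2 * ‖(S.visc p q : ℂ)‖ with hN
  have hN0 : ∀ p q, 0 ≤ N p q := fun p q => by positivity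
  have hsym : ∀ p q, ∀ η ∈ strip σ₀, ‖η‖ ≤ R → ‖S.symbol (S.lamStar K j η) η p q‖ ≤ N p q := by
    intro p q η hη hR
    have hR' := hR.trans (le_abs_self R)
    rw [symbol_apply]
    refine (norm_add_le _ _).trans (add_le_add ((norm_add_le _ _).trans (add_le_add ?_ ?_)) ?_)
    · rw [norm_mul]
      gcongr
      exact (hL η hη hR).trans (le_abs_self L)
    · rw [norm_mul, norm_mul, Complex.norm_I, one_mul]
      gcongr
    · rw [norm_mul, norm_pow]
      gcongr
  refine ⟨(σ₁ * σ₁)⁻¹ * (N (b + 1) (a + 1) * N (b + 2) (a + 2)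
    + N (b + 1) (a + 2) * N (b + 2) (a + 1)), fun η hη hR => ?_⟩
  rw [MhatStar_apply, norm_mul, norm_inv, norm_mul]
  have hd1 := h2 j (j + 1) (by simp) η hη
  have hd2 := h2 j (j + 2) (by simp) η hη
  refine mul_le_mul (inv_anti₀ (by positivity) (mul_le_mul hd1 hd2 h1.le (norm_nonneg _))) ?_
    (norm_nonneg _) (by positivity)
  refine (norm_sub_le _ _).trans (add_le_add ?_ ?_)
  · rw [norm_mul]
    exact mul_le_mul (hsym _ _ η hη hR) (hsym _ _ η hη hR) (norm_nonneg _) (hN0 _ _)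
  · rw [norm_mul]
    exact mul_le_mul (hsym _ _ η hη hR) (hsym _ _ η hη hR) (norm_nonneg _) (hN0 _ _)

/-- In the strip the approximate projections are bounded, and `(iη)^k M̂_j^*` differs from its
polynomial part by `-m_{k+1} iη / (1 + η²)` up to an absolutely integrable remainder. -/
theorem Admissible.exists_MhatStar_bounds (h : S.Admissible K σ₀ σs) (j a b : Fin 3) :
    ∃ (B : ℝ) (m : ℕ → ℂ), 0 ≤ B ∧ (∀ η ∈ strip σ₀, ‖S.MhatStar K j η a b‖ ≤ B) ∧
      (∀ l < 4, m l = S.coeffM j a b l) ∧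
      ∀ k ≤ 3, StripDecay σ₀ fun η => (Complex.I * η) ^ k * S.MhatStar K j η a b
        - ∑ l ∈ Finset.range (k + 1), m l * (Complex.I * η) ^ (k - l)
        + m (k + 1) * oddSymbol η := by
  obtain ⟨m₄, C, R, hR, hexp⟩ := S.exists_expansion_MhatStar K j a b
  set m : ℕ → ℂ := fun l => if l = 4 then m₄ else (S.coeffM j a b l : ℂ) with hm
  have hexp' : ∀ η : ℂ, R ≤ ‖η‖ → ‖S.MhatStar K j η a b
      - ∑ l ∈ Finset.range 5, m l * (Complex.I * η)⁻¹ ^ l‖ ≤ C * ‖η‖⁻¹ ^ 5 := fun η hη => by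
    simpa [Finset.sum_range_succ, hm] using hexp η hη
  obtain ⟨B₁, hB₁⟩ := h.exists_norm_MhatStar_le_of_norm_le j a b R
  set N : ℝ := ∑ l ∈ Finset.range 5, ‖m l‖ with hN
  have hN0 : 0 ≤ N := Finset.sum_nonneg fun _ _ => norm_nonneg _
  have hB : ∀ η ∈ strip σ₀, ‖S.MhatStar K j η a b‖ ≤ max B₁ (|C| + N) := by
    intro η hη
    rcases le_total ‖η‖ R with hle | hge
    · exact (hB₁ η hη hle).trans (le_max_left _ _)
    · refine le_max_of_le_right ?_
      have hn1 : ‖η‖⁻¹ ≤ 1 := inv_le_one_of_one_le₀ (by linarith)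
      have hn0 : 0 ≤ ‖η‖⁻¹ := by positivity
      have h1 : ‖∑ l ∈ Finset.range 5, m l * (Complex.I * η)⁻¹ ^ l‖ ≤ N := by
        refine norm_sum_le_of_le _ fun l _ => ?_
        rw [norm_mul, norm_pow, norm_inv, norm_mul, Complex.norm_I, one_mul]
        exact mul_le_of_le_one_right (norm_nonneg _) (pow_le_one₀ hn0 hn1)
      have h2 : C * ‖η‖⁻¹ ^ 5 ≤ |C| :=
        (mul_le_mul_of_nonneg_right (le_abs_self C) (by positivity)).trans
          (mul_le_of_le_one_right (abs_nonneg C) (pow_le_one₀ hn0 hn1))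
      have h3 := norm_sub_norm_le (S.MhatStar K j η a b)
        (∑ l ∈ Finset.range 5, m l * (Complex.I * η)⁻¹ ^ l)
      linarith [hexp' η hge]
  refine ⟨max B₁ (|C| + N), m, le_max_of_le_right (by positivity), hB, fun l hl => ?_,
    fun k hk => stripDecay_of_expansion h.sigma_lt_one hB m hR hexp' hk⟩
  simp [hm, hl.ne]

end GasState

/-! ### Existence of admissible constants -/

namespace GasState

/-- The common form of the approximate eigenvalues, of their differences and of the functions in
the gap conditions. -/
def eigFun (a B : ℝ) (A : Fin 3 → ℝ) (K : ℝ) (η : ℂ) : ℂ :=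
  -(a : ℂ) * η ^ 2 + B + ∑ k : Fin 3, (A k : ℂ) / (1 + η ^ 2) ^ ((k : ℕ) + 1)
    - K / (1 + η ^ 2) ^ 4

theorem re_eigFun_ofReal (a B : ℝ) (A : Fin 3 → ℝ) (K x : ℝ) :
    (eigFun a B A K x).re = -a * x ^ 2 + B + (A 0 * (1 + x ^ 2)⁻¹ + A 1 * (1 + x ^ 2)⁻¹ ^ 2
      + A 2 * (1 + x ^ 2)⁻¹ ^ 3) - K * (1 + x ^ 2)⁻¹ ^ 4 := by
  have : eigFun a B A K x = ((-a * x ^ 2 + B + (A 0 * (1 + x ^ 2)⁻¹ + A 1 * (1 + x ^ 2)⁻¹ ^ 2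
      + A 2 * (1 + x ^ 2)⁻¹ ^ 3) - K * (1 + x ^ 2)⁻¹ ^ 4 : ℝ) : ℂ) := by
    rw [eigFun, Fin.sum_univ_three]
    simp only [Fin.val_zero, Fin.val_one, Fin.val_two]
    push_cast
    simp only [div_eq_mul_inv, ← inv_pow, pow_one]
  rw [this, Complex.ofReal_re]

theorem norm_pow_sub_pow_le_of_norm_le_four {z w : ℂ} (hz : ‖z‖ ≤ 4) (hw : ‖w‖ ≤ 4) (n : ℕ) :
    ‖z ^ n - w ^ n‖ ≤ n * 4 ^ n * ‖z - w‖ := by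
  induction n with
  | zero => simp
  | succ n ih =>
    have e : z ^ (n + 1) - w ^ (n + 1) = z ^ n * (z - w) + (z ^ n - w ^ n) * w := by ring
    rw [e]
    refine (norm_add_le _ _).trans ?_
    rw [norm_mul, norm_mul, norm_pow]
    have h1 : ‖z‖ ^ n * ‖z - w‖ ≤ 4 ^ n * ‖z - w‖ := by gcongr
    have h2 : ‖z ^ n - w ^ n‖ * ‖w‖ ≤ (n * 4 ^ n * ‖z - w‖) * 4 := by gcongr
    have h3 : 0 ≤ (4:ℝ) ^ n * ‖z - w‖ := by positivity
    push_cast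
    rw [pow_succ]
    nlinarith

theorem norm_inv_one_add_sq_sub_le {η : ℂ} (hη : η ∈ strip (1 / 2)) :
    ‖(1 + η ^ 2)⁻¹ - (1 + (η.re : ℂ) ^ 2)⁻¹‖ ≤ 8 * |η.im| := by
  have h12 : (1 / 2 : ℝ) < 1 := by norm_num
  have hne := one_add_sq_ne_zero_of_mem_strip h12 hη
  have hz := norm_inv_one_add_sq_le h12 hη
  have hy : |η.im| < 1 / 2 := hη
  set x := η.re with hx
  have hpos : (0:ℝ) < 1 + x ^ 2 := by positivity
  have hne' : (1 + (x : ℂ) ^ 2) ≠ 0 := one_add_sq_ne_zero x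
  have e : (1 + η ^ 2)⁻¹ - (1 + (x : ℂ) ^ 2)⁻¹
      = ((x : ℂ) - η) * (x + η) * (1 + η ^ 2)⁻¹ * (1 + (x : ℂ) ^ 2)⁻¹ := by
    field_simp
    ring
  have hx' : ‖(1 + (x : ℂ) ^ 2)⁻¹‖ = (1 + x ^ 2)⁻¹ := by
    rw [show (1 + (x : ℂ) ^ 2) = ((1 + x ^ 2 : ℝ) : ℂ) by push_cast; rfl, norm_inv,
      Complex.norm_real, Real.norm_of_nonneg hpos.le]
  have hη' : η = x + η.im * Complex.I := (Complex.re_add_im η).symm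
  have hd : ‖(x : ℂ) - η‖ = |η.im| := by
    rw [show (x : ℂ) - η = -(η.im * Complex.I) by
      rw [sub_eq_iff_eq_add]
      linear_combination -hη']
    simp
  have hs : ‖(x : ℂ) + η‖ ≤ 2 * (1 + x ^ 2) := by
    have h1 : ‖(x : ℂ) + η‖ ≤ |x| + (|x| + |η.im|) := by
      refine (norm_add_le _ _).trans ?_
      rw [Complex.norm_real, Real.norm_eq_abs]
      exact add_le_add le_rfl (Complex.norm_le_abs_re_add_abs_im η)
    nlinarith [sq_abs x, sq_nonneg (|x| - 1)]
  rw [e, norm_mul, norm_mul, norm_mul, hx', hd]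
  calc |η.im| * ‖(x : ℂ) + η‖ * ‖(1 + η ^ 2)⁻¹‖ * (1 + x ^ 2)⁻¹
      ≤ |η.im| * (2 * (1 + x ^ 2)) * (((1 - 1 / 2) ^ 2)⁻¹ * (1 + x ^ 2)⁻¹) * (1 + x ^ 2)⁻¹ := by
        gcongr
    _ = 8 * |η.im| * (1 + x ^ 2)⁻¹ := by
        field_simp
        norm_num
    _ ≤ 8 * |η.im| := mul_le_of_le_one_right (by positivity) (inv_one_add_sq_le_one x)

/-- In a narrow strip the real part of `eigFun` is hardly larger than on the real line. -/
theorem exists_strip_re_eigFun_le (a B : ℝ) (A : Fin 3 → ℝ) (K : ℝ) {ε : ℝ} (hε : 0 < ε) :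
    ∃ σ > 0, σ ≤ 1 / 2 ∧ ∀ η ∈ strip σ, (eigFun a B A K η).re ≤ (eigFun a B A K η.re).re + ε := by
  set M : ℝ := |a| + (|A 0| + |A 1| + |A 2| + |K|) * (4 * 4 ^ 4 * 8) + 1 with hM
  have hM0 : 0 < M := by positivity
  refine ⟨min (1 / 2) (ε / M), lt_min (by norm_num) (by positivity), min_le_left _ _,
    fun η hη => ?_⟩
  have hη1 : |η.im| < 1 / 2 := lt_of_lt_of_le hη (min_le_left _ _)
  have hη2 : |η.im| < ε / M := lt_of_lt_of_le hη (min_le_right _ _)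
  have h12 : (1 / 2 : ℝ) < 1 := by norm_num
  set z := (1 + η ^ 2)⁻¹ with hz
  set w := (1 + (η.re : ℂ) ^ 2)⁻¹ with hw
  have hzw : ‖z - w‖ ≤ 8 * |η.im| := norm_inv_one_add_sq_sub_le hη1
  have hb : ∀ ζ ∈ strip (1 / 2), ‖(1 + ζ ^ 2)⁻¹‖ ≤ 4 := fun ζ hζ => by
    refine (norm_inv_one_add_sq_le h12 hζ).trans ?_
    have := inv_one_add_sq_le_one ζ.re
    norm_num
    linarith
  have hz4 : ‖z‖ ≤ 4 := hb η hη1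
  have hw4 : ‖w‖ ≤ 4 := hb η.re (by simp [strip])
  have hpow : ∀ (c : ℝ) (n : ℕ), n ≤ 4 →
      ((c : ℂ) * z ^ n).re ≤ ((c : ℂ) * w ^ n).re + |c| * (4 * 4 ^ 4 * 8) * |η.im| := by
    intro c n hn
    have h1 := norm_pow_sub_pow_le_of_norm_le_four hz4 hw4 n
    have h2 : (n : ℝ) * 4 ^ n * ‖z - w‖ ≤ 4 * 4 ^ 4 * (8 * |η.im|) := by
      have : (n : ℝ) ≤ 4 := by exact_mod_cast hn
      gcongr
      norm_num
    have h3 : ((c : ℂ) * z ^ n).re - ((c : ℂ) * w ^ n).re ≤ |c| * ‖z ^ n - w ^ n‖ := by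
      rw [← Complex.sub_re, ← mul_sub]
      refine (Complex.re_le_norm _).trans ?_
      rw [norm_mul, Complex.norm_real, Real.norm_eq_abs]
    have h4 := mul_le_mul_of_nonneg_left (h1.trans h2) (abs_nonneg c)
    linarith
  have hsq : (-(a : ℂ) * η ^ 2).re ≤ (-(a : ℂ) * (η.re : ℂ) ^ 2).re + |a| * |η.im| := by
    have e1 : (-(a : ℂ) * η ^ 2).re = -a * (η.re * η.re - η.im * η.im) := by simp [sq]
    have e2 : (-(a : ℂ) * (η.re : ℂ) ^ 2).re = -a * (η.re * η.re) := by simp [sq]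
    rw [e1, e2]
    have h1 : a * (η.im * η.im) ≤ |a| * (|η.im| * |η.im|) := by
      rw [← abs_mul η.im, ← abs_mul]
      exact le_abs_self _
    have h2 : |a| * (|η.im| * |η.im|) ≤ |a| * |η.im| :=
      mul_le_mul_of_nonneg_left (by nlinarith [abs_nonneg η.im]) (abs_nonneg a)
    linarith
  have hfun : ∀ ζ : ℂ, (eigFun a B A K ζ).re = (-(a : ℂ) * ζ ^ 2).re + B
      + (((A 0 : ℂ) * (1 + ζ ^ 2)⁻¹ ^ 1).re + ((A 1 : ℂ) * (1 + ζ ^ 2)⁻¹ ^ 2).re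
        + ((A 2 : ℂ) * (1 + ζ ^ 2)⁻¹ ^ 3).re) + (((-K : ℝ) : ℂ) * (1 + ζ ^ 2)⁻¹ ^ 4).re := by
    intro ζ
    rw [eigFun, Fin.sum_univ_three, sub_eq_add_neg]
    simp only [Fin.val_zero, Fin.val_one, Fin.val_two, div_eq_mul_inv, ← inv_pow]
    simp only [Complex.add_re, Complex.ofReal_re, Complex.neg_re, zero_add]
    push_cast
    simp only [neg_mul, Complex.neg_re]
  rw [hfun, hfun]
  have hK := hpow (-K) 4 le_rfl
  rw [abs_neg] at hK
  have hfin : M * |η.im| ≤ ε := by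
    rw [lt_div_iff₀ hM0] at hη2
    linarith
  rw [hM] at hfin
  linarith [hpow (A 0) 1 (by norm_num), hpow (A 1) 2 (by norm_num), hpow (A 2) 3 (by norm_num),
    abs_nonneg η.im]

theorem sum_mul_pow_le (A : Fin 3 → ℝ) {u : ℝ} (hu : 0 ≤ u) (hu1 : u ≤ 1) :
    A 0 * u + A 1 * u ^ 2 + A 2 * u ^ 3 ≤ (|A 0| + |A 1| + |A 2|) * u := by
  have h1 : A 0 * u ≤ |A 0| * u := mul_le_mul_of_nonneg_right (le_abs_self _) hu
  have h2 : A 1 * u ^ 2 ≤ |A 1| * u :=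
    mul_le_mul (le_abs_self _) (pow_le_of_le_one hu hu1 two_ne_zero) (by positivity) (abs_nonneg _)
  have h3 : A 2 * u ^ 3 ≤ |A 2| * u :=
    mul_le_mul (le_abs_self _) (pow_le_of_le_one hu hu1 three_ne_zero) (by positivity) (abs_nonneg _)
  linarith

/-- With dissipation at infinity, a large constant `K` makes `eigFun` at most `-1` on the line. -/
theorem exists_forall_re_eigFun_le_neg_one {a : ℝ} (ha : 0 < a) (B : ℝ) (A : Fin 3 → ℝ) :
    ∃ K₀ > 0, ∀ K ≥ K₀, ∀ x : ℝ, (eigFun a B A K x).re ≤ -1 := by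
  set Q : ℝ := |B| + (|A 0| + |A 1| + |A 2|) + 1 with hQ
  have hQ0 : 0 < Q := by positivity
  set X : ℝ := 1 + Q / a with hX
  have hX0 : 0 < X := by positivity
  refine ⟨Q * X ^ 4, by positivity, fun K hK x => ?_⟩
  have hK0 : 0 ≤ K := le_trans (by positivity) hK
  rw [re_eigFun_ofReal]
  set u := (1 + x ^ 2)⁻¹ with hu
  have hu0 : 0 < u := by positivity
  have hu1 : u ≤ 1 := inv_one_add_sq_le_one x
  have hS := sum_mul_pow_le A hu0.le hu1
  have hS' : (|A 0| + |A 1| + |A 2|) * u ≤ |A 0| + |A 1| + |A 2| :=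
    mul_le_of_le_one_right (by positivity) hu1
  have hB := le_abs_self B
  by_cases hx : Q ≤ a * x ^ 2
  · have : 0 ≤ K * u ^ 4 := by positivity
    linarith
  · have hx2 : 1 + x ^ 2 ≤ X := by
      have : x ^ 2 ≤ Q / a := by
        rw [le_div_iff₀ ha]
        linarith
      linarith
    have huX : 1 ≤ X * u := by
      rw [hu, ← div_eq_mul_inv, le_div_iff₀ (by positivity)]
      linarith
    have h1 : Q ≤ K * u ^ 4 := by
      calc Q = Q * 1 := (mul_one Q).symm
        _ ≤ Q * (X * u) ^ 4 := by gcongr; exact one_le_pow₀ huX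
        _ = Q * X ^ 4 * u ^ 4 := by ring
        _ ≤ K * u ^ 4 := by gcongr
    have h2 : 0 ≤ a * x ^ 2 := by positivity
    linarith

/-- Without dissipation, but with a negative limit `B` at infinity, a large constant `K` makes
`eigFun` at most `B / 2` on the line. -/
theorem exists_forall_re_eigFun_le_half {B : ℝ} (hB : B < 0) (A : Fin 3 → ℝ) :
    ∃ K₀ > 0, ∀ K ≥ K₀, ∀ x : ℝ, (eigFun 0 B A K x).re ≤ B / 2 := by
  set Q : ℝ := |A 0| + |A 1| + |A 2| with hQ
  have hQ0 : 0 ≤ Q := by positivity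
  have hB' : 0 < -B := by linarith
  refine ⟨1 + Q * (2 * Q / -B) ^ 3, by positivity, fun K hK x => ?_⟩
  have hK0 : 0 ≤ K := le_trans (by positivity) hK
  rw [re_eigFun_ofReal]
  set u := (1 + x ^ 2)⁻¹ with hu
  have hu0 : 0 < u := by positivity
  have hu1 : u ≤ 1 := inv_one_add_sq_le_one x
  have hS := sum_mul_pow_le A hu0.le hu1
  by_cases hx : Q * u ≤ -B / 2
  · have : 0 ≤ K * u ^ 4 := by positivity
    linarith
  · have h1 : 1 ≤ 2 * Q / -B * u := by
      rw [div_mul_eq_mul_div, le_div_iff₀ hB']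
      linarith
    have h2 : Q * u ≤ K * u ^ 4 := by
      calc Q * u = Q * u * 1 := (mul_one _).symm
        _ ≤ Q * u * (2 * Q / -B * u) ^ 3 := by gcongr; exact one_le_pow₀ h1
        _ = Q * (2 * Q / -B) ^ 3 * u ^ 4 := by ring
        _ ≤ K * u ^ 4 := by
          gcongr
          linarith
    linarith

variable (S : GasState)

theorem lamStar_sub_eq_eigFun (K : Fin 3 → ℝ) (j k : Fin 3) (η : ℂ) :
    S.lamStar K k η - S.lamStar K j η
      = eigFun (S.alpha k - S.alpha j) (S.beta k - S.beta j) (fun i => S.A k i - S.A j i)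
        (K k - K j) η := by
  simp only [lamStar, eigFun, Fin.sum_univ_three]
  push_cast
  ring

theorem lamStar_add_eq_eigFun (K : Fin 3 → ℝ) (j : Fin 3) (a : ℝ) (η : ℂ) :
    S.lamStar K j η + (a : ℂ) * (η ^ 2 + 1)
      = eigFun (S.alpha j - a) (S.beta j + a) (S.A j) (K j) η := by
  simp only [lamStar, eigFun]
  push_cast
  ring

theorem beta_zero_neg : S.beta 0 < 0 := by
  have hpv : S.pv < 0 :=
    div_neg_of_neg_of_pos (neg_neg_of_pos (mul_pos S.R_pos (div_pos S.e_pos S.cv_pos)))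
      (pow_pos S.v_pos 2)
  exact div_neg_of_neg_of_pos (mul_neg_of_pos_of_neg S.v_pos hpv) S.mu_pos

/-- Admissible constants exist: take `K₁`, `K₂ - K₁` and `K₃ - K₂` large, so that on the line
the gap conditions hold and `λ₃^* < λ₂^* < λ₁^*`, and then a narrow strip. -/
theorem exists_admissible : ∃ (K : Fin 3 → ℝ) (σ₀ σs : ℝ), S.Admissible K σ₀ σs := by
  have hα1 : 0 < S.mu / (2 * S.v) := div_pos S.mu_pos (mul_pos two_pos S.v_pos)
  have hα2 : 0 < S.kap * S.te / (2 * S.v) :=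
    div_pos (mul_pos S.kap_pos S.te_pos) (mul_pos two_pos S.v_pos)
  have e1 : S.alpha 1 - S.mu / (2 * S.v) = S.mu / (2 * S.v) := by
    have := S.v_pos.ne'
    simp only [alpha, Matrix.cons_val_one, Matrix.cons_val_zero]
    field_simp
    ring
  have e2 : S.alpha 2 - S.kap * S.te / (2 * S.v) = S.kap * S.te / (2 * S.v) := by
    have := S.v_pos.ne'
    simp only [alpha, Matrix.cons_val]
    field_simp
    ring
  obtain ⟨k0, hk0, H0⟩ := exists_forall_re_eigFun_le_half S.beta_zero_neg (S.A 0)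
  obtain ⟨k10, hk10, H10⟩ := exists_forall_re_eigFun_le_neg_one (sub_pos.2 S.alpha_zero_lt_one)
    (S.beta 1 - S.beta 0) (fun i => S.A 1 i - S.A 0 i)
  obtain ⟨k1, hk1, H1⟩ := exists_forall_re_eigFun_le_neg_one hα1
    (S.beta 1 + S.mu / (2 * S.v)) (S.A 1)
  obtain ⟨k21, hk21, H21⟩ := exists_forall_re_eigFun_le_neg_one (sub_pos.2 S.alpha_one_lt_two)
    (S.beta 2 - S.beta 1) (fun i => S.A 2 i - S.A 1 i)
  obtain ⟨k2, hk2, H2⟩ := exists_forall_re_eigFun_le_neg_one hα2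
    (S.beta 2 + S.kap * S.te / (2 * S.v)) (S.A 2)
  set K : Fin 3 → ℝ := ![k0, k0 + k10 + k1, k0 + k10 + k1 + k21 + k2] with hK
  have hK0 : K 0 = k0 := rfl
  have hK1 : K 1 = k0 + k10 + k1 := rfl
  have hK2 : K 2 = k0 + k10 + k1 + k21 + k2 := rfl
  have hβ := S.beta_zero_neg
  set δ : ℝ := min (-S.beta 0 / 2) 1 with hδ
  have hδ0 : 0 < δ := lt_min (by linarith) one_pos
  have hδ1 : δ ≤ 1 := min_le_right _ _
  have hδ2 : δ ≤ -S.beta 0 / 2 := min_le_left _ _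
  have hε : 0 < δ / 4 := by positivity
  obtain ⟨s0, hs0, hs0', P0⟩ := exists_strip_re_eigFun_le 0 (S.beta 0) (S.A 0) (K 0) hε
  obtain ⟨s1, hs1, -, P1⟩ := exists_strip_re_eigFun_le (S.mu / (2 * S.v))
    (S.beta 1 + S.mu / (2 * S.v)) (S.A 1) (K 1) hε
  obtain ⟨s2, hs2, -, P2⟩ := exists_strip_re_eigFun_le (S.kap * S.te / (2 * S.v))
    (S.beta 2 + S.kap * S.te / (2 * S.v)) (S.A 2) (K 2) hε
  obtain ⟨s10, hs10, -, P10⟩ := exists_strip_re_eigFun_le (S.alpha 1 - S.alpha 0)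
    (S.beta 1 - S.beta 0) (fun i => S.A 1 i - S.A 0 i) (K 1 - K 0) hε
  obtain ⟨s21, hs21, -, P21⟩ := exists_strip_re_eigFun_le (S.alpha 2 - S.alpha 1)
    (S.beta 2 - S.beta 1) (fun i => S.A 2 i - S.A 1 i) (K 2 - K 1) hε
  set σ : ℝ := min s0 (min (min s1 s2) (min s10 s21)) with hσ
  have hσ0 : 0 < σ := by simp [hσ, hs0, hs1, hs2, hs10, hs21]
  have hmono : ∀ {s : ℝ}, σ ≤ s → ∀ η ∈ strip σ, η ∈ strip s := fun hs η hη => lt_of_lt_of_le hη hs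
  have l0 : σ ≤ s0 := min_le_left _ _
  have l1 : σ ≤ s1 := (min_le_right _ _).trans ((min_le_left _ _).trans (min_le_left _ _))
  have l2 : σ ≤ s2 := (min_le_right _ _).trans ((min_le_left _ _).trans (min_le_right _ _))
  have l10 : σ ≤ s10 := (min_le_right _ _).trans ((min_le_right _ _).trans (min_le_left _ _))
  have l21 : σ ≤ s21 := (min_le_right _ _).trans ((min_le_right _ _).trans (min_le_right _ _))
  have hσ1 : σ < 1 := by linarith
  have B0 : ∀ η ∈ strip σ, (S.lamStar K 0 η).re ≤ -(3 * δ / 4) := fun η hη => by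
    have h1 := P0 η (hmono l0 η hη)
    have h2 := H0 (K 0) hK0.ge η.re
    have h3 : (S.lamStar K 0 η).re = (eigFun 0 (S.beta 0) (S.A 0) (K 0) η).re := rfl
    linarith
  have B10 : ∀ η ∈ strip σ, (S.lamStar K 1 η - S.lamStar K 0 η).re ≤ -(3 * δ / 4) := fun η hη => by
    have h1 := P10 η (hmono l10 η hη)
    have h2 := H10 (K 1 - K 0) (by rw [hK0, hK1]; linarith) η.re
    rw [lamStar_sub_eq_eigFun]
    linarith
  have B21 : ∀ η ∈ strip σ, (S.lamStar K 2 η - S.lamStar K 1 η).re ≤ -(3 * δ / 4) := fun η hη => by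
    have h1 := P21 η (hmono l21 η hη)
    have h2 := H21 (K 2 - K 1) (by rw [hK2, hK1]; linarith) η.re
    rw [lamStar_sub_eq_eigFun]
    linarith
  refine ⟨K, σ, δ / 2, ?_, hσ0, hσ1, by positivity, fun j => S.differentiableOn_lamStar hσ1 K j,
    ⟨-(3 * δ / 4), by linarith, B0⟩, ⟨-(3 * δ / 4), by linarith, fun η hη => ?_⟩,
    ⟨-(3 * δ / 4), by linarith, fun η hη => ?_⟩, 3 * δ / 4, by positivity, ?_⟩
  · intro j
    fin_cases j
    · exact hK0 ▸ hk0
    · change 0 < K 1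
      rw [hK1]
      positivity
    · change 0 < K 2
      rw [hK2]
      positivity
  · have h1 := P1 η (hmono l1 η hη)
    have h2 := H1 (K 1) (by rw [hK1]; linarith) η.re
    rw [lamStar_add_eq_eigFun, e1]
    linarith
  · have h1 := P2 η (hmono l2 η hη)
    have h2 := H2 (K 2) (by rw [hK2]; linarith) η.re
    rw [lamStar_add_eq_eigFun, e2]
    linarith
  · have hlt : ∀ j k : Fin 3, j < k → ∀ η ∈ strip σ,
        (S.lamStar K k η - S.lamStar K j η).re ≤ -(3 * δ / 4) := by
      intro j k hjk η hη
      have b10 := B10 η hη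
      have b21 := B21 η hη
      simp only [Complex.sub_re] at b10 b21 ⊢
      fin_cases j <;> fin_cases k <;> simp at hjk ⊢ <;> linarith
    intro j k hjk η hη
    rcases lt_or_gt_of_ne hjk with hlt' | hlt'
    · exact le_abs.2 (Or.inr (by linarith [hlt j k hlt' η hη]))
    · refine le_abs.2 (Or.inl ?_)
      have := hlt k j hlt' η hη
      rw [← neg_sub, Complex.neg_re] at this
      linarith

end GasState

/-! ### The approximate Green's function in the strip -/

/-- A first order bound for differences of exponentials, with the larger of the two sizes. -/
theorem norm_exp_add_sub_exp_le {z₀ z : ℂ} {M : ℝ} (h₀ : z₀.re ≤ M) (h₁ : (z₀ + z).re ≤ M) :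
    ‖Complex.exp (z₀ + z) - Complex.exp z₀‖ ≤ Real.exp M * ‖z‖ := by
  have h := (convex_halfSpace_re_le M).norm_image_sub_le_of_norm_deriv_le (𝕜 := ℂ)
    (f := Complex.exp) (C := Real.exp M) (x := z₀) (y := z₀ + z)
    (fun w _ => Complex.differentiableAt_exp)
    (fun w hw => by
      rw [Complex.deriv_exp, Complex.norm_exp]
      exact Real.exp_le_exp.2 hw) h₀ h₁
  simpa using h

/-- The second order version of `norm_exp_add_sub_exp_le`. -/
theorem norm_exp_add_sub_le {z₀ z : ℂ} {M : ℝ} (h₀ : z₀.re ≤ M) (h₁ : (z₀ + z).re ≤ M) :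
    ‖Complex.exp (z₀ + z) - Complex.exp z₀ * (1 + z)‖ ≤ Real.exp M * ‖z‖ ^ 2 := by
  have hseg : ∀ w ∈ segment ℝ z₀ (z₀ + z), w.re ≤ M ∧ ‖w - z₀‖ ≤ ‖z‖ := by
    rintro w hw
    refine ⟨(convex_halfSpace_re_le M).segment_subset h₀ h₁ hw, ?_⟩
    have := norm_sub_le_of_mem_segment hw
    simpa using this
  have h := (convex_segment z₀ (z₀ + z)).norm_image_sub_le_of_norm_deriv_le (𝕜 := ℂ)
    (f := fun w => Complex.exp w - w * Complex.exp z₀) (C := Real.exp M * ‖z‖)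
    (x := z₀) (y := z₀ + z) (fun w _ => by fun_prop)
    (fun w hw => by
      have hd : HasDerivAt (fun w => Complex.exp w - w * Complex.exp z₀)
          (Complex.exp w - 1 * Complex.exp z₀) w :=
        (Complex.hasDerivAt_exp w).sub ((hasDerivAt_id w).mul_const _)
      rw [hd.deriv, one_mul]
      have e := norm_exp_add_sub_exp_le (z₀ := z₀) (z := w - z₀) (M := M) h₀
        (by rw [add_sub_cancel]; exact (hseg w hw).1)
      rw [add_sub_cancel] at e
      exact e.trans (by gcongr; exact (hseg w hw).2))
    (left_mem_segment ℝ _ _) (right_mem_segment ℝ _ _)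
  rw [add_sub_cancel_left] at h
  calc _ = ‖Complex.exp (z₀ + z) - (z₀ + z) * Complex.exp z₀
        - (Complex.exp z₀ - z₀ * Complex.exp z₀)‖ := by congr 1; ring
    _ ≤ _ := h
    _ = _ := by ring

theorem continuous_ofReal_of_differentiableOn_strip {f : ℂ → ℂ} {σ : ℝ} (hσ : 0 < σ)
    (hf : DifferentiableOn ℂ f (GasState.strip σ)) : Continuous fun x : ℝ => f x :=
  hf.continuousOn.comp_continuous (by fun_prop) fun x => by simpa [GasState.strip] using hσ

theorem ofReal_mem_strip {σ : ℝ} (hσ : 0 < σ) (x : ℝ) : (x : ℂ) ∈ GasState.strip σ := by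
  simpa [GasState.strip] using hσ

theorem integrable_of_strip {f : ℂ → ℂ} {σ : ℝ} (hσ : 0 < σ)
    (hf : DifferentiableOn ℂ f (GasState.strip σ)) {b : ℝ → ℝ} (hb : Integrable b)
    (hfb : ∀ η ∈ GasState.strip σ, ‖f η‖ ≤ b η.re) : Integrable fun x : ℝ => f x :=
  hb.mono' (continuous_ofReal_of_differentiableOn_strip hσ hf).aestronglyMeasurable
    (Filter.Eventually.of_forall fun x => by simpa using hfb x (ofReal_mem_strip hσ x))

theorem norm_invF_le_of_stripDecay {f : ℂ → ℂ} {σ C : ℝ} (hσ : 0 < σ)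
    (hf : DifferentiableOn ℂ f (GasState.strip σ))
    (hfb : ∀ η ∈ GasState.strip σ, ‖f η‖ ≤ C / (1 + η.re ^ 2)) (x : ℝ) :
    ‖invF (fun η => f η) x‖ ≤ C / 2 * Real.exp (-σ * |x|) := by
  refine (norm_invF_le_of_strip hσ hf (integrable_const_div_one_add_sq C)
    (tendsto_const_div_one_add_sq C) hfb x).trans (le_of_eq ?_)
  have hi : ∫ ξ : ℝ, C / (1 + ξ ^ 2) = C * Real.pi := by
    simp only [div_eq_mul_inv]
    rw [integral_const_mul, integral_univ_inv_one_add_sq]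
  rw [hi]
  have := Real.pi_ne_zero
  field_simp

namespace GasState

theorem norm_pow_le_of_mem_strip {σ : ℝ} (hσ1 : σ < 1) {η : ℂ} (hη : η ∈ strip σ) {k : ℕ}
    (hk : k ≤ 2) : ‖(Complex.I * η) ^ k‖ ≤ 1 + η.re ^ 2 := by
  have h := norm_sq_le_of_mem_strip hσ1 hη
  rw [norm_pow, norm_mul, Complex.norm_I, one_mul]
  have := norm_nonneg η
  interval_cases k <;> nlinarith [sq_nonneg η.re]

theorem norm_pow_le_mul_of_mem_strip {σ : ℝ} (hσ1 : σ < 1) {η : ℂ} (hη : η ∈ strip σ) {k : ℕ}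
    (hk : k ≤ 3) : ‖(Complex.I * η) ^ k‖ ≤ (1 + |η.re|) * (1 + η.re ^ 2) := by
  have ha := abs_nonneg η.re
  have hsq := sq_nonneg η.re
  rcases Nat.lt_or_ge k 3 with h | h
  · refine (norm_pow_le_of_mem_strip hσ1 hη (by omega : k ≤ 2)).trans ?_
    nlinarith
  · obtain rfl : k = 3 := by omega
    have h1 : ‖Complex.I * η‖ ≤ 1 + |η.re| := by
      rw [norm_mul, Complex.norm_I, one_mul]
      have := Complex.norm_le_abs_re_add_abs_im η
      have := abs_im_lt_one_of_mem_strip hσ1 hη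
      linarith
    rw [pow_succ', norm_mul]
    exact mul_le_mul h1 (norm_pow_le_of_mem_strip hσ1 hη le_rfl) (norm_nonneg _) (by linarith)

variable {S : GasState} {K : Fin 3 → ℝ} {σ₀ σs : ℝ}

theorem alpha_pos {j : Fin 3} (hj : j ≠ 0) : 0 < S.alpha j := by
  have h1 := S.alpha_zero_lt_one
  have h2 := S.alpha_one_lt_two
  have h0 : S.alpha 0 = 0 := rfl
  fin_cases j
  · exact absurd rfl hj
  · exact h0 ▸ h1
  · exact h0 ▸ (h1.trans h2)

/-- The gap conditions in one formula for the three modes. -/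
theorem Admissible.exists_re_lamStar_le (h : S.Admissible K σ₀ σs) (j : Fin 3) :
    ∃ m < -σs, ∀ η ∈ strip σ₀, (S.lamStar K j η).re ≤ m - S.alpha j / 2 * η.re ^ 2 := by
  have key : ∀ (a : ℝ) (i : Fin 3), a = S.alpha i / 2 → 0 ≤ a →
      (∃ m < -σs, ∀ η ∈ strip σ₀, (S.lamStar K i η + (a : ℂ) * (η ^ 2 + 1)).re ≤ m) →
      ∃ m < -σs, ∀ η ∈ strip σ₀, (S.lamStar K i η).re ≤ m - S.alpha i / 2 * η.re ^ 2 := by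
    rintro a i ha ha0 ⟨m, hm, hb⟩
    refine ⟨m, hm, fun η hη => ?_⟩
    have h1 := hb η hη
    have h2 : ((a : ℂ) * (η ^ 2 + 1)).re = a * (η.re ^ 2 - η.im ^ 2 + 1) := by
      rw [Complex.re_ofReal_mul]
      simp [sq]
    rw [Complex.add_re, h2] at h1
    have h3 : η.im ^ 2 ≤ 1 := by
      rw [← sq_abs]
      exact pow_le_one₀ (abs_nonneg _) (abs_im_lt_one_of_mem_strip h.sigma_lt_one hη).le
    rw [← ha]
    nlinarith
  have hv := S.v_pos.ne'
  fin_cases j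
  · obtain ⟨m, hm, hb⟩ := h.gap_one
    refine ⟨m, hm, fun η hη => ?_⟩
    have : S.alpha 0 = 0 := rfl
    simpa [this] using hb η hη
  · refine key _ 1 ?_ (div_pos S.mu_pos (mul_pos two_pos S.v_pos)).le h.gap_two
    simp only [alpha, Matrix.cons_val_one, Matrix.cons_val_zero]
    field_simp
  · refine key _ 2 ?_ (div_pos (mul_pos S.kap_pos S.te_pos) (mul_pos two_pos S.v_pos)).le
      h.gap_three
    simp only [alpha, Matrix.cons_val]
    field_simp

theorem GhatStar_apply (S : GasState) (K : Fin 3 → ℝ) (j : Fin 3) (t : ℝ) (η : ℂ) (a b : Fin 3) :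
    S.GhatStar K j t η a b = Complex.exp (S.lamStar K j η * t) * S.MhatStar K j η a b := rfl

theorem Admissible.differentiableOn_GhatStar (h : S.Admissible K σ₀ σs) (j a b : Fin 3) (t : ℝ) :
    DifferentiableOn ℂ (fun η => S.GhatStar K j t η a b) (strip σ₀) := by
  simp only [GhatStar_apply]
  exact ((h.analytic j).mul_const _).cexp.mul (h.differentiableOn_MhatStar j a b)

theorem Admissible.exists_norm_GhatStar_le (h : S.Admissible K σ₀ σs) (j a b : Fin 3) :
    ∃ B : ℝ, 0 ≤ B ∧ ∀ t : ℝ, 0 ≤ t → ∀ η ∈ strip σ₀, ‖S.GhatStar K j t η a b‖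
      ≤ B * (Real.exp (-σs * t) * Real.exp (-(S.alpha j / 2 * t) * η.re ^ 2)) := by
  obtain ⟨m, hm, hre⟩ := h.exists_re_lamStar_le j
  obtain ⟨B, -, hB0, hB, -⟩ := h.exists_MhatStar_bounds j a b
  refine ⟨B, hB0, fun t ht η hη => ?_⟩
  rw [GhatStar_apply, norm_mul, mul_comm, Complex.norm_exp, ← Real.exp_add]
  refine mul_le_mul (hB η hη) (Real.exp_le_exp.2 ?_) (Real.exp_pos _).le hB0
  rw [Complex.re_mul_ofReal]
  have h1 := mul_le_mul_of_nonneg_right (hre η hη) ht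
  have h2 : m * t ≤ -σs * t := mul_le_mul_of_nonneg_right hm.le ht
  nlinarith

theorem Admissible.bddMeas_GhatStar (h : S.Admissible K σ₀ σs) (j a b : Fin 3) {t : ℝ}
    (ht : 0 ≤ t) : BddMeas fun η : ℝ => S.GhatStar K j t (η : ℂ) a b := by
  obtain ⟨B, hB0, hB⟩ := h.exists_norm_GhatStar_le j a b
  refine ⟨(continuous_ofReal_of_differentiableOn_strip h.sigma_pos
    (h.differentiableOn_GhatStar j a b t)).measurable, B, fun η => ?_⟩
  refine (hB t ht η (ofReal_mem_strip h.sigma_pos η)).trans (mul_le_of_le_one_right hB0 ?_)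
  have hα : 0 ≤ S.alpha j := by
    rcases eq_or_ne j 0 with rfl | hj
    · exact le_rfl
    · exact (alpha_pos hj).le
  have h1 : 0 ≤ S.alpha j / 2 * t * (η : ℂ).re ^ 2 := by positivity
  have h2 : 0 ≤ σs * t := mul_nonneg h.sigmaStar_pos.le ht
  rw [← Real.exp_add, Real.exp_le_one_iff]
  linarith

theorem Admissible.rapidDecay_GhatStar (h : S.Admissible K σ₀ σs) {j : Fin 3} (hj : j ≠ 0)
    (a b : Fin 3) {t : ℝ} (ht : 0 < t) :
    RapidDecay fun η : ℝ => S.GhatStar K j t (η : ℂ) a b := by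
  obtain ⟨B, hB0, hB⟩ := h.exists_norm_GhatStar_le j a b
  have hα := alpha_pos (S := S) hj
  refine RapidDecay.of_le_gaussian (a := S.alpha j / 2 * t) (C := B * Real.exp (-σs * t))
    (continuous_ofReal_of_differentiableOn_strip h.sigma_pos
      (h.differentiableOn_GhatStar j a b t)) (by positivity) fun η => ?_
  rw [mul_assoc]
  exact hB t ht.le η (ofReal_mem_strip h.sigma_pos η)

/-! ### The parabolic modes -/

theorem Admissible.exists_norm_invF_GhatStar_le (h : S.Admissible K σ₀ σs) {j : Fin 3}
    (hj : j ≠ 0) (a b : Fin 3) :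
    ∃ C : ℝ, ∀ k ≤ 2, ∀ t : ℝ, 1 ≤ t → ∀ x : ℝ,
      ‖invF (fun η : ℝ => (Complex.I * η) ^ k * S.GhatStar K j t (η : ℂ) a b) x‖
        ≤ C * Real.exp (-σs * t - σ₀ * |x|) := by
  obtain ⟨B, hB0, hB⟩ := h.exists_norm_GhatStar_le j a b
  have hα : 0 < S.alpha j / 2 := half_pos (alpha_pos hj)
  set D : ℝ := 2 * (1 + 2 / (S.alpha j / 2) ^ 2)
  have hD : 0 ≤ D := by positivity
  refine ⟨B * D / 2, fun k hk t ht x => ?_⟩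
  have ht0 : 0 ≤ t := by linarith
  have hdiff : DifferentiableOn ℂ (fun η : ℂ => (Complex.I * η) ^ k * S.GhatStar K j t η a b)
      (strip σ₀) := DifferentiableOn.mul (by fun_prop) (h.differentiableOn_GhatStar j a b t)
  refine (norm_invF_le_of_stripDecay (C := B * D * Real.exp (-σs * t)) h.sigma_pos hdiff
    (fun η hη => ?_) x).trans (le_of_eq ?_)
  · rw [norm_mul, le_div_iff₀ (by positivity)]
    have h1 := norm_pow_le_of_mem_strip h.sigma_lt_one hη hk
    have h2 := hB t ht0 η hη
    have h3 : Real.exp (-(S.alpha j / 2 * t) * η.re ^ 2)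
        ≤ Real.exp (-(S.alpha j / 2) * η.re ^ 2) := by
      refine Real.exp_le_exp.2 ?_
      have : 0 ≤ S.alpha j / 2 * η.re ^ 2 := by positivity
      nlinarith
    calc ‖(Complex.I * η) ^ k‖ * ‖S.GhatStar K j t η a b‖ * (1 + η.re ^ 2)
        ≤ (1 + η.re ^ 2) * (B * (Real.exp (-σs * t)
          * Real.exp (-(S.alpha j / 2) * η.re ^ 2))) * (1 + η.re ^ 2) := by
          refine mul_le_mul_of_nonneg_right (mul_le_mul h1 (h2.trans ?_) (norm_nonneg _)
            (by positivity)) (by positivity)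
          gcongr
      _ = B * Real.exp (-σs * t) * ((1 + η.re ^ 2) ^ 2
          * Real.exp (-(S.alpha j / 2) * η.re ^ 2)) := by ring
      _ ≤ B * Real.exp (-σs * t) * D := by
          gcongr
          exact one_add_sq_sq_mul_exp_le hα η.re
      _ = _ := by ring
  · rw [sub_eq_add_neg, Real.exp_add, ← neg_mul]
    ring

/-- The decomposition of `(iη)^k Ĝ^{*,j}` behind the short time expansion: a polynomial times the
symbol of the heat kernel, a multiple of `iη / (1 + η²)` times that symbol, and a remainder which is
absolutely integrable uniformly in `t`. -/
theorem Admissible.exists_heat_decomposition (h : S.Admissible K σ₀ σs) {j : Fin 3} (hj : j ≠ 0)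
    (a b : Fin 3) {k : ℕ} (hk : k ≤ 3) :
    ∃ (c : ℂ) (C₁ C₂ : ℝ) (W : ℝ → ℂ → ℂ), 0 ≤ C₂ ∧
      (∀ t, DifferentiableOn ℂ (W t) (strip σ₀)) ∧
      (∀ t, ∀ η, (Complex.I * η) ^ k * S.GhatStar K j t η a b
        = ∑ l ∈ Finset.range (k + 1), (S.coeffM j a b l : ℂ)
            * ((Complex.I * η) ^ (k - l) * heatSymbol (S.alpha j) (S.beta j) t η)
          + c * (oddSymbol η * heatSymbol (S.alpha j) (S.beta j) t η) + W t η) ∧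
      ∀ t, 0 < t → t < 1 → ∀ η ∈ strip σ₀, ‖W t η‖ ≤ C₁ / (1 + η.re ^ 2)
        + C₂ * (t * ((1 + |η.re|) * Real.exp (-(S.alpha j * t) * η.re ^ 2))) := by
  obtain ⟨B, m, hB0, hB, hmM, hR⟩ := h.exists_MhatStar_bounds j a b
  have hσ1 := h.sigma_lt_one
  obtain ⟨CR, hCR0, hCR⟩ := (hR k hk).exists_bound
  obtain ⟨Cρ, hCρ0, hCρ⟩ := (S.stripDecay_eigRem hσ1 K j).exists_bound
  have hα := alpha_pos (S := S) hj
  set α := S.alpha j with hαdef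
  set β := S.beta j with hβdef
  set R : ℂ → ℂ := fun η => (Complex.I * η) ^ k * S.MhatStar K j η a b
        - ∑ l ∈ Finset.range (k + 1), m l * (Complex.I * η) ^ (k - l)
        + m (k + 1) * oddSymbol η with hRdef
  set E : ℝ := α + |β| with hE
  refine ⟨-m (k + 1), Real.exp E * CR, Real.exp (E + Cρ) * Cρ * B,
    fun t η => heatSymbol α β t η * R η + (Complex.exp (S.lamStar K j η * t)
      - heatSymbol α β t η) * ((Complex.I * η) ^ k * S.MhatStar K j η a b), by positivity,
    fun t => ?_, fun t η => ?_, fun t ht ht1 η hη => ?_⟩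
  · have hM := h.differentiableOn_MhatStar j a b
    have hs : ∀ n : ℕ, DifferentiableOn ℂ (fun η : ℂ => (Complex.I * η) ^ n) (strip σ₀) :=
      fun n => by fun_prop
    have hH := (differentiable_heatSymbol α β t).differentiableOn (s := strip σ₀)
    refine (hH.mul ((((hs k).mul hM).sub (DifferentiableOn.fun_sum fun l _ =>
      (hs (k - l)).const_mul (m l))).add ((differentiableOn_oddSymbol hσ1).const_mul _))).add
      ((((h.analytic j).mul_const _).cexp.sub hH).mul ((hs k).mul hM))
  · have hsum : ∑ l ∈ Finset.range (k + 1), (S.coeffM j a b l : ℂ)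
        * ((Complex.I * η) ^ (k - l) * heatSymbol α β t η)
        = (∑ l ∈ Finset.range (k + 1), m l * (Complex.I * η) ^ (k - l)) * heatSymbol α β t η := by
      rw [Finset.sum_mul]
      refine Finset.sum_congr rfl fun l hl => ?_
      rw [hmM l (by have := Finset.mem_range.1 hl; omega)]
      ring
    rw [hsum, GhatStar_apply, hRdef]
    ring
  · have hy : η.im ^ 2 ≤ 1 := by
      rw [← sq_abs]
      exact pow_le_one₀ (abs_nonneg _) (abs_im_lt_one_of_mem_strip hσ1 hη).le
    -- the imaginary part of `η` and the factor `e^{β t}` only contribute a constant for `t < 1`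
    have hexp : ((-(α : ℂ) * η ^ 2 + β) * t).re ≤ E - α * t * η.re ^ 2 := by
      have e : ((-(α : ℂ) * η ^ 2 + β) * t).re = (-α * (η.re ^ 2 - η.im ^ 2) + β) * t := by
        simp [sq]
      have h1 : β * t ≤ |β| := (mul_le_mul_of_nonneg_right (le_abs_self β) ht.le).trans
        (mul_le_of_le_one_right (abs_nonneg β) ht1.le)
      have h2 : α * t * η.im ^ 2 ≤ α := by
        have : t * η.im ^ 2 ≤ 1 := mul_le_one₀ ht1.le (sq_nonneg _) hy
        nlinarith
      rw [e, hE]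
      linarith
    have hH : ‖heatSymbol α β t η‖ ≤ Real.exp E := by
      rw [heatSymbol, Complex.norm_exp]
      have : 0 ≤ α * t * η.re ^ 2 := by positivity
      exact Real.exp_le_exp.2 (by linarith)
    have hρ := hCρ η hη
    have hρt : ‖S.eigRem K j η * t‖ ≤ Cρ / (1 + η.re ^ 2) * t := by
      rw [norm_mul, Complex.norm_real, Real.norm_of_nonneg ht.le]
      gcongr
    have hρ1 : (S.eigRem K j η * t).re ≤ Cρ := by
      refine (Complex.re_le_norm _).trans (hρt.trans ?_)
      have h1 : Cρ / (1 + η.re ^ 2) ≤ Cρ := div_le_self hCρ0 (by nlinarith [sq_nonneg η.re])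
      nlinarith
    have hdiff := norm_exp_add_sub_exp_le (z₀ := (-(α : ℂ) * η ^ 2 + β) * t)
      (z := S.eigRem K j η * t) (M := E + Cρ + (-(α * t) * η.re ^ 2)) (by linarith)
      (by rw [Complex.add_re]; linarith)
    rw [← add_mul, ← lamStar_eq] at hdiff
    have hp := norm_pow_le_mul_of_mem_strip hσ1 hη hk
    refine (norm_add_le _ _).trans (add_le_add ?_ ?_)
    · rw [norm_mul, mul_div_assoc]
      exact mul_le_mul hH (hCR η hη) (norm_nonneg _) (Real.exp_pos _).le
    · rw [norm_mul, norm_mul]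
      have h1 := hdiff.trans (mul_le_mul_of_nonneg_left hρt (Real.exp_pos _).le)
      have hpos : (0:ℝ) < 1 + η.re ^ 2 := by positivity
      calc _ ≤ (Real.exp (E + Cρ + -(α * t) * η.re ^ 2) * (Cρ / (1 + η.re ^ 2) * t))
            * (((1 + |η.re|) * (1 + η.re ^ 2)) * B) := by
            refine mul_le_mul h1 (mul_le_mul hp (hB η hη) (norm_nonneg _) (by positivity))
              (by positivity) (by positivity)
        _ = _ := by
            rw [Real.exp_add (E + Cρ)]
            field_simp

theorem Admissible.exists_norm_invF_sub_heat_le (h : S.Admissible K σ₀ σs) {j : Fin 3}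
    (hj : j ≠ 0) (a b : Fin 3) {k : ℕ} (hk : k ≤ 3) :
    ∃ C : ℝ, ∀ t : ℝ, 0 < t → t < 1 → ∀ x : ℝ,
      ‖invF (fun η : ℝ => (Complex.I * η) ^ k * S.GhatStar K j t (η : ℂ) a b) x
        - ((∑ l ∈ Finset.range (k + 1),
          S.coeffM j a b l * iteratedDeriv (k - l) (S.heat j t) x : ℝ) : ℂ)‖
        ≤ C * Real.exp (-σs * t - σ₀ * |x|) := by
  obtain ⟨c, C₁, C₂, W, hC₂, hWd, hdec, hWb⟩ := h.exists_heat_decomposition hj a b hk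
  have hσ := h.sigma_pos
  have hα := alpha_pos (S := S) hj
  set α := S.alpha j with hαdef
  set β := S.beta j with hβdef
  set J : ℝ := ∫ ξ : ℝ, (1 + |ξ|) * Real.exp (-α * ξ ^ 2) with hJ
  set D : ℝ := ‖c‖ * Real.exp (|β| + 2 * α) + (2 * Real.pi)⁻¹ * (|C₁| * Real.pi + C₂ * J) with hD
  have hJ0 : 0 ≤ J := integral_nonneg fun ξ => by positivity
  have hD0 : 0 ≤ D := by
    have := Real.pi_pos
    positivity
  refine ⟨D * Real.exp σs, fun t ht ht1 x => ?_⟩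
  obtain ⟨hi2, hJt⟩ := integral_mul_one_add_abs_mul_exp_le hα ht ht1.le
  have hbi : Integrable fun ξ : ℝ => C₁ / (1 + ξ ^ 2)
      + C₂ * (t * ((1 + |ξ|) * Real.exp (-(α * t) * ξ ^ 2))) :=
    (integrable_const_div_one_add_sq C₁).add (hi2.const_mul C₂)
  have hb0 : Filter.Tendsto (fun ξ : ℝ => C₁ / (1 + ξ ^ 2)
      + C₂ * (t * ((1 + |ξ|) * Real.exp (-(α * t) * ξ ^ 2)))) (Filter.cocompact ℝ) (nhds 0) := by
    have h1 := (((tendsto_mul_one_add_abs_mul_exp (mul_pos hα ht)).const_mul t).const_mul C₂)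
    simpa using (tendsto_const_div_one_add_sq C₁).add h1
  have hWi : Integrable fun η : ℝ => W t η := integrable_of_strip hσ (hWd t) hbi (hWb t ht ht1)
  have hHr := rapidDecay_heatSymbol β hα ht
  have hqi : Integrable fun η : ℝ => c * (oddSymbol η * heatSymbol α β t η) := by
    obtain ⟨hqm, Q, hQ⟩ := bddMeas_oddSymbol
    exact (hHr.integrable.bdd_mul hqm.aestronglyMeasurable
      (Filter.Eventually.of_forall hQ)).const_mul c
  have hsi : ∀ l ∈ Finset.range (k + 1), Integrable fun η : ℝ => (S.coeffM j a b l : ℂ)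
      * ((Complex.I * η) ^ (k - l) * heatSymbol α β t η) := fun l _ => (hHr _).const_mul _
  have hinv : invF (fun η : ℝ => (Complex.I * η) ^ k * S.GhatStar K j t (η : ℂ) a b) x
      = ((∑ l ∈ Finset.range (k + 1),
          S.coeffM j a b l * iteratedDeriv (k - l) (S.heat j t) x : ℝ) : ℂ)
        + c * invF (fun η : ℝ => oddSymbol η * heatSymbol α β t η) x
        + invF (fun η : ℝ => W t η) x := by
    simp only [hdec t]
    have hpq : Integrable fun η : ℝ => ∑ l ∈ Finset.range (k + 1), (S.coeffM j a b l : ℂ)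
        * ((Complex.I * η) ^ (k - l) * heatSymbol α β t η)
        + c * (oddSymbol η * heatSymbol α β t η) := (integrable_finsetSum _ hsi).add hqi
    rw [invF_add hpq hWi,
      invF_add (integrable_finsetSum _ hsi) hqi, invF_sum _ hsi, invF_const_mul c]
    congr 2
    push_cast
    refine Finset.sum_congr rfl fun l _ => ?_
    rw [invF_const_mul]
    congr 1
    exact (ofReal_iteratedDeriv_heatKer β hα ht (k - l) x).symm
  have hW1 := norm_invF_le_of_strip hσ (hWd t) hbi hb0 (hWb t ht ht1) x
  have hint : ∫ ξ : ℝ, (C₁ / (1 + ξ ^ 2)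
      + C₂ * (t * ((1 + |ξ|) * Real.exp (-(α * t) * ξ ^ 2)))) ≤ |C₁| * Real.pi + C₂ * J := by
    rw [integral_add (integrable_const_div_one_add_sq C₁) (hi2.const_mul C₂), integral_const_mul]
    simp only [div_eq_mul_inv]
    rw [integral_const_mul, integral_univ_inv_one_add_sq]
    have := Real.pi_pos
    gcongr
    exact le_abs_self C₁
  have hpi := Real.pi_pos
  have hW2 : ‖invF (fun η : ℝ => W t η) x‖
      ≤ (2 * Real.pi)⁻¹ * (|C₁| * Real.pi + C₂ * J) * Real.exp (-σ₀ * |x|) :=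
    hW1.trans (by gcongr)
  have hq : ‖invF (fun η : ℝ => oddSymbol η * heatSymbol α β t η) x‖
      ≤ Real.exp (|β| + 2 * α) * Real.exp (-σ₀ * |x|) := by
    refine (norm_invF_oddSymbol_mul_heatSymbol_le β hα ht x).trans ?_
    have h1 : (β + 2 * α) * t ≤ |β| + 2 * α := by
      have : β + 2 * α ≤ |β| + 2 * α := by linarith [le_abs_self β]
      have h0 : 0 ≤ |β| + 2 * α := by positivity
      nlinarith
    have h2 : -|x| ≤ -σ₀ * |x| := by nlinarith [h.sigma_lt_one, abs_nonneg x]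
    gcongr
  have hfin : Real.exp (-σ₀ * |x|) ≤ Real.exp σs * Real.exp (-σs * t - σ₀ * |x|) := by
    rw [← Real.exp_add]
    refine Real.exp_le_exp.2 ?_
    have := h.sigmaStar_pos
    nlinarith
  rw [hinv, add_assoc, add_sub_cancel_left]
  calc _ ≤ ‖c‖ * (Real.exp (|β| + 2 * α) * Real.exp (-σ₀ * |x|))
        + (2 * Real.pi)⁻¹ * (|C₁| * Real.pi + C₂ * J) * Real.exp (-σ₀ * |x|) := by
        refine (norm_add_le _ _).trans (add_le_add ?_ hW2)
        rw [norm_mul]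
        gcongr
    _ = D * Real.exp (-σ₀ * |x|) := by rw [hD]; ring
    _ ≤ D * (Real.exp σs * Real.exp (-σs * t - σ₀ * |x|)) := by gcongr
    _ = _ := by ring

end GasState

/-! ### The hyperbolic mode -/

namespace GasState

variable {S : GasState} {K : Fin 3 → ℝ} {σ₀ σs : ℝ}

/-- The first order effect of the eigenvalue remainder `ρ = λ_1^* - β_1`: only in the case `k = 2`
has `(iη)^k ρ M̂_1^*` a limit at infinity, which is `-A_{1,1} M_1^{*,0}`. -/
theorem Admissible.exists_eigRem_mul_MhatStar (h : S.Admissible K σ₀ σs) (a b : Fin 3) {k : ℕ}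
    (hk : k ≤ 2) :
    ∃ c : ℂ, StripDecay σ₀ fun η => S.eigRem K 0 η * ((Complex.I * η) ^ k * S.MhatStar K 0 η a b)
      - ((if k = 2 then -((S.A11 * S.M0 0 a b : ℝ) : ℂ) else 0) + c * oddSymbol η) := by
  obtain ⟨B, m, hB0, hB, hmM, hR⟩ := h.exists_MhatStar_bounds 0 a b
  have hσ1 := h.sigma_lt_one
  have hM0 : ((S.A11 * S.M0 0 a b : ℝ) : ℂ) = S.A11 * m 0 := by
    rw [hmM 0 (by norm_num)]
    push_cast
    rfl
  rw [hM0]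
  set M : ℂ → ℂ := fun η => S.MhatStar K 0 η a b with hM
  set F : ℂ → ℂ := fun η => (S.A 0 1 + S.A 0 2 * (1 + η ^ 2)⁻¹ - K 0 * ((1 + η ^ 2)⁻¹) ^ 2)
        * (1 + η ^ 2)⁻¹ with hF
  set A : ℂ := (S.A11 : ℂ) with hA
  have hFd : StripDecay σ₀ F := S.stripDecay_eigFactor hσ1 K 0
  have hzd := stripDecay_inv_one_add_sq hσ1
  obtain ⟨Z, hZ0, hZ⟩ := hzd.bounded
  have hρ : ∀ η, S.eigRem K 0 η = A * (1 + η ^ 2)⁻¹ + (1 + η ^ 2)⁻¹ * F η := S.eigRem_eq K 0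
  -- the leading order of the projection
  set R : ℂ → ℂ := fun η => (Complex.I * η) ^ 0 * S.MhatStar K 0 η a b
        - ∑ l ∈ Finset.range (0 + 1), m l * (Complex.I * η) ^ (0 - l)
        + m (0 + 1) * oddSymbol η with hRdef
  have hRd : StripDecay σ₀ R := hR 0 (by norm_num)
  have hMR : ∀ η, M η = m 0 - m 1 * oddSymbol η + R η := fun η => by
    rw [hRdef, hM]
    simp
  have hQ : ∀ η ∈ strip σ₀, ‖oddSymbol η‖ ≤ ((1 - σ₀) ^ 2)⁻¹ :=
    fun η hη => norm_oddSymbol_le hσ1 hη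
  interval_cases k
  · refine ⟨0, ?_⟩
    obtain ⟨C, hC⟩ := StripDecay.bdd_mul hB (S.stripDecay_eigRem hσ1 K 0)
    refine ⟨C, fun η hη => (le_of_eq ?_).trans (hC η hη)⟩
    congr 1
    simp
    ring
  · refine ⟨A * m 0, ?_⟩
    obtain ⟨C, hC⟩ := (((StripDecay.bdd_mul hQ hRd).const_mul A).add
      ((stripDecay_oddSymbol_mul_oddSymbol hσ1).const_mul (-(A * m 1)))).add
      (StripDecay.bdd_mul hQ (StripDecay.bdd_mul hB hFd))
    refine ⟨C, fun η hη => (le_of_eq ?_).trans (hC η hη)⟩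
    congr 1
    change S.eigRem K 0 η * ((Complex.I * η) ^ 1 * M η) - _ = _ + oddSymbol η * (M η * F η)
    rw [hρ, if_neg (by norm_num)]
    have e : (A * (1 + η ^ 2)⁻¹ + (1 + η ^ 2)⁻¹ * F η) * ((Complex.I * η) ^ 1 * M η)
        = A * oddSymbol η * M η + oddSymbol η * (M η * F η) := by
      rw [oddSymbol, div_eq_mul_inv]
      ring
    rw [e]
    have := hMR η
    linear_combination (A * oddSymbol η) * this
  · refine ⟨A * m 1, ?_⟩
    obtain ⟨C, hC⟩ := ((hRd.const_mul (-A)).add ((StripDecay.bdd_mul hB hzd).const_mul A)).add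
      (StripDecay.bdd_mul (f := fun η => (1 + η ^ 2)⁻¹ - 1) (B := Z + 1) (fun η hη => by
        refine (norm_sub_le _ _).trans ?_
        rw [norm_one]
        exact add_le_add (hZ η hη) le_rfl) (StripDecay.bdd_mul hB hFd))
    refine ⟨C, fun η hη => (le_of_eq ?_).trans (hC η hη)⟩
    congr 1
    change S.eigRem K 0 η * ((Complex.I * η) ^ 2 * M η) - _
      = _ + A * (M η * (1 + η ^ 2)⁻¹) + ((1 + η ^ 2)⁻¹ - 1) * (M η * F η)
    rw [hρ, if_pos rfl]
    have hz : (Complex.I * η) ^ 2 * (1 + η ^ 2)⁻¹ = (1 + η ^ 2)⁻¹ - 1 := by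
      have := one_add_sq_ne_zero_of_mem_strip hσ1 hη
      rw [mul_pow, Complex.I_sq]
      field_simp
      ring
    have := hMR η
    linear_combination (A * M η + M η * F η) * hz - A * this

/-- The limit at infinity `β_1` of `λ_1^*` inherits upper bounds, so that `e^{β_1 t}` decays at least
as fast as `e^{λ_1^* t}` is known to. -/
theorem Admissible.beta_zero_le (h : S.Admissible K σ₀ σs) {m : ℝ}
    (hm : ∀ η ∈ strip σ₀, (S.lamStar K 0 η).re ≤ m) : S.beta 0 ≤ m := by
  obtain ⟨C, hC⟩ := S.stripDecay_eigRem h.sigma_lt_one K 0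
  have h1 : Filter.Tendsto (fun x : ℝ => S.beta 0 - C / (1 + x ^ 2)) (Filter.cocompact ℝ)
      (nhds (S.beta 0 - 0)) := tendsto_const_nhds.sub (tendsto_const_div_one_add_sq C)
  rw [sub_zero] at h1
  refine le_of_tendsto h1 (Filter.Eventually.of_forall fun x => ?_)
  have hx := ofReal_mem_strip h.sigma_pos x
  have h2 := hC x hx
  have h3 := hm x hx
  have h4 : (S.lamStar K 0 x).re = S.beta 0 + (S.eigRem K 0 x).re := by
    rw [lamStar_eq]
    simp [alpha]
  have h5 := (abs_le.1 (Complex.abs_re_le_norm (S.eigRem K 0 x))).1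
  rw [Complex.ofReal_re] at h2
  linarith

/-- The coefficients of the delta distributions in the `k`-th derivative of the hyperbolic mode. -/
def deltaCoeff (S : GasState) (a b : Fin 3) (k : ℕ) (t : ℝ) (l : ℕ) : ℝ :=
  Real.exp (S.beta 0 * t) * (S.coeffM 0 a b (k - l)
    - if k = 2 ∧ l = 0 then S.A11 * t * S.M0 0 a b else 0)

/-- The decomposition of `(iη)^k Ĝ^{*,1}` into a polynomial, a multiple of `iη / (1 + η²)` and an
absolutely integrable remainder, from `e^{λ_1^* t} = e^{β_1 t} (1 + ρ t) + O(ρ² t² e^{m t})` with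
`ρ = λ_1^* - β_1` and `m < -σ₀^*`. -/
theorem Admissible.exists_delta_decomposition (h : S.Admissible K σ₀ σs) (a b : Fin 3) {k : ℕ}
    (hk : k ≤ 2) :
    ∃ C : ℝ, ∀ t : ℝ, 0 ≤ t → ∃ (c : ℂ) (R : ℂ → ℂ), DifferentiableOn ℂ R (strip σ₀) ∧
      ‖c‖ ≤ C * Real.exp (-σs * t) ∧
      (∀ η ∈ strip σ₀, ‖R η‖ ≤ C * Real.exp (-σs * t) / (1 + η.re ^ 2)) ∧
      ∀ η, (Complex.I * η) ^ k * S.GhatStar K 0 t η a b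
        = ∑ l ∈ Finset.range (k + 1), (S.deltaCoeff a b k t l : ℂ) * (Complex.I * η) ^ l
          + (c * oddSymbol η + R η) := by
  obtain ⟨B, m, hB0, hB, hmM, hR⟩ := h.exists_MhatStar_bounds 0 a b
  obtain ⟨c₁, hR'⟩ := h.exists_eigRem_mul_MhatStar a b hk
  have hσ1 := h.sigma_lt_one
  obtain ⟨C₁, hC₁0, hC₁⟩ := (hR k (by omega)).exists_bound
  obtain ⟨C₂, hC₂0, hC₂⟩ := hR'.exists_bound
  obtain ⟨Cρ, hCρ0, hCρ⟩ := (S.stripDecay_eigRem hσ1 K 0).exists_bound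
  obtain ⟨μ, hμ, hre⟩ := h.gap_one
  have hβμ := h.beta_zero_le hre
  set β := S.beta 0 with hβ
  set M : ℂ → ℂ := fun η => (Complex.I * η) ^ k * S.MhatStar K 0 η a b with hM
  set R₁ : ℂ → ℂ := fun η => M η
        - ∑ l ∈ Finset.range (k + 1), m l * (Complex.I * η) ^ (k - l)
        + m (k + 1) * oddSymbol η with hR₁
  set κ : ℂ := if k = 2 then -((S.A11 * S.M0 0 a b : ℝ) : ℂ) else 0 with hκ
  set R₂ : ℂ → ℂ := fun η => S.eigRem K 0 η * M η - (κ + c₁ * oddSymbol η) with hR₂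
  -- powers of `t` are absorbed by the strict gap `μ < -σs`
  set δ : ℝ := -σs - μ with hδ
  have hδ0 : 0 < δ := by rw [hδ]; linarith
  set N : ℝ := 1 + 1 / δ + 2 / δ ^ 2 with hN
  have hN0 : 0 < N := by positivity
  have hpoly : ∀ t : ℝ, 0 ≤ t → Real.exp (μ * t) * (1 + t + t ^ 2)
      ≤ N * Real.exp (-σs * t) := by
    intro t ht
    have hz : 0 ≤ δ * t := by positivity
    have hq := Real.quadratic_le_exp_of_nonneg hz
    have h1 : (1:ℝ) ≤ Real.exp (δ * t) := Real.one_le_exp hz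
    have h2 : t ≤ 1 / δ * Real.exp (δ * t) := by
      rw [one_div, inv_mul_eq_div, le_div_iff₀ hδ0]
      nlinarith [sq_nonneg (δ * t)]
    have h3 : t ^ 2 ≤ 2 / δ ^ 2 * Real.exp (δ * t) := by
      rw [div_mul_eq_mul_div, le_div_iff₀ (by positivity)]
      nlinarith
    have h4 : Real.exp (-σs * t) = Real.exp (μ * t) * Real.exp (δ * t) := by
      rw [← Real.exp_add, hδ]
      congr 1
      ring
    rw [h4]
    calc _ ≤ Real.exp (μ * t) * (N * Real.exp (δ * t)) := by
          gcongr
          rw [hN]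
          linarith
      _ = _ := by ring
  set C : ℝ := (‖m (k + 1)‖ + ‖c₁‖ + C₁ + C₂ + Cρ ^ 2 * B) with hC
  have hC0 : 0 ≤ C := by positivity
  refine ⟨C * N, fun t ht => ?_⟩
  have hexpβ : Real.exp (β * t) ≤ Real.exp (μ * t) :=
    Real.exp_le_exp.2 (mul_le_mul_of_nonneg_right hβμ ht)
  set e : ℂ := (Real.exp (β * t) : ℂ) with he
  have hen : ‖e‖ = Real.exp (β * t) := by
    rw [he, Complex.norm_real, Real.norm_of_nonneg (Real.exp_pos _).le]
  have hp1 : 1 ≤ 1 + t + t ^ 2 := by nlinarith [sq_nonneg t]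
  have hpt : t ≤ 1 + t + t ^ 2 := by nlinarith [sq_nonneg t]
  have hpt2 : t ^ 2 ≤ 1 + t + t ^ 2 := by linarith
  set P : ℝ := Real.exp (μ * t) * (1 + t + t ^ 2) with hP
  have hP0 : 0 ≤ P := by positivity
  have he1 : ‖e‖ ≤ P := by
    rw [hen]
    exact hexpβ.trans (le_mul_of_one_le_right (Real.exp_pos _).le hp1)
  have het : ‖e * t‖ ≤ P := by
    rw [norm_mul, hen, Complex.norm_real, Real.norm_of_nonneg ht]
    exact mul_le_mul hexpβ hpt ht (Real.exp_pos _).le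
  have hPN : C * P ≤ C * N * Real.exp (-σs * t) := by
    rw [mul_assoc]
    exact mul_le_mul_of_nonneg_left (hpoly t ht) hC0
  set Er : ℂ → ℂ := fun η => (Complex.exp (S.lamStar K 0 η * t) - e * (1 + S.eigRem K 0 η * t))
    * M η with hEr
  set c : ℂ := e * -m (k + 1) + e * t * c₁ with hc
  have hsum : ∀ η, ∑ l ∈ Finset.range (k + 1), (S.deltaCoeff a b k t l : ℂ) * (Complex.I * η) ^ l
      = e * ∑ l ∈ Finset.range (k + 1), m l * (Complex.I * η) ^ (k - l) + e * t * κ := by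
    intro η
    have h0 : (e * t * κ : ℂ) = ∑ l ∈ Finset.range (k + 1),
        (if l = 0 then e * t * κ else 0) := by
      rw [Finset.sum_ite_eq' (Finset.range (k + 1)) 0, if_pos (by simp)]
    rw [h0, Finset.mul_sum, ← Finset.sum_range_reflect (fun l => e * (m l * _)),
      ← Finset.sum_add_distrib]
    refine Finset.sum_congr rfl fun l hl => ?_
    have hl' := Finset.mem_range.1 hl
    have e1 : k + 1 - 1 - l = k - l := by omega
    have e2 : k - (k - l) = l := by omega
    rw [e1, e2, hmM (k - l) (by omega), deltaCoeff, hκ,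
      Complex.ofReal_mul]
    change e * _ * _ = _
    by_cases hl0 : l = 0 <;> by_cases hk2 : k = 2 <;> simp [hl0, hk2] <;> ring
  have hdec : ∀ η, (Complex.I * η) ^ k * S.GhatStar K 0 t η a b
      = ∑ l ∈ Finset.range (k + 1), (S.deltaCoeff a b k t l : ℂ) * (Complex.I * η) ^ l
        + (c * oddSymbol η + (e * R₁ η + e * t * R₂ η + Er η)) := by
    intro η
    rw [hsum, GhatStar_apply, hEr, hR₂, hR₁, hc, hM]
    ring
  refine ⟨c, fun η => e * R₁ η + e * t * R₂ η + Er η, ?_, ?_, ?_, hdec⟩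
  · have hd : DifferentiableOn ℂ (fun η => (Complex.I * η) ^ k * S.GhatStar K 0 t η a b
        - ∑ l ∈ Finset.range (k + 1), (S.deltaCoeff a b k t l : ℂ) * (Complex.I * η) ^ l
        - c * oddSymbol η) (strip σ₀) :=
      ((DifferentiableOn.mul (by fun_prop) (h.differentiableOn_GhatStar 0 a b t)).sub
        (by fun_prop)).sub ((differentiableOn_oddSymbol hσ1).const_mul c)
    refine hd.congr fun η _ => ?_
    rw [hdec]
    ring
  · refine le_trans ?_ hPN
    have h1 : ‖c‖ ≤ P * ‖m (k + 1)‖ + P * ‖c₁‖ := by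
      refine (norm_add_le _ _).trans (add_le_add ?_ ?_)
      · rw [norm_mul, norm_neg]
        gcongr
      · rw [norm_mul]
        gcongr
    have h2 : 0 ≤ (C₁ + C₂ + Cρ ^ 2 * B) * P := by positivity
    rw [hC]
    linarith
  · intro η hη
    refine le_trans ?_ (div_le_div_of_nonneg_right hPN (by positivity))
    have hpos : (0:ℝ) < 1 + η.re ^ 2 := by positivity
    have hEb : ‖Er η‖ ≤ P * (Cρ ^ 2 * B) / (1 + η.re ^ 2) := by
      have hz0 : ((β : ℂ) * t).re ≤ μ * t := by
        rw [← Complex.ofReal_mul, Complex.ofReal_re]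
        exact mul_le_mul_of_nonneg_right hβμ ht
      have hl : S.lamStar K 0 η = β + S.eigRem K 0 η := by
        have hα : S.alpha 0 = 0 := rfl
        rw [lamStar_eq, hα]
        simp [hβ]
      have hz1 : ((β : ℂ) * t + S.eigRem K 0 η * t).re ≤ μ * t := by
        rw [← add_mul, ← hl, Complex.re_mul_ofReal]
        exact mul_le_mul_of_nonneg_right (hre η hη) ht
      have h1 := norm_exp_add_sub_le hz0 hz1
      rw [← add_mul, ← hl, show Complex.exp ((β : ℂ) * t) = e by rw [he]; push_cast; rfl,
        norm_mul, Complex.norm_real, Real.norm_of_nonneg ht] at h1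
      have h2 : ‖M η‖ ≤ (1 + η.re ^ 2) * B := by
        rw [hM, norm_mul]
        exact mul_le_mul (norm_pow_le_of_mem_strip hσ1 hη hk) (hB η hη) (norm_nonneg _) hpos.le
      rw [hEr, norm_mul]
      calc _ ≤ (Real.exp (μ * t) * (‖S.eigRem K 0 η‖ * t) ^ 2) * ((1 + η.re ^ 2) * B) :=
            mul_le_mul h1 h2 (norm_nonneg _) (by positivity)
        _ ≤ (Real.exp (μ * t) * (Cρ / (1 + η.re ^ 2) * t) ^ 2) * ((1 + η.re ^ 2) * B) := by
            gcongr
            exact hCρ η hη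
        _ = Real.exp (μ * t) * t ^ 2 * (Cρ ^ 2 * B) / (1 + η.re ^ 2) := by
            field_simp
        _ ≤ _ := by
            rw [hP]
            gcongr
    have h1 : ‖e * R₁ η‖ ≤ P * C₁ / (1 + η.re ^ 2) := by
      rw [norm_mul, mul_div_assoc]
      exact mul_le_mul he1 (hC₁ η hη) (norm_nonneg _) hP0
    have h2 : ‖e * t * R₂ η‖ ≤ P * C₂ / (1 + η.re ^ 2) := by
      rw [norm_mul, mul_div_assoc]
      exact mul_le_mul het (hC₂ η hη) (norm_nonneg _) hP0
    have h3 := (norm_add_le (e * R₁ η + e * t * R₂ η) (Er η)).trans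
      (add_le_add (norm_add_le (e * R₁ η) (e * t * R₂ η)) le_rfl)
    refine h3.trans ((add_le_add (add_le_add h1 h2) hEb).trans ?_)
    rw [← add_div, ← add_div]
    refine div_le_div_of_nonneg_right ?_ hpos.le
    have h4 : 0 ≤ (‖m (k + 1)‖ + ‖c₁‖) * P := by positivity
    rw [hC]
    linarith

/-- The derivatives of the hyperbolic mode are combinations of delta distributions, up to a
function with exponential decay. -/
theorem Admissible.exists_hyperbolic_remainder (h : S.Admissible K σ₀ σs) (a b : Fin 3) {k : ℕ}
    (hk : k ≤ 2) :
    ∃ C : ℝ, ∀ t : ℝ, 0 ≤ t → ∃ r : ℝ → ℂ, Measurable r ∧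
      (∀ x, ‖r x‖ ≤ C * Real.exp (-σs * t - σ₀ * |x|)) ∧
      (TemperedDistribution.derivCLM ℂ)^[k]
        (invFourierDist fun η : ℝ => S.GhatStar K 0 t (η : ℂ) a b)
        = ∑ l ∈ Finset.range (k + 1), (S.deltaCoeff a b k t l : ℂ) •
            (TemperedDistribution.derivCLM ℂ)^[l] (TemperedDistribution.delta (0 : ℝ))
          + distOf r := by
  obtain ⟨C, hC⟩ := h.exists_delta_decomposition a b hk
  have hσ := h.sigma_pos
  refine ⟨C, fun t ht => ?_⟩
  obtain ⟨c, R, hRd, hcb, hRb, hdec⟩ := hC t ht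
  set D : ℝ := C * Real.exp (-σs * t) with hD
  have hRi : Integrable fun η : ℝ => R η :=
    integrable_of_strip hσ hRd (integrable_const_div_one_add_sq D) hRb
  have hRm : BddMeas fun η : ℝ => R η :=
    ⟨(continuous_ofReal_of_differentiableOn_strip hσ hRd).measurable, |D|, fun x => by
      refine (hRb x (ofReal_mem_strip hσ x)).trans ((div_le_div_of_nonneg_right (le_abs_self D)
        (by positivity)).trans (div_le_self (abs_nonneg D) ?_))
      nlinarith [sq_nonneg (x : ℂ).re]⟩
  have hIm : BddMeas (invF fun η : ℝ => R η) :=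
    ⟨(continuous_invF hRi).measurable, _, fun x => norm_invF_le _ x⟩
  refine ⟨fun x => c * oddExp x + invF (fun η : ℝ => R η) x,
    (measurable_oddExp.const_mul c).add (continuous_invF hRi).measurable, fun x => ?_, ?_⟩
  · have h1 := norm_invF_le_of_stripDecay hσ hRd hRb x
    have h2 : ‖c * oddExp x‖ ≤ D / 2 * Real.exp (-σ₀ * |x|) := by
      rw [norm_mul, norm_oddExp]
      have h3 : Real.exp (-|x|) ≤ Real.exp (-σ₀ * |x|) :=
        Real.exp_le_exp.2 (by nlinarith [h.sigma_lt_one, abs_nonneg x])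
      calc ‖c‖ * (Real.exp (-|x|) / 2) ≤ D * (Real.exp (-σ₀ * |x|) / 2) :=
            mul_le_mul hcb (by linarith) (by positivity) ((norm_nonneg c).trans hcb)
        _ = _ := by ring
    refine (norm_add_le _ _).trans ((add_le_add h2 h1).trans (le_of_eq ?_))
    rw [sub_eq_add_neg, Real.exp_add, hD, ← neg_mul]
    ring
  · rw [iterate_derivCLM_invFourierDist (h.bddMeas_GhatStar 0 a b ht)
      ((bddMeas_oddSymbol.const_mul c).add hRm) k (k + 1) (fun l => (S.deltaCoeff a b k t l : ℂ))
      (fun η => hdec η), invFourierDist_add (bddMeas_oddSymbol.const_mul c) hRm,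
      invFourierDist_const_mul bddMeas_oddSymbol, invFourierDist_oddSymbol,
      invFourierDist_eq_distOf_invF hRm hRi, distOf_add (bddMeas_oddExp.const_mul c) hIm,
      distOf_const_mul bddMeas_oddExp]

end GasState

/-! ### Assembling the entries -/

/-- Finitely many bounds that persist when the constant grows hold with a common constant. -/
theorem exists_common_const {ι : Type*} [Finite ι] {P : ι → ℝ → Prop}
    (hmono : ∀ i C D, C ≤ D → P i C → P i D) (h : ∀ i, ∃ C, P i C) : ∃ C, ∀ i, P i C := by
  choose c hc using h
  obtain ⟨C, hC⟩ := Finite.exists_le c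
  exact ⟨C, fun i => hmono i _ _ (hC i) (hc i)⟩

theorem eqUpToExp_of_entries {C σ₀ σs t : ℝ} {T main : MatDist}
    (h : ∀ a b, ∃ r : ℝ → ℂ, Measurable r ∧
      (∀ x, ‖r x‖ ≤ C * Real.exp (-σs * t - σ₀ * |x|)) ∧ T a b = main a b + distOf r) :
    EqUpToExp C σ₀ σs t T main := by
  choose r hm hb hT using h
  refine ⟨fun x => Matrix.of fun a b => r a b x, hm, fun x a b => hb a b x, ?_⟩
  ext1 a b
  exact hT a b

namespace GasState

variable {S : GasState} {K : Fin 3 → ℝ} {σ₀ σs : ℝ}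

theorem Admissible.exists_hyperbolic_const (h : S.Admissible K σ₀ σs) :
    ∃ C : ℝ, ∀ k ≤ 2, ∀ a b : Fin 3, ∀ t : ℝ, 0 ≤ t → ∃ r : ℝ → ℂ, Measurable r ∧
      (∀ x, ‖r x‖ ≤ C * Real.exp (-σs * t - σ₀ * |x|)) ∧
      (TemperedDistribution.derivCLM ℂ)^[k] (S.greenStarPart K 0 t a b)
        = ∑ l ∈ Finset.range (k + 1), (S.deltaCoeff a b k t l : ℂ) •
            (TemperedDistribution.derivCLM ℂ)^[l] (TemperedDistribution.delta (0 : ℝ))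
          + distOf r := by
  obtain ⟨C, hC⟩ := exists_common_const (ι := Fin 3 × Fin 3 × Fin 3)
    (fun _ C D hCD hP t ht => by
      obtain ⟨r, hr, hb, he⟩ := hP t ht
      exact ⟨r, hr, fun x => (hb x).trans (by gcongr), he⟩)
    (fun i => h.exists_hyperbolic_remainder i.2.1 i.2.2 (k := i.1) (by omega))
  exact ⟨C, fun k hk a b => hC (⟨k, by omega⟩, a, b)⟩

theorem Admissible.exists_large_time_const (h : S.Admissible K σ₀ σs) :
    ∃ C : ℝ, ∀ j : Fin 3, j ≠ 0 → ∀ a b : Fin 3, ∀ k ≤ 2, ∀ t : ℝ, 1 ≤ t → ∀ x,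
      ‖invF (fun η => (Complex.I * η) ^ k * S.GhatStar K j t (η : ℂ) a b) x‖
        ≤ C * Real.exp (-σs * t - σ₀ * |x|) := by
  obtain ⟨C, hC⟩ := exists_common_const (ι := {j : Fin 3 // j ≠ 0} × Fin 3 × Fin 3)
    (fun _ C D hCD hP k hk t ht x => (hP k hk t ht x).trans (by gcongr))
    (fun i => h.exists_norm_invF_GhatStar_le i.1.2 i.2.1 i.2.2)
  exact ⟨C, fun j hj a b => hC (⟨j, hj⟩, a, b)⟩

theorem Admissible.exists_small_time_const (h : S.Admissible K σ₀ σs) :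
    ∃ C : ℝ, ∀ j : Fin 3, j ≠ 0 → ∀ a b : Fin 3, ∀ k ≤ 3, ∀ t : ℝ, 0 < t → t < 1 → ∀ x,
      ‖invF (fun η => (Complex.I * η) ^ k * S.GhatStar K j t (η : ℂ) a b) x
        - ((∑ l ∈ Finset.range (k + 1), S.coeffM j a b l
            * iteratedDeriv (k - l) (S.heat j t) x : ℝ) : ℂ)‖
        ≤ C * Real.exp (-σs * t - σ₀ * |x|) := by
  obtain ⟨C, hC⟩ := exists_common_const (ι := {j : Fin 3 // j ≠ 0} × Fin 3 × Fin 3 × Fin 4)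
    (fun _ C D hCD hP t ht ht1 x => (hP t ht ht1 x).trans (by gcongr))
    (fun i => h.exists_norm_invF_sub_heat_le i.1.2 i.2.1 i.2.2.1 (k := i.2.2.2) (by omega))
  exact ⟨C, fun j hj a b k hk => hC (⟨j, hj⟩, a, b, ⟨k, by omega⟩)⟩

theorem Admissible.greenStar_eq_sum (h : S.Admissible K σ₀ σs) {t : ℝ} (ht : 0 ≤ t) :
    S.greenStar K t = ∑ j, S.greenStarPart K j t := by
  ext1 a b
  rw [Matrix.sum_apply]
  simp only [greenStar, greenStarPart, Matrix.of_apply, Matrix.sum_apply]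
  exact invFourierDist_sum _ fun j => h.bddMeas_GhatStar j a b ht

theorem Admissible.greenStarPart_eq_matDistOf (h : S.Admissible K σ₀ σs) {j : Fin 3} (hj : j ≠ 0)
    {t : ℝ} (ht : 0 < t) :
    S.greenStarPart K j t
      = matDistOf fun x => Matrix.of fun a b => invF (fun η => S.GhatStar K j t (η : ℂ) a b) x := by
  ext1 a b
  exact invFourierDist_eq_distOf_invF (h.bddMeas_GhatStar j a b ht.le)
    (h.rapidDecay_GhatStar hj a b ht).integrable

end GasState

end

theorem theorem4p1 (S : GasState) :
    (∃ (K : Fin 3 → ℝ) (σ₀ σs : ℝ), S.Admissible K σ₀ σs) ∧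
    ∀ (K : Fin 3 → ℝ) (σ₀ σs : ℝ), S.Admissible K σ₀ σs →
      -- the parts are well defined and add up to the singular part
      (∀ (j : Fin 3) (t : ℝ), 0 ≤ t → ∀ a b : Fin 3,
        MemLp (fun η : ℝ => S.GhatStar K j t (η : ℂ) a b) ∞ volume) ∧
      (∀ t : ℝ, 0 ≤ t → S.greenStar K t = ∑ j, S.greenStarPart K j t) ∧
      ∃ C : ℝ, 0 < C ∧
        -- the first part
        (∀ t : ℝ, 0 ≤ t →
          EqUpToExp C σ₀ σs t (S.greenStarPart K 0 t)
            (deltaDist 0 (Real.exp (S.v * S.pv / S.mu * t) • S.M0 0)) ∧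
          EqUpToExp C σ₀ σs t (dxDist 1 (S.greenStarPart K 0 t))
            (deltaDist 1 (Real.exp (S.v * S.pv / S.mu * t) • S.M0 0)
              - deltaDist 0 (Real.exp (S.v * S.pv / S.mu * t) • S.M1 0)) ∧
          EqUpToExp C σ₀ σs t (dxDist 2 (S.greenStarPart K 0 t))
            (deltaDist 2 (Real.exp (S.v * S.pv / S.mu * t) • S.M0 0)
              - deltaDist 1 (Real.exp (S.v * S.pv / S.mu * t) • S.M1 0)
              + deltaDist 0 (Real.exp (S.v * S.pv / S.mu * t) •
                  (-S.M2 0 - (S.A11 * t) • S.M0 0)))) ∧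
        -- the second and the third part
        ∀ j : Fin 3, j ≠ 0 → ∀ t : ℝ, 0 < t →
          ∃ G : ℝ → Matrix (Fin 3) (Fin 3) ℂ,
            (∀ a b, ContDiff ℝ ∞ fun x => G x a b) ∧
            S.greenStarPart K j t = matDistOf G ∧
            (1 ≤ t → ∀ k ≤ 2, ∀ (x : ℝ) (a b : Fin 3),
              ‖iteratedDeriv k (fun y => G y a b) x‖
                ≤ C * Real.exp (-σs * t - σ₀ * |x|)) ∧
            (t < 1 → ∀ (x : ℝ) (a b : Fin 3),
              ‖G x a b - (S.heat j t x * S.M0 j a b : ℝ)‖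
                  ≤ C * Real.exp (-σs * t - σ₀ * |x|) ∧
              ‖deriv (fun y => G y a b) x
                  - (deriv (S.heat j t) x * S.M0 j a b - S.heat j t x * S.M1 j a b : ℝ)‖
                  ≤ C * Real.exp (-σs * t - σ₀ * |x|) ∧
              ‖iteratedDeriv 2 (fun y => G y a b) x
                  - (iteratedDeriv 2 (S.heat j t) x * S.M0 j a b
                    - deriv (S.heat j t) x * S.M1 j a b
                    - S.heat j t x * S.M2 j a b : ℝ)‖
                  ≤ C * Real.exp (-σs * t - σ₀ * |x|) ∧
              ‖iteratedDeriv 3 (fun y => G y a b) x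
                  - (iteratedDeriv 3 (S.heat j t) x * S.M0 j a b
                    - iteratedDeriv 2 (S.heat j t) x * S.M1 j a b
                    - deriv (S.heat j t) x * S.M2 j a b
                    + S.heat j t x * S.M3 j a b : ℝ)‖
                  ≤ C * Real.exp (-σs * t - σ₀ * |x|)) := by
  refine ⟨S.exists_admissible, fun K σ₀ σs h =>
    ⟨fun j t ht a b => (h.bddMeas_GhatStar j a b ht).memLp,
    fun t ht => h.greenStar_eq_sum ht, ?_⟩⟩
  obtain ⟨C₁, h₁⟩ := h.exists_hyperbolic_const
  obtain ⟨C₂, h₂⟩ := h.exists_large_time_const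
  obtain ⟨C₃, h₃⟩ := h.exists_small_time_const
  set C := |C₁| + |C₂| + |C₃| + 1 with hC
  have hC₁ : C₁ ≤ C := by linarith [le_abs_self C₁, abs_nonneg C₂, abs_nonneg C₃]
  have hC₂ : C₂ ≤ C := by linarith [le_abs_self C₂, abs_nonneg C₁, abs_nonneg C₃]
  have hC₃ : C₃ ≤ C := by linarith [le_abs_self C₃, abs_nonneg C₁, abs_nonneg C₂]
  refine ⟨C, by positivity, fun t ht => ?_, fun j hj t ht => ?_⟩
  · have key : ∀ k ≤ 2, ∀ main : MatDist,
        (∀ a b, main a b = ∑ l ∈ Finset.range (k + 1), (S.deltaCoeff a b k t l : ℂ) •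
            (TemperedDistribution.derivCLM ℂ)^[l] (TemperedDistribution.delta (0 : ℝ))) →
        EqUpToExp C σ₀ σs t (dxDist k (S.greenStarPart K 0 t)) main := by
      intro k hk main hmain
      refine eqUpToExp_of_entries fun a b => ?_
      obtain ⟨r, hr, hb, he⟩ := h₁ k hk a b t ht
      exact ⟨r, hr, fun x => (hb x).trans (by gcongr), by rw [hmain a b, ← he]; rfl⟩
    have hβ : S.v * S.pv / S.mu = S.beta 0 := rfl
    rw [hβ]
    refine ⟨key 0 (by norm_num) _ fun a b => ?_, key 1 (by norm_num) _ fun a b => ?_,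
      key 2 (by norm_num) _ fun a b => ?_⟩
    · simp [deltaDist, GasState.deltaCoeff, GasState.coeffM]
    · simp [deltaDist, GasState.deltaCoeff, GasState.coeffM, Finset.sum_range_succ]
      module
    · simp [deltaDist, GasState.deltaCoeff, GasState.coeffM, Finset.sum_range_succ]
      module
  · have hR := fun a b => h.rapidDecay_GhatStar hj a b ht
    have hder : ∀ (k : ℕ) (a b : Fin 3),
        iteratedDeriv k (invF fun η => S.GhatStar K j t (η : ℂ) a b)
          = invF fun η => (Complex.I * η) ^ k * S.GhatStar K j t (η : ℂ) a b :=
      fun k a b => (hR a b).iteratedDeriv_invF k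
    refine ⟨_, fun a b => (hR a b).contDiff_invF, h.greenStarPart_eq_matDistOf hj ht, ?_, ?_⟩
    · intro ht1 k hk x a b
      change ‖iteratedDeriv k (invF fun η => S.GhatStar K j t (η : ℂ) a b) x‖ ≤ _
      rw [hder]
      exact (h₂ j hj a b k hk t ht1 x).trans (by gcongr)
    · intro ht1 x a b
      have key : ∀ k ≤ 3, ‖iteratedDeriv k (invF fun η => S.GhatStar K j t (η : ℂ) a b) x
          - ((∑ l ∈ Finset.range (k + 1), S.coeffM j a b l
            * iteratedDeriv (k - l) (S.heat j t) x : ℝ) : ℂ)‖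
          ≤ C * Real.exp (-σs * t - σ₀ * |x|) := by
        intro k hk
        rw [hder]
        exact (h₃ j hj a b k hk t ht ht1 x).trans (by gcongr)
      refine ⟨?_, ?_, ?_, ?_⟩
      · convert key 0 (by norm_num) using 4
        · simp
        · simp [GasState.coeffM, mul_comm]
      · convert key 1 (by norm_num) using 4
        · rw [iteratedDeriv_one]
        · simp [GasState.coeffM, Finset.sum_range_succ, iteratedDeriv_one]
          ring
      · convert key 2 (by norm_num) using 4
        simp [GasState.coeffM, Finset.sum_range_succ, iteratedDeriv_one]
        ring
      · convert key 3 (by norm_num) using 4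
        simp [GasState.coeffM, Finset.sum_range_succ, iteratedDeriv_one]
        ring
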